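/- For $1\le q\le\infty$ and $n\ge 1$ let $B_q^n=\{x\in\mathbb{R}^n:\sum_{i=1}^n|x_i|^q\le 1\}$ if $q<\infty$ and $B_\infty^n=\{x\in\mathbb{R}^n:\max_i|x_i|\le 1\}$; put $1/\infty=0$. For a convex body $K\subset\mathbb{R}^n$ with $K=-K$ let $x_0,x_1,\dots,x_n$ be independent random points uniformly distributed in $K$, and let $$U_K=\frac{|\mathrm{conv}\{x_0,\dots,x_n\}|}{|K|},\qquad V_K=\frac{|\mathrm{conv}\{\pm x_1,\dots,\pm x_n\}|}{|K|},$$ where $|\cdot|$ is volume. Write $\|X\|_p=(\mathbb{E}|X|^p)^{1/p}$, and write $f\simeq g$ if $f=(1+o(1))g$ as $n\to\infty$. Define $$\varphi(t,n)=\Bigl(1-\frac{2t}{n+2}+\frac{t^2}{(n+1)(n+2)}\Bigr)\sum_{k=0}^n\frac{t^k}{k!}+\frac{t^{n+1}}{(n+1)!}-\frac{t^{n+2}}{(n+2)!},$$ $$A_q=\frac{9\,\Gamma(1+\frac1q)\,\Gamma(1+\frac5q)}{5\,\Gamma(1+\frac3q)^2},\qquad \alpha(t)=\frac{e^{1-2t}\,\Gamma(1+3t)}{3\,\Gamma(1+t)^3}\quad(0\le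 t\le 1).$$ (1) For all $1\le q\le\infty$ and $n\ge 1$, $$\mathbb{E}V_{B_q^n}^2=\frac1{n!}\left(\frac{\Gamma(1+\frac3q)\,\Gamma(1+\frac nq)}{3\,\Gamma(1+\frac1q)^3\,\Gamma(1+\frac{n+2}q)}\right)^{n}\Gamma\Bigl(1+\frac nq\Bigr)^2,$$ $$\mathbb{E}V_{B_q^n}^4=\frac{(n+1)(n+2)}{2(n!)^2}\left(\frac{\Gamma(1+\frac3q)^2\,\Gamma(1+\frac nq)}{9\,\Gamma(1+\frac1q)^6\,\Gamma(1+\frac{n+4}q)}\right)^{n}\Gamma\Bigl(1+\frac nq\Bigr)^4\varphi(A_q-3,n),$$ and, if $n\ge 2$, $A_q=\int_{B_q^n}x_i^4\,dx\big/\int_{B_q^n}x_i^2x_j^2\,dx$ for all $i\ne j$. (2) For every fixed $1\le q\le\infty$, as $n\to\infty$, $$\bigl(\mathbb{E}V_{B_q^n}^2\bigr)^{1/n}\simeq\alpha(1/q)\,n^{-1},\qquad \bigl(\mathbb{E}V_{B_q^n}^4\bigr)^{1/n}\simeq\alpha(1/q)^2\,n^{-2}.$$ (3) For all fixed $1\le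 p\le 4$ and $1\le q\le\infty$, as $n\to\infty$, $$\|V_{B_q^n}\|_p^{1/n}\simeq\sqrt{\alpha(1/q)}\,n^{-1/2},\qquad \|U_{B_q^n}\|_p^{1/n}\simeq\tfrac12\sqrt{\alpha(1/q)}\,n^{-1/2}.$$ (4) The function $\alpha$ attains its maximum over $[0,1]$ at $t=0$; and for every $1\le p\le 4$ there is $n_0$ such that for every $n\ge n_0$ both $\|V_{B_q^n}\|_p$ and $\|U_{B_q^n}\|_p$ are maximized over $1\le q\le\infty$ at $q=\infty$, that is, $\|V_{B_q^n}\|_p\le\|V_{B_\infty^n}\|_p$ and $\|U_{B_q^n}\|_p\le\|U_{B_\infty^n}\|_p$ for all $1\le q\le\infty$. -/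

import Mathlib

open MeasureTheory Filter Asymptotics
open scoped ENNReal Nat Pointwise

noncomputable section

/-- The unit ball `B_q^n` of `ℓ_q^n`, for an exponent `q ∈ [1, ∞]`. -/
def lqBall (q : ℝ≥0∞) (n : ℕ) : Set (Fin n → ℝ) :=
  if q = ∞ then {x | ∀ i, |x i| ≤ 1} else {x | ∑ i, |x i| ^ q.toReal ≤ 1}

/-- The volume (Lebesgue measure) of a subset of `ℝ^n`, as a real number. -/
def vol {n : ℕ} (A : Set (Fin n → ℝ)) : ℝ :=
  (volume A).toReal

/-- The joint law of `N` independent random points, each uniformly distributed in `K ⊆ ℝ^n`. -/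
def uniformPoints {n : ℕ} (K : Set (Fin n → ℝ)) (N : ℕ) : Measure (Fin N → Fin n → ℝ) :=
  Measure.pi fun _ => ProbabilityTheory.cond volume K

/-- `U_K`: the normalized volume of the random simplex spanned by `n + 1` points. -/
def simplexVol {n : ℕ} (K : Set (Fin n → ℝ)) (x : Fin (n + 1) → Fin n → ℝ) : ℝ :=
  vol (convexHull ℝ (Set.range x)) / vol K

/-- `V_K`: the normalized volume of the random crosspolytope spanned by `± x_1, …, ± x_n`. -/
def crosspolytopeVol {n : ℕ} (K : Set (Fin n → ℝ)) (x : Fin n → Fin n → ℝ) : ℝ :=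
  vol (convexHull ℝ (Set.range x ∪ -Set.range x)) / vol K

/-- The moment `E V_K ^ m`. -/
def crosspolytopeMoment {n : ℕ} (K : Set (Fin n → ℝ)) (m : ℕ) : ℝ :=
  ∫ x, crosspolytopeVol K x ^ m ∂(uniformPoints K n)

/-- `‖V_K‖_p`. -/
def crosspolytopeNorm {n : ℕ} (K : Set (Fin n → ℝ)) (p : ℝ≥0∞) : ℝ :=
  lpNorm (crosspolytopeVol K) p (uniformPoints K n)

/-- `‖U_K‖_p`. -/
def simplexNorm {n : ℕ} (K : Set (Fin n → ℝ)) (p : ℝ≥0∞) : ℝ :=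
  lpNorm (simplexVol K) p (uniformPoints K (n + 1))

/-- `1 / q` as a real number, with `1 / ∞ = 0`. -/
def recip (q : ℝ≥0∞) : ℝ := q⁻¹.toReal

/-- The constant `A_q`, as a function of `t = 1 / q`. -/
def momentRatio (t : ℝ) : ℝ :=
  9 * Real.Gamma (1 + t) * Real.Gamma (1 + 5 * t) / (5 * Real.Gamma (1 + 3 * t) ^ 2)

/-- The function `φ(t, n)`. -/
def phiFun (t : ℝ) (n : ℕ) : ℝ :=
  (1 - 2 * t / ((n : ℝ) + 2) + t ^ 2 / (((n : ℝ) + 1) * ((n : ℝ) + 2))) *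
      ∑ k ∈ Finset.range (n + 1), t ^ k / (k ! : ℝ)
    + t ^ (n + 1) / ((n + 1)! : ℝ) - t ^ (n + 2) / ((n + 2)! : ℝ)

/-- The function `α(t)`. -/
def alphaFun (t : ℝ) : ℝ :=
  Real.exp (1 - 2 * t) * Real.Gamma (1 + 3 * t) / (3 * Real.Gamma (1 + t) ^ 3)

end

/-! Up to the factors `n!` and `vol K`, V is `2 ^ n` times the absolute determinant of a matrix with
independent uniform rows, and U is the absolute determinant of the bordered matrix with rows `(1, x
i)`. Everything is therefore a statement about random determinants.

Exact moments. With the other rows fixed, a Gram determinant is a quadratic form in the remaining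
row, and the matrix of this form is the Gram determinant of the other rows times an orthogonal
projection (`gramForm_mul_self`, `trace_gramForm`). The second moment sees only its trace, which
gives a product formula. The law of a row is invariant under reflections and has equal mixed
moments, so the fourth moment sees the trace, the trace of the square and the sum of squared
diagonal entries. The diagonal entries are again Gram determinants, with one column deleted
(`gramForm_diag`). The resulting recursion in the numbers of rows and columns is solved by a
binomial sum (`gramRec_eq_sum`), which is `phiFun` in closed form. The moments of the coordinates
come from inserting the weight `exp (-∑ |x i| ^ r)`.

Asymptotics. A weak form of Stirling's formula gives the `n`-th roots of `E V ^ 2` and `E V ^ 4`.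
Since `(E V ^ 2) ^ 2` and `E V ^ 4` have equivalent `n`-th roots, a reverse Hölder inequality
(`crosspolytopeMoment_one_ge`) pins down every p-norm with `1 ≤ p ≤ 4`. Symmetry and the triangle
inequality show that `2 ^ n * ‖U‖` lies between `‖V‖` and `(n + 1) * ‖V‖`, which is invisible after
taking `n`-th roots.

Maximality at the cube. Write `t = 1 / q`; the difficulty is uniformity in `q`. If `n * t` is at
least of order `√n`, the convexity bound behind the maximum of `alphaFun` makes `E V ^ 2` smaller
than for the cube by a factor exponential in `n * t`, which beats every polynomial loss. If `t` is
small, the rows are replaced one by one by rows uniform in a rescaled cube (`lpNorm_le_of_affine`).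
Jensen's inequality in the radial variable passes from the ball to independent coordinates with
density proportional to `exp (-|y| ^ q)`. Replacing this density by the uniform one of the same
height costs `O(t ^ 2)` per coordinate, hence a factor `1 + O(t ^ 2 * √n)` per row. Superadditivity
of `c ↦ log Γ (1 + c)`, in the quantitative form `mul_log_Gamma_le`, yields from the volume ratio a
gain of order `(n * t) ^ 2 / (1 + n * t)` in the exponent, against a total loss of order `n * t ^ 2
* √n`. The two regimes together cover all `q` once `n` is large. -/

/-! ### Bounds for `log Γ` and the maximum of `α` -/

theorem log_Gamma_add_one {x : ℝ} (hx : 0 < x) :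
    Real.log (Real.Gamma (x + 1)) = Real.log (Real.Gamma x) + Real.log x := by
  rw [Real.Gamma_add_one hx.ne', Real.log_mul hx.ne' (Real.Gamma_pos_of_pos hx).ne', add_comm]

/-- Convexity of `log Γ`: the slope over `[1 + c, 1 + c + h]` is at least the slope over `[c, 1 +
c]`, which is `log c` by the functional equation. -/
theorem mul_log_le_log_Gamma_sub {c h : ℝ} (hc : 0 < c) (hh : 0 ≤ h) :
    h * Real.log c ≤ Real.log (Real.Gamma (1 + (c + h))) - Real.log (Real.Gamma (1 + c)) := by
  rcases hh.eq_or_lt with rfl | hh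
  · simp
  have := (convexOn_iff_slope_mono_adjacent.mp Real.convexOn_log_Gamma).2
    (x := c) (y := 1 + c) (z := 1 + (c + h)) hc (Set.mem_Ioi.2 (by linarith))
    (by linarith) (by linarith)
  have h1 := log_Gamma_add_one hc
  rw [add_comm c 1] at h1
  simp only [Function.comp_apply] at this
  rw [h1, show 1 + c - c = 1 by ring, show 1 + (c + h) - (1 + c) = h by ring, div_one,
    le_div_iff₀ hh] at this
  linarith

/-- Convexity again, now against the unit interval to the right of `1 + c + h`. -/
theorem log_Gamma_sub_le_mul_log {c h : ℝ} (hc : 0 ≤ c) (hh : 0 ≤ h) :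
    Real.log (Real.Gamma (1 + (c + h))) - Real.log (Real.Gamma (1 + c)) ≤
      h * Real.log (1 + (c + h)) := by
  rcases hh.eq_or_lt with rfl | hh
  · simp
  have := (convexOn_iff_slope_mono_adjacent.mp Real.convexOn_log_Gamma).2
    (x := 1 + c) (y := 1 + (c + h)) (z := 1 + (c + h) + 1) (Set.mem_Ioi.2 (by linarith))
    (Set.mem_Ioi.2 (by linarith)) (by linarith) (by linarith)
  have h1 := log_Gamma_add_one (x := 1 + (c + h)) (by linarith)
  simp only [Function.comp_apply] at this
  rw [h1, show 1 + (c + h) - (1 + c) = h by ring, show 1 + (c + h) + 1 - (1 + (c + h)) = 1 by ring,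
    div_one, div_le_iff₀ hh] at this
  linarith

/-- Lower half of Stirling: keep only `x > c` in Euler's integral, where `x ^ c ≥ c ^ c`. -/
theorem mul_log_sub_le_log_Gamma {c : ℝ} (hc : 0 ≤ c) :
    c * Real.log c - c ≤ Real.log (Real.Gamma (1 + c)) := by
  rcases hc.eq_or_lt with rfl | hc
  · simp
  have hG := Real.Gamma_eq_integral (s := 1 + c) (by linarith)
  have hI := Real.GammaIntegral_convergent (s := 1 + c) (by linarith)
  rw [Real.le_log_iff_exp_le (Real.Gamma_pos_of_pos (by linarith)), hG]
  calc Real.exp (c * Real.log c - c) = c ^ c * ∫ x in Set.Ioi c, Real.exp (-x) := by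
        rw [integral_exp_neg_Ioi, Real.exp_sub, Real.exp_neg, Real.rpow_def_of_pos hc, mul_comm c,
          div_eq_mul_inv]
    _ = ∫ x in Set.Ioi c, c ^ c * Real.exp (-x) := by rw [integral_const_mul]
    _ ≤ ∫ x in Set.Ioi c, Real.exp (-x) * x ^ (1 + c - 1) := by
        refine setIntegral_mono_on ?_ (hI.mono_set (Set.Ioi_subset_Ioi hc.le)) measurableSet_Ioi ?_
        · exact (integrableOn_exp_neg_Ioi c).const_mul _
        · intro x hx
          rw [mul_comm, add_sub_cancel_left]
          gcongr
          exact (Set.mem_Ioi.1 hx).le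
    _ ≤ _ := by
        refine setIntegral_mono_set hI ?_ (Set.Ioi_subset_Ioi hc.le).eventuallyLE
        filter_upwards [ae_restrict_mem measurableSet_Ioi] with x hx
        have : (0:ℝ) < x := hx
        positivity

/-- Upper half of Stirling, up to a logarithmic error: the tangent to `log` at `1 + c` dominates
Euler's integrand by a multiple of `exp (-x / (1 + c))`, whose integral is `1 + c`. -/
theorem log_Gamma_le_mul_log_sub {c : ℝ} (hc : 0 ≤ c) :
    Real.log (Real.Gamma (1 + c)) ≤ c * Real.log c - c + 1 + Real.log (1 + c) := by
  rcases hc.eq_or_lt with rfl | hc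
  · simp
  have hG := Real.Gamma_eq_integral (s := 1 + c) (by linarith)
  have hI := Real.GammaIntegral_convergent (s := 1 + c) (by linarith)
  have h1c : 0 < 1 + c := by linarith
  set d : ℝ := (1 + c)⁻¹ with hd
  have hd0 : 0 < d := by positivity
  have hint : ∫ x in Set.Ioi (0:ℝ), Real.exp (-d * x) = 1 + c := by
    rw [integral_exp_mul_Ioi (by linarith)]; simp [hd]
  have key : ∀ x : ℝ, 0 < x → Real.exp (-x) * x ^ (1 + c - 1) ≤
      Real.exp (c * Real.log (1 + c) - c) * Real.exp (-d * x) := by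
    intro x hx
    rw [Real.rpow_def_of_pos hx, ← Real.exp_add, ← Real.exp_add, Real.exp_le_exp]
    have h2 := Real.log_le_sub_one_of_pos (x := x / (1 + c)) (by positivity)
    rw [Real.log_div hx.ne' h1c.ne'] at h2
    have h3 : c * (x / (1 + c)) = x - d * x := by rw [hd]; field_simp; ring
    nlinarith
  rw [Real.log_le_iff_le_exp (Real.Gamma_pos_of_pos h1c), hG]
  calc _ ≤ ∫ x in Set.Ioi (0:ℝ), Real.exp (c * Real.log (1 + c) - c) * Real.exp (-d * x) := by
        refine setIntegral_mono_on hI ?_ measurableSet_Ioi fun x hx => key x hx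
        exact (integrableOn_exp_mul_Ioi (by linarith) 0).const_mul _
    _ = Real.exp (c * Real.log (1 + c) - c + Real.log (1 + c)) := by
        rw [integral_const_mul, hint, Real.exp_add _ (Real.log (1 + c)), Real.exp_log h1c]
    _ ≤ _ := by
        rw [Real.exp_le_exp]
        have h2 := Real.log_le_sub_one_of_pos (x := (1 + c) / c) (by positivity)
        rw [Real.log_div h1c.ne' hc.ne'] at h2
        have h3 : c * ((1 + c) / c - 1) = 1 := by field_simp; ring
        nlinarith

open Real.BohrMollerup in
-- The left side is a convex function of `t` on `[0, 1]`, equal to `0` at `0` and to `log 6` at `1`,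
-- so it lies below its chord. Convexity is inherited from Euler's finite product approximations of
-- `Γ`.
theorem log_Gamma_three_mul_le {t : ℝ} (ht0 : 0 ≤ t) (ht1 : t ≤ 1) :
    Real.log (Real.Gamma (1 + 3 * t)) - 3 * Real.log (Real.Gamma (1 + t)) ≤ t * Real.log 6 := by
  -- The index `3 * n + 2` gives `3 * n + 3` factors for `Γ (1 + 3 * t)`; grouped in threes they
  -- match the `n + 1` factors of `Γ (1 + t)` taken three times.
  let f : ℕ → ℝ → ℝ := fun n t => logGammaSeq (1 + 3 * t) (3 * n + 2) - 3 * logGammaSeq (1 + t) n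
  have hlim : ∀ t : ℝ, 0 ≤ t → Tendsto (fun n => f n t) atTop
      (nhds (Real.log (Real.Gamma (1 + 3 * t)) - 3 * Real.log (Real.Gamma (1 + t)))) := by
    intro t ht
    refine Tendsto.sub ?_ (Tendsto.const_mul _ (tendsto_log_gamma (by linarith)))
    refine (tendsto_log_gamma (by linarith)).comp (tendsto_atTop_mono (fun n => ?_) tendsto_id)
    simp only [id]; omega
  have hsum : ∀ (g : ℕ → ℝ) (n : ℕ), ∑ m ∈ Finset.range (3 * n + 2 + 1), g m =
      ∑ m ∈ Finset.range (n + 1), (g (3 * m) + g (3 * m + 1) + g (3 * m + 2)) := by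
    intro g n
    induction n with
    | zero => simp [Finset.sum_range_succ]
    | succ n ih =>
      rw [Finset.sum_range_succ _ (n + 1), ← ih, show 3 * (n + 1) + 2 + 1 = 3 * n + 2 + 1 + 3 by ring]
      simp only [Finset.sum_range_succ, show 3 * (n + 1) = 3 * n + 2 + 1 by ring]
      ring
  -- The derivative is `-(a - b) / ((a + t) * (b + t))`, which increases with `t`.
  have hlog : ∀ a b : ℝ, 0 < b → b ≤ a →
      ConvexOn ℝ (Set.Icc 0 1) (fun t => Real.log (a + t) - Real.log (b + t)) := by
    intro a b hb hab
    have hd : ∀ x ∈ Set.Ici (0:ℝ), HasDerivAt (fun t => Real.log (a + t) - Real.log (b + t))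
        ((a + x)⁻¹ - (b + x)⁻¹) x := by
      intro x hx
      have hx : (0:ℝ) ≤ x := hx
      have h1 := ((hasDerivAt_id' x).const_add a).log (by linarith)
      have h2 := ((hasDerivAt_id' x).const_add b).log (by linarith)
      rw [one_div] at h1 h2
      exact h1.sub h2
    refine MonotoneOn.convexOn_of_deriv (convex_Icc _ _)
      (fun x hx => (hd x hx.1).continuousAt.continuousWithinAt)
      (fun x hx => ?_) ?_
    · rw [interior_Icc] at hx
      exact (hd x hx.1.le).differentiableAt.differentiableWithinAt
    · rw [interior_Icc]
      intro x hx y hy hxy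
      rw [(hd x hx.1.le).deriv, (hd y hy.1.le).deriv]
      have hx0 := hx.1
      have hy0 := hy.1
      have e : ∀ z : ℝ, 0 < z → (a + z)⁻¹ - (b + z)⁻¹ = -((a - b) * ((a + z)⁻¹ * (b + z)⁻¹)) := by
        intro z hz
        have : 0 < a + z := by linarith
        have : 0 < b + z := by linarith
        field_simp; ring
      rw [e x hx0, e y hy0, neg_le_neg_iff]
      have : 0 ≤ a - b := by linarith
      have := inv_pos.2 (show 0 < a + y by linarith)
      have := inv_pos.2 (show 0 < b + y by linarith)
      have := inv_anti₀ (show 0 < a + x by linarith) (show a + x ≤ a + y by linarith)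
      have := inv_anti₀ (show 0 < b + x by linarith) (show b + x ≤ b + y by linarith)
      gcongr
      linarith
  have hconv : ∀ n, f n t ≤ (1 - t) * f n 0 + t * f n 1 := by
    intro n
    have e : ∀ t : ℝ, 0 ≤ t → f n t = (1 + 3 * t) * Real.log ((3 * n + 2 : ℕ) : ℝ)
        + Real.log ((3 * n + 2)! : ℝ) - 3 * ((1 + t) * Real.log n + Real.log (n ! : ℝ))
        - (n + 1) * (3 * Real.log 3)
        + ∑ m ∈ Finset.range (n + 1), (
          (Real.log ((m + 1 : ℝ) + t) - Real.log ((m + 1 / 3 : ℝ) + t))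
          + (Real.log ((m + 1 : ℝ) + t) - Real.log ((m + 2 / 3 : ℝ) + t))
          + (Real.log ((m + 1 : ℝ) + t) - Real.log ((m + 1 : ℝ) + t))) := by
      intro t ht
      have : ∀ m : ℕ, Real.log (1 + 3 * t + ((3 * m : ℕ) : ℝ))
            + Real.log (1 + 3 * t + ((3 * m + 1 : ℕ) : ℝ))
            + Real.log (1 + 3 * t + ((3 * m + 2 : ℕ) : ℝ)) =
          3 * Real.log 3 + (Real.log ((m + 1 / 3 : ℝ) + t) + Real.log ((m + 2 / 3 : ℝ) + t)
            + Real.log ((m + 1 : ℝ) + t)) := by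
        intro m
        have e1 : 1 + 3 * t + ((3 * m : ℕ) : ℝ) = 3 * ((m + 1 / 3 : ℝ) + t) := by push_cast; ring
        have e2 : 1 + 3 * t + ((3 * m + 1 : ℕ) : ℝ) = 3 * ((m + 2 / 3 : ℝ) + t) := by
          push_cast; ring
        have e3 : 1 + 3 * t + ((3 * m + 2 : ℕ) : ℝ) = 3 * ((m + 1 : ℝ) + t) := by push_cast; ring
        rw [e1, e2, e3, Real.log_mul (by norm_num) (by positivity),
          Real.log_mul (by norm_num) (by positivity), Real.log_mul (by norm_num) (by positivity)]
        ring
      simp only [f, logGammaSeq]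
      rw [hsum]
      simp only [this]
      simp only [Finset.sum_add_distrib, Finset.sum_sub_distrib, Finset.sum_const,
        Finset.card_range, nsmul_eq_mul]
      have : ∀ m : ℕ, (1 + t + (m : ℝ)) = (m : ℝ) + 1 + t := fun m => by ring
      simp only [this]
      push_cast
      ring
    rw [e t ht0, e 0 le_rfl, e 1 zero_le_one]
    have hs : ∀ m ∈ Finset.range (n + 1),
        ((Real.log ((m + 1 : ℝ) + t) - Real.log ((m + 1 / 3 : ℝ) + t))
          + (Real.log ((m + 1 : ℝ) + t) - Real.log ((m + 2 / 3 : ℝ) + t))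
          + (Real.log ((m + 1 : ℝ) + t) - Real.log ((m + 1 : ℝ) + t))) ≤
        (1 - t) * ((Real.log ((m + 1 : ℝ) + 0) - Real.log ((m + 1 / 3 : ℝ) + 0))
          + (Real.log ((m + 1 : ℝ) + 0) - Real.log ((m + 2 / 3 : ℝ) + 0))
          + (Real.log ((m + 1 : ℝ) + 0) - Real.log ((m + 1 : ℝ) + 0))) +
        t * ((Real.log ((m + 1 : ℝ) + 1) - Real.log ((m + 1 / 3 : ℝ) + 1))
          + (Real.log ((m + 1 : ℝ) + 1) - Real.log ((m + 2 / 3 : ℝ) + 1))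
          + (Real.log ((m + 1 : ℝ) + 1) - Real.log ((m + 1 : ℝ) + 1))) := by
      intro m _
      have h1 := (hlog (m + 1) (m + 1 / 3) (by positivity) (by linarith)).2
        (show (0 : ℝ) ∈ Set.Icc 0 1 by simp) (show (1 : ℝ) ∈ Set.Icc 0 1 by simp)
        (show 0 ≤ 1 - t by linarith) ht0 (by ring)
      have h2 := (hlog (m + 1) (m + 2 / 3) (by positivity) (by linarith)).2
        (show (0 : ℝ) ∈ Set.Icc 0 1 by simp) (show (1 : ℝ) ∈ Set.Icc 0 1 by simp)
        (show 0 ≤ 1 - t by linarith) ht0 (by ring)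
      simp only [smul_eq_mul, mul_zero, mul_one, zero_add] at h1 h2
      linarith
    have := (Finset.sum_le_sum hs).trans_eq Finset.sum_add_distrib
    rw [← Finset.mul_sum, ← Finset.mul_sum] at this
    linarith
  have h := le_of_tendsto_of_tendsto' (hlim t ht0)
    (((hlim 0 le_rfl).const_mul (1 - t)).add ((hlim 1 zero_le_one).const_mul t)) hconv
  have hG4 : Real.Gamma 4 = 6 := by
    rw [show (4 : ℝ) = (3 : ℕ) + 1 by norm_num, Real.Gamma_nat_eq_factorial]; norm_num [Nat.factorial]
  have hG2 : Real.Gamma 2 = 1 := Real.Gamma_two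
  norm_num [hG4, hG2] at h
  linarith

/-- By `log_Gamma_three_mul_le`, `log α (t) - log α (0) ≤ -(2 - log 6) * t`. Positivity gives the
maximum at `0`; the explicit `1 / 10` is the rate of decay used for large `n * t`. -/
theorem two_sub_log_six_pos : (1 / 10 : ℝ) < 2 - Real.log 6 := by
  have h2 := Real.log_two_lt_d9
  have h3 : Real.log 6 = Real.log 2 + Real.log 3 := by
    rw [← Real.log_mul (by norm_num) (by norm_num)]; norm_num
  have h4 : Real.log 3 < 1.12 := by
    have := Real.exp_one_gt_d9
    have h := Real.log_le_sub_one_of_pos (x := 3 / Real.exp 1) (by positivity)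
    rw [Real.log_div (by norm_num) (Real.exp_pos 1).ne', Real.log_exp] at h
    have : 3 / Real.exp 1 < 1.12 := by
      rw [div_lt_iff₀ (Real.exp_pos 1)]; nlinarith
    linarith
  linarith

theorem alphaFun_pos {t : ℝ} (ht : 0 ≤ t) : 0 < alphaFun t := by
  unfold alphaFun
  have h1 := Real.Gamma_pos_of_pos (s := 1 + 3 * t) (by linarith)
  have h2 := Real.Gamma_pos_of_pos (s := 1 + t) (by linarith)
  positivity

theorem log_alphaFun {t : ℝ} (ht : 0 ≤ t) :
    Real.log (alphaFun t) = 1 - 2 * t + Real.log (Real.Gamma (1 + 3 * t)) - Real.log 3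
      - 3 * Real.log (Real.Gamma (1 + t)) := by
  unfold alphaFun
  have h1 := Real.Gamma_pos_of_pos (s := 1 + 3 * t) (by linarith)
  have h2 := Real.Gamma_pos_of_pos (s := 1 + t) (by linarith)
  rw [Real.log_div (by positivity) (by positivity), Real.log_mul (by positivity) (by positivity),
    Real.log_mul (by positivity) (by positivity), Real.log_exp, Real.log_pow]
  push_cast
  ring

theorem isMaxOn_alphaFun : IsMaxOn alphaFun (Set.Icc 0 1) 0 := by
  intro t ht
  rw [Set.mem_ofPred_eq, ← Real.log_le_log_iff (alphaFun_pos ht.1) (alphaFun_pos le_rfl),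
    log_alphaFun ht.1, log_alphaFun le_rfl]
  have h1 := log_Gamma_three_mul_le ht.1 ht.2
  have h2 := two_sub_log_six_pos
  norm_num
  nlinarith [ht.1]

/-- Quantitative superadditivity of `c ↦ log Γ(1 + c)`. -/
theorem mul_log_Gamma_le {c r : ℝ} (hc : 0 ≤ c) (hr : 1 ≤ r) :
    r * Real.log (Real.Gamma (1 + c)) + (r - 1) * (c ^ 2 / (4 * (1 + c))) ≤
      Real.log (Real.Gamma (1 + r * c)) := by
  -- After `m` applications of the functional equation, plain convexity handles the shifted Gamma
  -- values, and the gain comes from the `m` logarithms split off. With `m ≥ 1 + c` at least half of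
  -- the infinite telescoping sum is retained.
  obtain ⟨m, hm⟩ := exists_nat_ge (1 + c)
  have hrec : ∀ x : ℝ, 0 ≤ x → Real.log (Real.Gamma (1 + x)) =
      Real.log (Real.Gamma (1 + x + m)) - ∑ k ∈ Finset.range m, Real.log (1 + x + k) := by
    intro x hx
    have := Real.BohrMollerup.f_add_nat_eq (f := Real.log ∘ Real.Gamma) (x := 1 + x)
      (fun {y} hy => log_Gamma_add_one hy) (by linarith) m
    simp only [Function.comp_apply] at this
    linarith
  have hrpos : 0 < r := by linarith
  have hJ : r * Real.log (Real.Gamma (1 + c + m)) ≤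
      Real.log (Real.Gamma (1 + r * c + m)) + (r - 1) * Real.log (Real.Gamma (1 + 0 + m)) := by
    have h := Real.convexOn_log_Gamma.2 (show 1 + r * c + m ∈ Set.Ioi 0 from Set.mem_Ioi.2 (by positivity))
      (show (1 + 0 + m : ℝ) ∈ Set.Ioi 0 from Set.mem_Ioi.2 (by positivity)) (show 0 ≤ 1 / r by positivity)
      (show 0 ≤ 1 - 1 / r by rw [sub_nonneg, div_le_one hrpos]; exact hr) (by ring)
    simp only [smul_eq_mul, Function.comp_apply] at h
    rw [show 1 / r * (1 + r * c + m) + (1 - 1 / r) * (1 + 0 + m) = 1 + c + m by field_simp; ring] at h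
    have := mul_le_mul_of_nonneg_left h hrpos.le
    rw [show ∀ a b : ℝ, r * (1 / r * a + (1 - 1 / r) * b) = a + (r - 1) * b from
      fun a b => by field_simp] at this
    exact this
  -- With `y = c / (1 + c + k)`, concavity of `log` loses nothing to first order, and `-log (1 - y)
  -- ≥ y + y ^ 2 / 2` leaves `(r - 1) * y ^ 2 / 2`. This is bounded below by a telescoping term.
  have hterm : ∀ k ∈ Finset.range m, (r - 1) * (c ^ 2 / 2 * (1 / (1 + c + k) - 1 / (1 + c + (k + 1)))) ≤
      r * Real.log (1 + c + k) - Real.log (1 + r * c + k) - (r - 1) * Real.log (1 + 0 + k) := by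
    intro k _
    have hA : 0 < 1 + 0 + (k : ℝ) := by positivity
    have hB : 0 < 1 + c + (k : ℝ) := by positivity
    have hC : 0 < 1 + r * c + (k : ℝ) := by positivity
    have h1 := Real.log_le_sub_one_of_pos (x := (1 + r * c + k) / (1 + c + k)) (by positivity)
    rw [Real.log_div hC.ne' hB.ne'] at h1
    have h1' : (1 + r * c + k) / (1 + c + k) - 1 = (r - 1) * (c / (1 + c + k)) := by
      field_simp; ring
    rw [h1'] at h1
    have h2 : c / (1 + c + k) + (c / (1 + c + k)) ^ 2 / 2 ≤
        Real.log (1 + c + k) - Real.log (1 + 0 + k) := by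
      have h3 : 1 + 0 + (k:ℝ) = (1 + c + k) * (1 - c / (1 + c + k)) := by field_simp; ring
      set y := c / (1 + c + k) with hy
      have hy1 : y < 1 := by rw [hy, div_lt_one hB]; linarith
      have hy0 : 0 ≤ y := by positivity
      rw [h3, Real.log_mul hB.ne' (by linarith)]
      have h5 := Real.hasSum_pow_div_log_of_abs_lt_one (x := y) (by rw [abs_of_nonneg hy0]; exact hy1)
      have h6 := sum_le_hasSum (Finset.range 2) (fun i _ => by positivity) h5
      norm_num [Finset.sum_range_succ] at h6
      linarith
    have h7 : c ^ 2 / 2 * (1 / (1 + c + k) - 1 / (1 + c + (k + 1))) ≤ (c / (1 + c + k)) ^ 2 / 2 := by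
      have : 1 / (1 + c + k) - 1 / (1 + c + (k + 1)) = 1 / ((1 + c + k) * (1 + c + (k + 1))) := by
        field_simp; ring
      rw [this, div_pow, pow_two (1 + c + (k:ℝ)), div_eq_mul_one_div (c ^ 2) (_ * _)]
      have : 1 / ((1 + c + k) * (1 + c + (k + 1))) ≤ 1 / ((1 + c + k) * (1 + c + k)) := by
        gcongr; linarith
      nlinarith [sq_nonneg c]
    nlinarith
  have hS := Finset.sum_le_sum hterm
  have htel : ∑ k ∈ Finset.range m, (1 / (1 + c + k) - 1 / (1 + c + (k + 1))) =
      1 / (1 + c) - 1 / (1 + c + m) := by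
    have := Finset.sum_range_sub' (fun k : ℕ => 1 / (1 + c + (k : ℝ))) m
    simpa using this
  rw [← Finset.mul_sum, ← Finset.mul_sum, htel, Finset.sum_sub_distrib, Finset.sum_sub_distrib,
    ← Finset.mul_sum, ← Finset.mul_sum] at hS
  have h0 := hrec 0 le_rfl
  rw [hrec c hc, hrec (r * c) (by positivity)]
  simp only [add_zero, Real.Gamma_one, Real.log_one] at h0 hS hJ
  have hlast : c ^ 2 / (4 * (1 + c)) ≤ c ^ 2 / 2 * (1 / (1 + c) - 1 / (1 + c + m)) := by
    have : 1 / (1 + c + m) ≤ 1 / (2 * (1 + c)) := by gcongr; linarith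
    have e : c ^ 2 / (4 * (1 + c)) = c ^ 2 / 2 * (1 / (1 + c) - 1 / (2 * (1 + c))) := by
      field_simp; ring
    rw [e]
    gcongr
  nlinarith

/-! ### Integration over the ball through the weight `exp (-∑ |x i| ^ r)` -/

theorem measurableSet_sum_rpow_le {n : ℕ} (r y : ℝ) :
    MeasurableSet {x : Fin n → ℝ | ∑ i, |x i| ^ r ≤ y} :=
  measurableSet_le (by fun_prop) measurable_const

theorem lintegral_comp_smul_pi {n : ℕ} {s : ℝ} (hs : 0 < s) {f : (Fin n → ℝ) → ℝ≥0∞}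
    (hf : Measurable f) :
    ∫⁻ x, f x = ENNReal.ofReal (s ^ n) * ∫⁻ x, f (s • x) := by
  have h := Measure.map_addHaar_smul (volume : Measure (Fin n → ℝ)) hs.ne'
  have h2 : ∫⁻ x, f (s • x) = ∫⁻ x, f x ∂(Measure.map (fun x : Fin n → ℝ => s • x) volume) :=
    (lintegral_map hf (by fun_prop)).symm
  rw [h2, h, lintegral_smul_measure, smul_eq_mul, ← mul_assoc, ← ENNReal.ofReal_mul (by positivity)]
  simp only [Module.finrank_pi, Fintype.card_fin]
  rw [abs_of_nonneg (by positivity), mul_inv_cancel₀ (by positivity)]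
  simp

theorem ofReal_exp_neg_eq_lintegral {a : ℝ} (ha : 0 ≤ a) :
    ENNReal.ofReal (Real.exp (-a)) =
      ∫⁻ y in Set.Ioi 0, (Set.Ici a).indicator (fun y => ENNReal.ofReal (Real.exp (-y))) y := by
  rw [lintegral_indicator measurableSet_Ici, Measure.restrict_restrict measurableSet_Ici]
  have h : (Set.Ici a ∩ Set.Ioi 0 : Set ℝ) =ᵐ[volume] Set.Ioi a := by
    have h1 : (Set.Ici a ∩ Set.Ioi 0 : Set ℝ) =ᵐ[volume] (Set.Ioi a ∩ Set.Ioi 0 : Set ℝ) :=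
      (Ioi_ae_eq_Ici.symm).inter (ae_eq_refl _)
    rwa [Set.inter_eq_left.2 (Set.Ioi_subset_Ioi ha)] at h1
  rw [Measure.restrict_congr_set h, ← ofReal_integral_eq_lintegral_ofReal
    (integrableOn_exp_neg_Ioi a) (ae_of_all _ fun _ => (Real.exp_pos _).le), integral_exp_neg_Ioi]

/-- Layer cake: `exp (-a)` is the integral of `exp (-y)` over `y ≥ a`. After exchanging integrals,
the sublevel set at height `y` is the unit ball dilated by `y ^ r⁻¹`. Probabilistically, a uniform
point of the ball times an independent power of a Gamma variable has independent coordinates. -/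
theorem lintegral_mul_exp_neg_sum_rpow {n : ℕ} {r : ℝ} (hr : 0 < r) {f : (Fin n → ℝ) → ℝ≥0∞}
    (hf : Measurable f) :
    ∫⁻ x, f x * ENNReal.ofReal (Real.exp (-∑ i, |x i| ^ r)) =
      ∫⁻ y in Set.Ioi (0 : ℝ), ENNReal.ofReal (Real.exp (-y) * y ^ (n * r⁻¹)) *
        ∫⁻ x in {x : Fin n → ℝ | ∑ i, |x i| ^ r ≤ 1}, f (y ^ r⁻¹ • x) := by
  have h0 : ∀ x : Fin n → ℝ, 0 ≤ ∑ i, |x i| ^ r := fun x => by positivity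
  have hm : Measurable fun x : Fin n → ℝ => ∑ i, |x i| ^ r := by fun_prop
  calc _ = ∫⁻ x, ∫⁻ y in Set.Ioi (0 : ℝ), f x * (Set.Ici (∑ i, |x i| ^ r)).indicator
        (fun y => ENNReal.ofReal (Real.exp (-y))) y := by
        refine lintegral_congr fun x => ?_
        rw [ofReal_exp_neg_eq_lintegral (h0 x), lintegral_const_mul]
        exact (by fun_prop : Measurable fun y : ℝ => ENNReal.ofReal (Real.exp (-y))).indicator
          measurableSet_Ici
    _ = ∫⁻ y in Set.Ioi (0 : ℝ), ∫⁻ x, f x * (Set.Ici (∑ i, |x i| ^ r)).indicator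
        (fun y => ENNReal.ofReal (Real.exp (-y))) y := by
        refine lintegral_lintegral_swap (Measurable.aemeasurable ?_)
        refine (hf.comp measurable_fst).mul ?_
        have : (fun z : (Fin n → ℝ) × ℝ => (Set.Ici (∑ i, |z.1 i| ^ r)).indicator
            (fun y => ENNReal.ofReal (Real.exp (-y))) z.2) =
            Set.indicator {z : (Fin n → ℝ) × ℝ | ∑ i, |z.1 i| ^ r ≤ z.2}
              (fun z => ENNReal.ofReal (Real.exp (-z.2))) := by
          ext z; simp [Set.indicator]
        rw [this]
        exact Measurable.indicator (by fun_prop)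
          (measurableSet_le (hm.comp measurable_fst) measurable_snd)
    _ = _ := by
        refine setLIntegral_congr_fun measurableSet_Ioi fun y hy => ?_
        have hy : 0 < y := hy
        have hs : 0 < y ^ r⁻¹ := Real.rpow_pos_of_pos hy _
        have e : ∀ x : Fin n → ℝ, f x * (Set.Ici (∑ i, |x i| ^ r)).indicator
            (fun y => ENNReal.ofReal (Real.exp (-y))) y = ENNReal.ofReal (Real.exp (-y)) *
              Set.indicator {x : Fin n → ℝ | ∑ i, |x i| ^ r ≤ y} f x := by
          intro x
          by_cases h : ∑ i, |x i| ^ r ≤ y <;> simp [Set.indicator, h, mul_comm]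
        simp only [e]
        have hmi : Measurable (Set.indicator {x : Fin n → ℝ | ∑ i, |x i| ^ r ≤ y} f) :=
          hf.indicator (measurableSet_sum_rpow_le r y)
        rw [lintegral_const_mul _ hmi, lintegral_comp_smul_pi hs hmi, ← mul_assoc,
          ← ENNReal.ofReal_mul (Real.exp_pos _).le, ← Real.rpow_natCast (y ^ r⁻¹),
          ← Real.rpow_mul hy.le, mul_comm r⁻¹, ← lintegral_indicator (measurableSet_sum_rpow_le r 1)]
        congr 1
        refine lintegral_congr fun x => ?_
        have : ∑ i, |(y ^ r⁻¹ • x) i| ^ r = y * ∑ i, |x i| ^ r := by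
          rw [Finset.mul_sum]
          refine Finset.sum_congr rfl fun i _ => ?_
          rw [Pi.smul_apply, smul_eq_mul, abs_mul, abs_of_pos hs,
            Real.mul_rpow hs.le (abs_nonneg _), ← Real.rpow_mul hy.le, inv_mul_cancel₀ hr.ne',
            Real.rpow_one]
        simp only [Set.indicator, Set.mem_ofPred_eq, this]
        simp only [mul_le_iff_le_one_right hy]

theorem integral_exp_neg_mul_rpow_Ioi {s : ℝ} (hs : 0 ≤ s) :
    IntegrableOn (fun y : ℝ => Real.exp (-y) * y ^ s) (Set.Ioi 0) ∧
      ∫ y in Set.Ioi (0 : ℝ), Real.exp (-y) * y ^ s = Real.Gamma (1 + s) := by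
  have h1 := Real.Gamma_eq_integral (s := 1 + s) (by linarith)
  have h2 := Real.GammaIntegral_convergent (s := 1 + s) (by linarith)
  simp only [add_sub_cancel_left] at h1 h2
  exact ⟨h2, h1.symm⟩

/-- Integrals of products of nonnegative homogeneous functions of the coordinates over the ball
`∑ |x i| ^ r ≤ 1`. -/
theorem lintegral_ball_prod {n : ℕ} {r : ℝ} (hr : 0 < r) {g : Fin n → ℝ → ℝ} {a : Fin n → ℕ}
    (hm : ∀ i, Measurable (g i)) (h0 : ∀ i x, 0 ≤ g i x)
    (hhom : ∀ i s x, 0 < s → g i (s * x) = s ^ a i * g i x)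
    (hint : ∀ i, Integrable fun x => g i x * Real.exp (-|x| ^ r)) :
    ∫⁻ x in {x : Fin n → ℝ | ∑ i, |x i| ^ r ≤ 1}, ENNReal.ofReal (∏ i, g i (x i)) =
      ENNReal.ofReal ((∏ i, ∫ x, g i x * Real.exp (-|x| ^ r)) /
        Real.Gamma (1 + ((n : ℝ) + ∑ i, (a i : ℝ)) * r⁻¹)) := by
  have hmp : Measurable fun x : Fin n → ℝ => ENNReal.ofReal (∏ i, g i (x i)) := by
    refine ENNReal.measurable_ofReal.comp (Finset.measurable_fun_prod _ fun i _ => ?_)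
    exact (hm i).comp (measurable_pi_apply i)
  have key := lintegral_mul_exp_neg_sum_rpow hr hmp
  -- On the weighted side the integral factors over the coordinates.
  have hL : ∫⁻ x : Fin n → ℝ, ENNReal.ofReal (∏ i, g i (x i)) *
      ENNReal.ofReal (Real.exp (-∑ i, |x i| ^ r)) =
      ENNReal.ofReal (∏ i, ∫ x, g i x * Real.exp (-|x| ^ r)) := by
    have e : ∀ x : Fin n → ℝ, ENNReal.ofReal (∏ i, g i (x i)) *
      ENNReal.ofReal (Real.exp (-∑ i, |x i| ^ r)) =
        ENNReal.ofReal (∏ i, g i (x i) * Real.exp (-|x i| ^ r)) := by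
      intro x
      rw [← ENNReal.ofReal_mul (Finset.prod_nonneg fun i _ => h0 i _), ← Finset.sum_neg_distrib,
        Real.exp_sum, Finset.prod_mul_distrib]
    simp only [e]
    rw [← ofReal_integral_eq_lintegral_ofReal]
    · rw [integral_fintype_prod_volume_eq_prod (fun i x => g i x * Real.exp (-|x| ^ r))]
    · exact Integrable.fintype_prod hint
    · exact ae_of_all _ fun x => Finset.prod_nonneg fun i _ => mul_nonneg (h0 i _) (Real.exp_pos _).le
  have hG : 0 < Real.Gamma (1 + ((n : ℝ) + ∑ i, (a i : ℝ)) * r⁻¹) :=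
    Real.Gamma_pos_of_pos (by positivity)
  rw [hL] at key
  -- Homogeneity pulls the dilation out of the inner integral, and only a Gamma integral in `y`
  -- remains.
  have hR : ∀ y ∈ Set.Ioi (0 : ℝ), ENNReal.ofReal (Real.exp (-y) * y ^ (n * r⁻¹)) *
        ∫⁻ x in {x : Fin n → ℝ | ∑ i, |x i| ^ r ≤ 1},
          ENNReal.ofReal (∏ i, g i ((y ^ r⁻¹ • x) i)) =
      ENNReal.ofReal (Real.exp (-y) * y ^ (((n : ℝ) + ∑ i, (a i : ℝ)) * r⁻¹)) *
        ∫⁻ x in {x : Fin n → ℝ | ∑ i, |x i| ^ r ≤ 1}, ENNReal.ofReal (∏ i, g i (x i)) := by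
    intro y hy
    have hy : 0 < y := hy
    have hs : 0 < y ^ r⁻¹ := Real.rpow_pos_of_pos hy _
    have e : ∀ x : Fin n → ℝ, ENNReal.ofReal (∏ i, g i ((y ^ r⁻¹ • x) i)) =
        ENNReal.ofReal (y ^ ((∑ i, (a i : ℝ)) * r⁻¹)) * ENNReal.ofReal (∏ i, g i (x i)) := by
      intro x
      rw [← ENNReal.ofReal_mul (by positivity)]
      congr 1
      simp only [Pi.smul_apply, smul_eq_mul, hhom _ _ _ hs]
      rw [Finset.prod_mul_distrib, Finset.prod_pow_eq_pow_sum, ← Real.rpow_natCast,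
        ← Real.rpow_mul hy.le, mul_comm r⁻¹]
      push_cast
      rfl
    simp only [e]
    rw [lintegral_const_mul _ hmp, ← mul_assoc, ← ENNReal.ofReal_mul (by positivity), add_mul,
      Real.rpow_add hy, mul_assoc]
  rw [setLIntegral_congr_fun measurableSet_Ioi hR, lintegral_mul_const _ (by fun_prop)] at key
  obtain ⟨hI, hE⟩ := integral_exp_neg_mul_rpow_Ioi
    (s := ((n : ℝ) + ∑ i, (a i : ℝ)) * r⁻¹) (by positivity)
  rw [← ofReal_integral_eq_lintegral_ofReal hI, hE] at key
  · rw [ENNReal.ofReal_div_of_pos hG, key, mul_comm, ENNReal.mul_div_cancel_right]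
    · simpa using hG
    · simp
  · filter_upwards [ae_restrict_mem measurableSet_Ioi] with y hy
    have : (0:ℝ) < y := hy
    positivity

theorem integral_abs_pow_mul_exp_neg {r : ℝ} (hr : 0 < r) (a : ℕ) :
    Integrable (fun x : ℝ => |x| ^ a * Real.exp (-|x| ^ r)) ∧
      ∫ x : ℝ, |x| ^ a * Real.exp (-|x| ^ r) =
        2 / ((a : ℝ) + 1) * Real.Gamma (1 + ((a : ℝ) + 1) * r⁻¹) := by
  have ha : (-1 : ℝ) < a := by have : (0:ℝ) ≤ a := a.cast_nonneg; linarith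
  have hI : IntegrableOn (fun x : ℝ => x ^ (a : ℝ) * Real.exp (-x ^ r)) (Set.Ioi 0) :=
    integrableOn_rpow_mul_exp_neg_rpow ha hr
  have hE := integral_rpow_mul_exp_neg_rpow hr ha
  simp only [Real.rpow_natCast] at hI hE
  constructor
  · have hpos : IntegrableOn (fun x : ℝ => |x| ^ a * Real.exp (-|x| ^ r)) (Set.Ioi 0) :=
      hI.congr_fun (fun x hx => by simp only [abs_of_pos (Set.mem_Ioi.1 hx)]) measurableSet_Ioi
    have hneg : IntegrableOn (fun x : ℝ => |x| ^ a * Real.exp (-|x| ^ r)) (Set.Iio 0) := by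
      have := (Measure.measurePreserving_neg (volume : Measure ℝ)).integrableOn_comp_preimage
        (measurableEmbedding_neg) (f := fun x : ℝ => |x| ^ a * Real.exp (-|x| ^ r))
        (s := Set.Ioi 0)
      simpa [Function.comp_def] using this.2 hpos
    rw [← integrableOn_univ, ← Set.Iio_union_Ici (a := (0 : ℝ))]
    exact hneg.union (Iff.mpr integrableOn_Ici_iff_integrableOn_Ioi hpos)
  · rw [integral_comp_abs (f := fun x : ℝ => x ^ a * Real.exp (-x ^ r)), hE, add_comm (1 : ℝ),
      Real.Gamma_add_one (by positivity)]
    field_simp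

/-! ### The balls `B_q^n`: moments, volume, reflections -/

theorem recip_nonneg (q : ℝ≥0∞) : 0 ≤ recip q := ENNReal.toReal_nonneg

theorem recip_le_one {q : ℝ≥0∞} (hq : 1 ≤ q) : recip q ≤ 1 := by
  unfold recip
  have := ENNReal.toReal_mono ENNReal.one_ne_top (ENNReal.inv_le_one.2 hq)
  simpa using this

@[simp] theorem recip_top : recip ∞ = 0 := by simp [recip]

theorem recip_eq (q : ℝ≥0∞) : recip q = q.toReal⁻¹ := by simp [recip]

theorem one_le_toReal {q : ℝ≥0∞} (hq : 1 ≤ q) (h : q ≠ ∞) : 1 ≤ q.toReal := by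
  have := ENNReal.toReal_mono h hq
  simpa using this

theorem lqBall_top (n : ℕ) : lqBall ∞ n = Set.pi Set.univ fun _ => Set.Icc (-1) 1 := by
  ext x; simp [lqBall, abs_le, Pi.le_def, forall_and]

theorem lqBall_of_ne_top {q : ℝ≥0∞} (h : q ≠ ∞) (n : ℕ) :
    lqBall q n = {x | ∑ i, |x i| ^ q.toReal ≤ 1} := by
  simp [lqBall, h]

theorem lqBall_subset_cube {q : ℝ≥0∞} (hq : 1 ≤ q) (n : ℕ) : lqBall q n ⊆ lqBall ∞ n := by
  rcases eq_or_ne q ∞ with rfl | h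
  · rfl
  rw [lqBall_of_ne_top h]
  intro x hx
  simp only [lqBall, if_true, Set.mem_ofPred_eq]
  intro i
  by_contra! hi
  have h1 := Real.one_lt_rpow hi (zero_lt_one.trans_le (one_le_toReal hq h))
  have h2 := Finset.single_le_sum (f := fun i => |x i| ^ q.toReal) (fun i _ => by positivity)
    (Finset.mem_univ i)
  have h3 : ∑ i, |x i| ^ q.toReal ≤ 1 := hx
  linarith

theorem isCompact_lqBall {q : ℝ≥0∞} (hq : 1 ≤ q) (n : ℕ) : IsCompact (lqBall q n) := by
  have hc : IsCompact (lqBall ∞ n) := by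
    rw [lqBall_top]; exact isCompact_univ_pi fun _ => isCompact_Icc
  rcases eq_or_ne q ∞ with rfl | h
  · exact hc
  refine hc.of_isClosed_subset ?_ (lqBall_subset_cube hq n)
  rw [lqBall_of_ne_top h]
  refine isClosed_le (continuous_finsetSum _ fun i _ => ?_) continuous_const
  exact ((continuous_apply i).abs).rpow_const fun _ => Or.inr ENNReal.toReal_nonneg

theorem measurableSet_lqBall {q : ℝ≥0∞} (hq : 1 ≤ q) (n : ℕ) : MeasurableSet (lqBall q n) :=
  (isCompact_lqBall hq n).isClosed.measurableSet

/-- Absolute moments of the ball `B_q^n`. -/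
theorem setIntegral_lqBall_prod_abs_pow {q : ℝ≥0∞} (hq : 1 ≤ q) (n : ℕ) (a : Fin n → ℕ) :
    ∫ x in lqBall q n, ∏ i, |x i| ^ a i =
      (∏ i, 2 / ((a i : ℝ) + 1) * Real.Gamma (1 + ((a i : ℝ) + 1) * recip q)) /
        Real.Gamma (1 + ((n : ℝ) + ∑ i, (a i : ℝ)) * recip q) := by
  rcases eq_or_ne q ∞ with rfl | h
  · rw [lqBall_top, volume_pi, Measure.restrict_pi_pi,
      integral_fintype_prod_eq_prod (fun i x => |x| ^ a i)]
    simp only [recip_top, mul_zero, add_zero, Real.Gamma_one, mul_one, div_one]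
    refine Finset.prod_congr rfl fun i _ => ?_
    rw [integral_Icc_eq_integral_Ioc, ← intervalIntegral.integral_of_le (by norm_num),
      ← intervalIntegral.integral_add_adjacent_intervals (b := 0)
      (Continuous.intervalIntegrable (by fun_prop) _ _)
      (Continuous.intervalIntegrable (by fun_prop) _ _)]
    have h1 : ∫ x in (0:ℝ)..1, |x| ^ a i = 1 / ((a i : ℝ) + 1) := by
      rw [intervalIntegral.integral_congr (g := fun x => x ^ a i), integral_pow]
      · simp
      · intro x hx
        rw [Set.uIcc_of_le zero_le_one] at hx
        simp only [abs_of_nonneg hx.1]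
    have h2 : ∫ x in (-1:ℝ)..0, |x| ^ a i = ∫ x in (0:ℝ)..1, |x| ^ a i := by
      have := intervalIntegral.integral_comp_neg (a := 0) (b := 1) (f := fun x : ℝ => |x| ^ a i)
      simp only [abs_neg, neg_zero] at this
      exact this.symm
    rw [h2, h1]
    ring
  · have hr : 0 < q.toReal := zero_lt_one.trans_le (one_le_toReal hq h)
    have key := lintegral_ball_prod (n := n) hr (g := fun i x => |x| ^ a i) (a := a)
      (fun i => by fun_prop) (fun i x => by positivity)
      (fun i s x hs => by rw [abs_mul, mul_pow, abs_of_pos hs])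
      (fun i => (integral_abs_pow_mul_exp_neg hr (a i)).1)
    simp only [(integral_abs_pow_mul_exp_neg hr (a _)).2] at key
    have hcont : Continuous fun x : Fin n → ℝ => ∏ i, |x i| ^ a i := by fun_prop
    have hnn : ∀ x : Fin n → ℝ, 0 ≤ ∏ i, |x i| ^ a i := fun x => by positivity
    rw [integral_eq_lintegral_of_nonneg_ae (ae_of_all _ hnn) hcont.aestronglyMeasurable,
      lqBall_of_ne_top h, recip_eq, key, ENNReal.toReal_ofReal]
    have : ∀ i, 0 ≤ Real.Gamma (1 + ((a i : ℝ) + 1) * q.toReal⁻¹) := fun i =>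
      (Real.Gamma_pos_of_pos (by positivity)).le
    have h2 := (Real.Gamma_pos_of_pos (s := 1 + ((n : ℝ) + ∑ i, (a i : ℝ)) * q.toReal⁻¹)
      (by positivity)).le
    exact div_nonneg (Finset.prod_nonneg fun i _ => mul_nonneg (by positivity) (this i)) h2

theorem vol_lqBall {q : ℝ≥0∞} (hq : 1 ≤ q) (n : ℕ) :
    vol (lqBall q n) = 2 ^ n * Real.Gamma (1 + recip q) ^ n / Real.Gamma (1 + n * recip q) := by
  have h := setIntegral_lqBall_prod_abs_pow hq n 0
  simp only [Pi.zero_apply, pow_zero, Finset.prod_const_one, CharP.cast_eq_zero, zero_add, div_one,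
    one_mul, Finset.sum_const_zero, add_zero, Finset.prod_const, Finset.card_univ,
    Fintype.card_fin, mul_pow] at h
  rw [← h]
  simp [vol, Measure.real]

theorem vol_lqBall_pos {q : ℝ≥0∞} (hq : 1 ≤ q) (n : ℕ) : 0 < vol (lqBall q n) := by
  rw [vol_lqBall hq]
  have h := recip_nonneg q
  have h1 := Real.Gamma_pos_of_pos (s := 1 + recip q) (by positivity)
  have h2 := Real.Gamma_pos_of_pos (s := 1 + n * recip q) (by positivity)
  positivity

theorem volume_lqBall_ne_zero {q : ℝ≥0∞} (hq : 1 ≤ q) (n : ℕ) : volume (lqBall q n) ≠ 0 := by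
  intro h
  have := vol_lqBall_pos hq n
  simp [vol, h] at this

theorem volume_lqBall_ne_top {q : ℝ≥0∞} (hq : 1 ≤ q) (n : ℕ) : volume (lqBall q n) ≠ ∞ :=
  (isCompact_lqBall hq n).measure_lt_top.ne

/-- Reflection in the coordinate hyperplane `x a = 0`. -/
def flipCoord {n : ℕ} (a : Fin n) (x : Fin n → ℝ) : Fin n → ℝ :=
  fun i => if i = a then -x i else x i

theorem measurePreserving_flipCoord {n : ℕ} (a : Fin n) :
    MeasurePreserving (flipCoord a) (volume : Measure (Fin n → ℝ)) volume := by
  have : flipCoord a = fun (x : Fin n → ℝ) i => (if i = a then (fun y : ℝ => -y) else id) (x i) := by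
    ext x i; by_cases h : i = a <;> simp [flipCoord, h]
  rw [this]
  refine volume_preserving_pi fun i => ?_
  by_cases h : i = a
  · simpa [h] using Measure.measurePreserving_neg (volume : Measure ℝ)
  · simpa [h] using MeasurePreserving.id (volume : Measure ℝ)

theorem flipCoord_flipCoord {n : ℕ} (a : Fin n) (x : Fin n → ℝ) :
    flipCoord a (flipCoord a x) = x := by
  ext i; by_cases h : i = a <;> simp [flipCoord, h]

theorem flipCoord_mem_lqBall {q : ℝ≥0∞} {n : ℕ} (a : Fin n) (x : Fin n → ℝ) :
    flipCoord a x ∈ lqBall q n ↔ x ∈ lqBall q n := by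
  have : ∀ i, |flipCoord a x i| = |x i| := by
    intro i; by_cases h : i = a <;> simp [flipCoord, h]
  unfold lqBall
  split_ifs <;> simp [this]

theorem setIntegral_lqBall_flipCoord {q : ℝ≥0∞} {n : ℕ} (a : Fin n) (f : (Fin n → ℝ) → ℝ) :
    ∫ x in lqBall q n, f (flipCoord a x) = ∫ x in lqBall q n, f x := by
  have hemb : MeasurableEmbedding (flipCoord a : (Fin n → ℝ) → Fin n → ℝ) :=
    (MeasurableEquiv.mk ⟨flipCoord a, flipCoord a, flipCoord_flipCoord a, flipCoord_flipCoord a⟩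
      (measurePreserving_flipCoord a).measurable
      (measurePreserving_flipCoord a).measurable).measurableEmbedding
  have := (measurePreserving_flipCoord a).setIntegral_preimage_emb hemb f (lqBall q n)
  rw [← this]
  congr 2
  ext x
  exact (flipCoord_mem_lqBall a x).symm

/-- This kills every monomial that is odd in some coordinate. -/
theorem setIntegral_lqBall_eq_zero {q : ℝ≥0∞} {n : ℕ} (a : Fin n) {f : (Fin n → ℝ) → ℝ}
    (hf : ∀ x, f (flipCoord a x) = -f x) : ∫ x in lqBall q n, f x = 0 := by
  have := setIntegral_lqBall_flipCoord (q := q) a f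
  simp only [hf, integral_neg] at this
  linarith

/-! ### Second and fourth order moments of the coordinates -/

/-- `E x_i^2` for `x` uniform in `B_q^n`, as a function of `t = 1/q`. -/
noncomputable def secondMoment (t : ℝ) (n : ℕ) : ℝ :=
  Real.Gamma (1 + 3 * t) * Real.Gamma (1 + n * t) /
    (3 * Real.Gamma (1 + t) * Real.Gamma (1 + ((n : ℝ) + 2) * t))

/-- `E x_i^2 x_j^2`, `i ≠ j`, for `x` uniform in `B_q^n`, as a function of `t = 1/q`. -/
noncomputable def mixedMoment (t : ℝ) (n : ℕ) : ℝ :=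
  Real.Gamma (1 + 3 * t) ^ 2 * Real.Gamma (1 + n * t) /
    (9 * Real.Gamma (1 + t) ^ 2 * Real.Gamma (1 + ((n : ℝ) + 4) * t))

/-- `E x_i^4` for `x` uniform in `B_q^n`, as a function of `t = 1/q`. -/
noncomputable def fourthMoment (t : ℝ) (n : ℕ) : ℝ :=
  Real.Gamma (1 + 5 * t) * Real.Gamma (1 + n * t) /
    (5 * Real.Gamma (1 + t) * Real.Gamma (1 + ((n : ℝ) + 4) * t))

theorem Gamma_one_add_pos {s : ℝ} (hs : 0 ≤ s) : 0 < Real.Gamma (1 + s) :=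
  Real.Gamma_pos_of_pos (by linarith)

theorem setIntegral_lqBall_sq {q : ℝ≥0∞} (hq : 1 ≤ q) {n : ℕ} (i : Fin n) :
    ∫ x in lqBall q n, x i ^ 2 = vol (lqBall q n) * secondMoment (recip q) n := by
  have h := setIntegral_lqBall_prod_abs_pow hq n (Pi.single i 2)
  obtain ⟨m, rfl⟩ : ∃ m, n = m + 1 := ⟨n - 1, by have := i.pos; omega⟩
  have e1 : ∀ x : Fin (m + 1) → ℝ, ∏ j, |x j| ^ (Pi.single i 2 : Fin (m + 1) → ℕ) j = x i ^ 2 := by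
    intro x
    rw [Fin.prod_univ_succAbove _ i]
    simp
  have e2 : ∑ j, (((Pi.single i 2 : Fin (m + 1) → ℕ) j : ℕ) : ℝ) = 2 := by
    rw [Fin.sum_univ_succAbove _ i]
    simp
  simp only [e1, e2] at h
  rw [h, Fin.prod_univ_succAbove _ i, vol_lqBall hq, secondMoment]
  simp only [Pi.single_eq_same, Pi.single_apply, Fin.succAbove_ne, if_false, Nat.cast_zero,
    Nat.cast_ofNat, zero_add, one_mul, div_one, Finset.prod_const, Finset.card_univ,
    Fintype.card_fin]
  have ht := recip_nonneg q
  have h1 := Gamma_one_add_pos ht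
  have h2 := Gamma_one_add_pos (s := ((m + 1 : ℕ) : ℝ) * recip q) (by positivity)
  have h3 := Gamma_one_add_pos (s := (((m + 1 : ℕ) : ℝ) + 2) * recip q) (by positivity)
  norm_num only
  field_simp
  ring

theorem setIntegral_lqBall_pow_four {q : ℝ≥0∞} (hq : 1 ≤ q) {n : ℕ} (i : Fin n) :
    ∫ x in lqBall q n, x i ^ 4 = vol (lqBall q n) * fourthMoment (recip q) n := by
  have h := setIntegral_lqBall_prod_abs_pow hq n (Pi.single i 4)
  obtain ⟨m, rfl⟩ : ∃ m, n = m + 1 := ⟨n - 1, by have := i.pos; omega⟩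
  have e1 : ∀ x : Fin (m + 1) → ℝ, ∏ j, |x j| ^ (Pi.single i 4 : Fin (m + 1) → ℕ) j = x i ^ 4 := by
    intro x
    rw [Fin.prod_univ_succAbove _ i]
    simp [Even.pow_abs (show Even 4 by decide)]
  have e2 : ∑ j, (((Pi.single i 4 : Fin (m + 1) → ℕ) j : ℕ) : ℝ) = 4 := by
    rw [Fin.sum_univ_succAbove _ i]
    simp
  simp only [e1, e2] at h
  rw [h, Fin.prod_univ_succAbove _ i, vol_lqBall hq, fourthMoment]
  simp only [Pi.single_eq_same, Pi.single_apply, Fin.succAbove_ne, if_false, Nat.cast_zero,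
    Nat.cast_ofNat, zero_add, one_mul, div_one, Finset.prod_const, Finset.card_univ,
    Fintype.card_fin]
  have ht := recip_nonneg q
  have h1 := Gamma_one_add_pos ht
  have h2 := Gamma_one_add_pos (s := ((m + 1 : ℕ) : ℝ) * recip q) (by positivity)
  have h3 := Gamma_one_add_pos (s := (((m + 1 : ℕ) : ℝ) + 4) * recip q) (by positivity)
  norm_num only
  field_simp
  ring

theorem setIntegral_lqBall_sq_mul_sq {q : ℝ≥0∞} (hq : 1 ≤ q) {n : ℕ} {i j : Fin n} (hij : i ≠ j) :
    ∫ x in lqBall q n, x i ^ 2 * x j ^ 2 = vol (lqBall q n) * mixedMoment (recip q) n := by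
  have h := setIntegral_lqBall_prod_abs_pow hq n (Pi.single i 2 + Pi.single j 2)
  obtain ⟨m, rfl⟩ : ∃ m, n = m + 2 := ⟨n - 2, by omega⟩
  obtain ⟨k, rfl⟩ := Fin.exists_succAbove_eq hij.symm
  have hne : ∀ l, i.succAbove (k.succAbove l) ≠ i.succAbove k := fun l hl =>
    Fin.succAbove_ne k l (Fin.succAbove_right_injective hl)
  have e1 : ∀ x : Fin (m + 2) → ℝ, ∏ l, |x l| ^
      (Pi.single i 2 + Pi.single (i.succAbove k) 2 : Fin (m + 2) → ℕ) l =
        x i ^ 2 * x (i.succAbove k) ^ 2 := by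
    intro x
    rw [Fin.prod_univ_succAbove _ i, Fin.prod_univ_succAbove _ k]
    simp [hne]
  have e2 : ∑ l, (((Pi.single i 2 + Pi.single (i.succAbove k) 2 : Fin (m + 2) → ℕ) l : ℕ) : ℝ)
      = 4 := by
    rw [Fin.sum_univ_succAbove _ i, Fin.sum_univ_succAbove _ k]
    simp [hne]
    norm_num
  simp only [e1, e2] at h
  rw [h, Fin.prod_univ_succAbove _ i, Fin.prod_univ_succAbove _ k, vol_lqBall hq, mixedMoment]
  simp only [Pi.add_apply, Pi.single_eq_same, Pi.single_apply, Fin.succAbove_ne,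
    (Fin.succAbove_ne i k).symm, hne, if_false, Nat.cast_zero,
    add_zero, Nat.cast_ofNat, zero_add, one_mul, div_one, Finset.prod_const, Finset.card_univ,
    Fintype.card_fin]
  have ht := recip_nonneg q
  have h1 := Gamma_one_add_pos ht
  have h2 := Gamma_one_add_pos (s := ((m + 2 : ℕ) : ℝ) * recip q) (by positivity)
  have h3 := Gamma_one_add_pos (s := (((m + 2 : ℕ) : ℝ) + 4) * recip q) (by positivity)
  norm_num only
  field_simp
  ring

/-! ### Bordered determinants and Gram determinants -/

open Matrix in
-- Expand along the first row, then each minor along its first column. With the adjugate in place of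
-- an inverse, the identity also covers singular `G`, so no genericity of the rows is needed later.
theorem det_bordered {k : ℕ} (c : ℝ) (v : Fin k → ℝ) (G : Matrix (Fin k) (Fin k) ℝ) :
    det (of (Fin.cons (Fin.cons c v) fun i => Fin.cons (v i) (G i)) :
      Matrix (Fin (k + 1)) (Fin (k + 1)) ℝ) = c * det G - v ⬝ᵥ (adjugate G *ᵥ v) := by
  rw [det_succ_row_zero, Fin.sum_univ_succ]
  have h0 : (of (Fin.cons (Fin.cons c v) fun i => Fin.cons (v i) (G i)) :
      Matrix (Fin (k + 1)) (Fin (k + 1)) ℝ).submatrix Fin.succ (Fin.succAbove 0) = G := by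
    ext i j; simp
  rw [h0]
  simp only [Fin.val_zero, pow_zero, one_mul, of_apply, Fin.cons_zero, Fin.cons_succ, sub_eq_add_neg]
  congr 1
  cases k with
  | zero => simp [dotProduct]
  | succ k =>
    have hN : ∀ j : Fin (k + 1), ((of (Fin.cons (Fin.cons c v) fun i => Fin.cons (v i) (G i)) :
        Matrix (Fin (k + 2)) (Fin (k + 2)) ℝ).submatrix Fin.succ (Fin.succAbove j.succ)).det =
        (-1) ^ (j : ℕ) * (adjugate G *ᵥ v) j := by
      intro j
      rw [det_succ_column_zero, mulVec, dotProduct, Finset.mul_sum]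
      refine Finset.sum_congr rfl fun i _ => ?_
      rw [adjugate_fin_succ_eq_det_submatrix]
      have : ((of (Fin.cons (Fin.cons c v) fun i => Fin.cons (v i) (G i)) :
        Matrix (Fin (k + 2)) (Fin (k + 2)) ℝ).submatrix Fin.succ (Fin.succAbove j.succ)).submatrix
          i.succAbove Fin.succ = G.submatrix i.succAbove j.succAbove := by
        ext a b; simp
      rw [this]
      have h2 : ((-1 : ℝ) ^ (j : ℕ)) * (-1) ^ (j : ℕ) = 1 := by
        rw [← mul_pow]; simp
      simp only [submatrix_apply, Fin.succAbove_ne_zero_zero (Fin.succ_ne_zero j), of_apply,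
        Fin.cons_succ, Fin.cons_zero, pow_add]
      linear_combination (-1) ^ (i : ℕ) * v i * (G.submatrix i.succAbove j.succAbove).det * (-h2)
    simp only [hN, dotProduct, ← Finset.sum_neg_distrib]
    refine Finset.sum_congr rfl fun j _ => ?_
    have h2 : ((-1 : ℝ) ^ (j : ℕ)) * (-1) ^ (j : ℕ) = 1 := by
      rw [← mul_pow]; simp
    rw [Fin.val_succ, pow_succ]
    linear_combination (-(v j * (adjugate G *ᵥ v) j)) * h2

open Matrix in
-- Border `G` by `(1, u)`; subtracting `u i` times the first row from row `i` clears the first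
-- column and leaves `G - u uᵀ`.
theorem det_sub_vecMulVec_self {k : ℕ} (u : Fin k → ℝ) (G : Matrix (Fin k) (Fin k) ℝ) :
    det (G - vecMulVec u u) = det G - u ⬝ᵥ (adjugate G *ᵥ u) := by
  have h := det_bordered 1 u G
  rw [one_mul] at h
  rw [← h, ← det_eq_of_forall_row_eq_smul_add_const
    (A := (of (Fin.cons (Fin.cons 1 u) fun i => Fin.cons 0 ((G - vecMulVec u u) i)) :
      Matrix (Fin (k + 1)) (Fin (k + 1)) ℝ)) (Fin.cons 0 (-u)) 0 (by simp)]
  · rw [det_succ_column_zero, Fin.sum_univ_succ]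
    simp only [of_apply, Fin.cons_zero, Fin.cons_succ, mul_zero, zero_mul, Finset.sum_const_zero,
      add_zero, Fin.val_zero, pow_zero, one_mul]
    rfl
  · intro i j
    refine Fin.cases ?_ (fun i => ?_) i
    · simp
    · refine Fin.cases ?_ (fun j => ?_) j
      · simp
      · simp [vecMulVec_apply, sub_eq_add_neg]

/-- The Gram determinant of the rows of `R`, restricted to the columns in `S`. -/
noncomputable def gramDet {n k : ℕ} (S : Finset (Fin n)) (R : Fin k → Fin n → ℝ) : ℝ :=
  Matrix.det (Matrix.of fun i j : Fin k => ∑ b ∈ S, R i b * R j b)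

/-- The matrix of the quadratic form `x ↦ gramDet S (Fin.cons x R)`. -/
noncomputable def gramForm {n k : ℕ} (S : Finset (Fin n)) (R : Fin k → Fin n → ℝ) :
    Matrix (Fin n) (Fin n) ℝ :=
  gramDet S R • Matrix.diagonal (fun b => if b ∈ S then 1 else 0) -
    (Matrix.of fun i b => if b ∈ S then R i b else 0).transpose *
      Matrix.adjugate (Matrix.of fun i j : Fin k => ∑ b ∈ S, R i b * R j b) *
      (Matrix.of fun i b => if b ∈ S then R i b else 0)

section Gram

open Matrix

variable {n k : ℕ} (S : Finset (Fin n)) (R : Fin k → Fin n → ℝ)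

theorem masked_mul_transpose :
    (of fun (i : Fin k) b => if b ∈ S then R i b else 0) *
      (of fun (i : Fin k) b => if b ∈ S then R i b else 0)ᵀ =
      of fun i j : Fin k => ∑ b ∈ S, R i b * R j b := by
  ext i j
  simp only [mul_apply, of_apply, transpose_apply]
  rw [← Finset.sum_filter_add_sum_filter_not Finset.univ (· ∈ S), Finset.sum_eq_zero (s := {x | x ∉ S})
    fun b hb => by simp [(Finset.mem_filter.1 hb).2], add_zero, Finset.filter_univ_mem]
  exact Finset.sum_congr rfl fun b hb => by simp [hb]

/-- The Gram matrix with `x` added is bordered by the inner products of `x` with the rows of `R`. -/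
theorem gramDet_cons (x : Fin n → ℝ) :
    gramDet S (Fin.cons x R : Fin (k + 1) → Fin n → ℝ) = ∑ a, ∑ b, gramForm S R a b * (x a * x b) := by
  have h1 : (of fun i j : Fin (k + 1) => ∑ b ∈ S, (Fin.cons x R : Fin (k + 1) → Fin n → ℝ) i b *
      (Fin.cons x R : Fin (k + 1) → Fin n → ℝ) j b) =
      of (Fin.cons (Fin.cons (∑ b ∈ S, x b * x b) fun i => ∑ b ∈ S, R i b * x b)
        fun i => Fin.cons (∑ b ∈ S, R i b * x b)
          ((of fun i j : Fin k => ∑ b ∈ S, R i b * R j b) i)) := by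
    ext i j
    refine Fin.cases ?_ (fun i => ?_) i <;> refine Fin.cases ?_ (fun j => ?_) j <;> simp [mul_comm]
  rw [gramDet, h1, det_bordered]
  set r : Matrix (Fin k) (Fin n) ℝ := of fun i b => if b ∈ S then R i b else 0 with hr
  have h2 : (fun i => ∑ b ∈ S, R i b * x b) = r *ᵥ x := by
    ext i
    simp [mulVec, dotProduct, hr, ite_mul]
  have h3 : ∑ a, ∑ b, gramForm S R a b * (x a * x b) = x ⬝ᵥ (gramForm S R *ᵥ x) := by
    simp only [dotProduct, mulVec, Finset.mul_sum]
    refine Finset.sum_congr rfl fun a _ => Finset.sum_congr rfl fun b _ => by ring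
  rw [h2, h3, gramForm, ← hr, sub_mulVec, dotProduct_sub, smul_mulVec, dotProduct_smul,
    ← mulVec_mulVec, ← mulVec_mulVec, dotProduct_mulVec x rᵀ, vecMul_transpose]
  congr 1
  rw [smul_eq_mul, mul_comm, gramDet]
  congr 1
  simp [dotProduct, mulVec_diagonal]

theorem gramForm_transpose : (gramForm S R)ᵀ = gramForm S R := by
  have : (of fun i j : Fin k => ∑ b ∈ S, R i b * R j b)ᵀ =
      of fun i j : Fin k => ∑ b ∈ S, R i b * R j b := by
    ext i j; simp [mul_comm]
  simp only [gramForm, transpose_sub, transpose_smul, diagonal_transpose, transpose_mul,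
    transpose_transpose, adjugate_transpose, this, Matrix.mul_assoc]

/-- `gramForm S R` is `gramDet S R` times the projection of the coordinate space of `S` onto the
orthogonal complement of the rows, of dimension `|S| - k` when the rows are independent. The
adjugate form makes this an identity valid for all rows. -/
theorem trace_gramForm : trace (gramForm S R) = ((S.card : ℝ) - k) * gramDet S R := by
  rw [gramForm, trace_sub, trace_smul, Matrix.mul_assoc, trace_mul_comm, Matrix.mul_assoc,
    masked_mul_transpose, adjugate_mul, trace_smul, trace_one, trace_diagonal, gramDet]
  simp
  ring

/-- The projection property, cleared of denominators. -/
theorem gramForm_mul_self : gramForm S R * gramForm S R = gramDet S R • gramForm S R := by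
  set r : Matrix (Fin k) (Fin n) ℝ := of fun i b => if b ∈ S then R i b else 0 with hr
  set P : Matrix (Fin n) (Fin n) ℝ := diagonal (fun b => if b ∈ S then 1 else 0) with hP
  set G := of fun i j : Fin k => ∑ b ∈ S, R i b * R j b with hG
  have hPP : P * P = P := by
    rw [hP, diagonal_mul_diagonal]; congr 1; ext b; split_ifs <;> simp
  have hrP : r * P = r := by
    ext i b; rw [hP, mul_diagonal, hr]; simp only [of_apply]; split_ifs <;> simp
  have hPr : P * rᵀ = rᵀ := by
    have := congrArg transpose hrP
    rwa [transpose_mul, hP, diagonal_transpose] at this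
  have hrr : r * rᵀ = G := masked_mul_transpose S R
  have hM : (rᵀ * adjugate G * r) * (rᵀ * adjugate G * r) = gramDet S R • (rᵀ * adjugate G * r) := by
    rw [show (rᵀ * adjugate G * r) * (rᵀ * adjugate G * r) =
      rᵀ * (adjugate G * (r * rᵀ)) * adjugate G * r by simp only [Matrix.mul_assoc], hrr,
      adjugate_mul]
    simp [gramDet, hG]
  have h1 : P * (rᵀ * adjugate G * r) = rᵀ * adjugate G * r := by
    rw [← Matrix.mul_assoc, ← Matrix.mul_assoc, hPr]
  have h2 : (rᵀ * adjugate G * r) * P = rᵀ * adjugate G * r := by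
    rw [Matrix.mul_assoc, hrP]
  have hform : gramForm S R = gramDet S R • P - rᵀ * adjugate G * r := rfl
  rw [hform, Matrix.sub_mul, Matrix.mul_sub, Matrix.mul_sub, hM]
  simp only [Matrix.smul_mul, Matrix.mul_smul, hPP, h1, h2, smul_sub, sub_self, sub_zero]

/-- Deleting column `a` changes the Gram matrix by a rank-one term, so this is
`det_sub_vecMulVec_self`. It is what makes the recursion for fourth moments close. -/
theorem gramForm_diag (a : Fin n) :
    gramForm S R a a = if a ∈ S then gramDet (S.erase a) R else 0 := by
  have hform : gramForm S R a a = gramDet S R * (if a ∈ S then 1 else 0) -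
      ∑ j, (∑ i, (if a ∈ S then R i a else 0) *
        adjugate (of fun i j : Fin k => ∑ b ∈ S, R i b * R j b) i j) *
        (if a ∈ S then R j a else 0) := by
    simp [gramForm, mul_apply, Matrix.sub_apply]
  rw [hform]
  split_ifs with ha
  · have h1 : (of fun i j : Fin k => ∑ b ∈ S.erase a, R i b * R j b) =
        (of fun i j : Fin k => ∑ b ∈ S, R i b * R j b) -
          vecMulVec (fun i => R i a) (fun i => R i a) := by
      ext i j
      rw [Matrix.sub_apply, of_apply, of_apply, vecMulVec_apply, ← Finset.sum_erase_add S _ ha]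
      ring
    rw [gramDet, gramDet, h1, det_sub_vecMulVec_self, mul_one, dotProduct_mulVec]
    rfl
  · simp

theorem gramDet_univ_eq_sq (R : Fin n → Fin n → ℝ) :
    gramDet Finset.univ R = det (of R) ^ 2 := by
  have : (of fun i j : Fin n => ∑ b, R i b * R j b) = of R * (of R)ᵀ := by
    ext i j; simp [mul_apply]
  rw [gramDet, this, det_mul, det_transpose, sq]

end Gram

/-! ### Second and fourth moments of random determinants -/

/-- The uniform distribution on `B_q^n`. -/
noncomputable def lqLaw (q : ℝ≥0∞) (n : ℕ) : Measure (Fin n → ℝ) :=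
  ProbabilityTheory.cond volume (lqBall q n)

theorem isProbabilityMeasure_lqLaw {q : ℝ≥0∞} (hq : 1 ≤ q) (n : ℕ) :
    IsProbabilityMeasure (lqLaw q n) :=
  ProbabilityTheory.cond_isProbabilityMeasure_of_finite (volume_lqBall_ne_zero hq n)
    (volume_lqBall_ne_top hq n)

theorem uniformPoints_lqBall (q : ℝ≥0∞) (n N : ℕ) :
    uniformPoints (lqBall q n) N = Measure.pi fun _ => lqLaw q n := rfl

theorem integral_lqLaw (q : ℝ≥0∞) (n : ℕ) (f : (Fin n → ℝ) → ℝ) :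
    ∫ x, f x ∂(lqLaw q n) = (vol (lqBall q n))⁻¹ * ∫ x in lqBall q n, f x := by
  rw [lqLaw, ProbabilityTheory.cond, integral_smul_measure, smul_eq_mul, ENNReal.toReal_inv]
  rfl

theorem ae_mem_lqBall {q : ℝ≥0∞} (hq : 1 ≤ q) (n : ℕ) : ∀ᵐ x ∂(lqLaw q n), x ∈ lqBall q n :=
  ProbabilityTheory.ae_cond_mem (measurableSet_lqBall hq n)

theorem ae_pi_mem_lqBall {q : ℝ≥0∞} (hq : 1 ≤ q) (n N : ℕ) :
    ∀ᵐ X ∂(Measure.pi fun _ : Fin N => lqLaw q n), X ∈ Set.pi Set.univ fun _ => lqBall q n := by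
  have := isProbabilityMeasure_lqLaw hq n
  have : ∀ i : Fin N, ∀ᵐ X ∂(Measure.pi fun _ : Fin N => lqLaw q n), X i ∈ lqBall q n := fun i =>
    (Measure.tendsto_eval_ae_ae (μ := fun _ : Fin N => lqLaw q n) (i := i)).eventually
      (ae_mem_lqBall hq n)
  filter_upwards [ae_all_iff.2 this] with X hX i _ using hX i

theorem memLp_pi_lqLaw {q : ℝ≥0∞} (hq : 1 ≤ q) (n N : ℕ) {f : (Fin N → Fin n → ℝ) → ℝ}
    (hf : Continuous f) (p : ℝ≥0∞) : MemLp f p (Measure.pi fun _ => lqLaw q n) := by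
  have := isProbabilityMeasure_lqLaw hq n
  obtain ⟨C, hC⟩ := (isCompact_univ_pi fun _ : Fin N => isCompact_lqBall hq n).exists_bound_of_continuousOn
    hf.continuousOn
  exact MemLp.of_bound hf.aestronglyMeasurable C
    ((ae_pi_mem_lqBall hq n N).mono fun X hX => hC X hX)

theorem integrable_pi_lqLaw {q : ℝ≥0∞} (hq : 1 ≤ q) (n N : ℕ) {f : (Fin N → Fin n → ℝ) → ℝ}
    (hf : Continuous f) : Integrable f (Measure.pi fun _ => lqLaw q n) :=
  memLp_one_iff_integrable.1 (memLp_pi_lqLaw hq n N hf 1)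

theorem integrable_lqLaw {q : ℝ≥0∞} (hq : 1 ≤ q) (n : ℕ) {f : (Fin n → ℝ) → ℝ}
    (hf : Continuous f) : Integrable f (lqLaw q n) := by
  have := isProbabilityMeasure_lqLaw hq n
  obtain ⟨C, hC⟩ := (isCompact_lqBall hq n).exists_bound_of_continuousOn hf.continuousOn
  exact Integrable.of_bound hf.aestronglyMeasurable C ((ae_mem_lqBall hq n).mono fun X hX => hC X hX)

theorem integral_pi_lqLaw_succ {q : ℝ≥0∞} (hq : 1 ≤ q) (n N : ℕ)
    {f : (Fin (N + 1) → Fin n → ℝ) → ℝ} (hf : Continuous f) :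
    ∫ X, f X ∂(Measure.pi fun _ => lqLaw q n) =
      ∫ R, ∫ x, f (Fin.cons x R) ∂(lqLaw q n) ∂(Measure.pi fun _ : Fin N => lqLaw q n) := by
  have := isProbabilityMeasure_lqLaw hq n
  have h := (measurePreserving_piFinSuccAbove (fun _ : Fin (N + 1) => lqLaw q n) 0).symm
  have e : ∀ z : (Fin n → ℝ) × (Fin N → Fin n → ℝ),
      (MeasurableEquiv.piFinSuccAbove (fun _ : Fin (N + 1) => Fin n → ℝ) 0).symm z =
        Fin.cons z.1 z.2 := fun z => by
    simp [MeasurableEquiv.piFinSuccAbove, Fin.consEquiv]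
  rw [← h.integral_comp', integral_prod_symm]
  · simp only [e]
  · exact (h.integrable_comp_emb (MeasurableEquiv.measurableEmbedding _)).2
      (integrable_pi_lqLaw hq n (N + 1) hf)

theorem integral_lqLaw_mul {q : ℝ≥0∞} (hq : 1 ≤ q) {n : ℕ} (a b : Fin n) :
    ∫ x, x a * x b ∂(lqLaw q n) = if a = b then secondMoment (recip q) n else 0 := by
  rw [integral_lqLaw]
  split_ifs with h
  · subst h
    simp only [← sq]
    rw [setIntegral_lqBall_sq hq, inv_mul_cancel_left₀ (vol_lqBall_pos hq n).ne']
  · rw [setIntegral_lqBall_eq_zero a, mul_zero]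
    intro x
    simp [flipCoord, Ne.symm h]

/-- The three pairings are those of Wick's formula; the last term corrects for the fourth moment not
being three times the mixed one. -/
theorem integral_lqLaw_mul_mul_mul {q : ℝ≥0∞} (hq : 1 ≤ q) {n : ℕ} (a b c d : Fin n) :
    ∫ x, x a * x b * (x c * x d) ∂(lqLaw q n) =
      mixedMoment (recip q) n * ((if a = b then 1 else 0) * (if c = d then 1 else 0)
        + (if a = c then 1 else 0) * (if b = d then 1 else 0)
        + (if a = d then 1 else 0) * (if b = c then 1 else 0))
      + (fourthMoment (recip q) n - 3 * mixedMoment (recip q) n) *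
        ((if a = b then 1 else 0) * (if a = c then 1 else 0) * (if a = d then 1 else 0)) := by
  have hv := (vol_lqBall_pos hq n).ne'
  have hsq : ∀ {i j : Fin n}, i ≠ j → ∀ f : (Fin n → ℝ) → ℝ, (∀ x, f x = x i ^ 2 * x j ^ 2) →
      ∫ x, f x ∂(lqLaw q n) = mixedMoment (recip q) n := by
    intro i j hij f hf
    simp only [hf]
    rw [integral_lqLaw, setIntegral_lqBall_sq_mul_sq hq hij, inv_mul_cancel_left₀ hv]
  have hzero : ∀ (i : Fin n) (f : (Fin n → ℝ) → ℝ), (∀ x, f (flipCoord i x) = -f x) →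
      ∫ x, f x ∂(lqLaw q n) = 0 := by
    intro i f hf
    rw [integral_lqLaw, setIntegral_lqBall_eq_zero i hf, mul_zero]
  by_cases hab : a = b
  · subst hab
    by_cases hcd : c = d
    · subst hcd
      by_cases hac : a = c
      · subst hac
        have : ∀ x : Fin n → ℝ, x a * x a * (x a * x a) = x a ^ 4 := fun x => by ring
        simp only [this, if_true]
        rw [integral_lqLaw, setIntegral_lqBall_pow_four hq, inv_mul_cancel_left₀ hv]
        ring
      · rw [hsq hac _ fun x => by ring]
        simp [hac]
    · by_cases hac : a = c
      · subst hac
        rw [hzero d _ fun x => by simp [flipCoord, hcd]]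
        simp [hcd]
      · rw [hzero c _ fun x => by simp [flipCoord, hac, Ne.symm hcd]]
        simp [hcd, hac]
  · by_cases hac : a = c
    · subst hac
      by_cases hbd : b = d
      · subst hbd
        rw [hsq hab _ fun x => by ring]
        simp [hab]
      · by_cases had : a = d
        · subst had
          rw [hzero b _ fun x => by simp [flipCoord, hab]]
          simp [hab, Ne.symm hab]
        · rw [hzero d _ fun x => by simp [flipCoord, hbd, had]]
          simp [hab, hbd, had]
    · by_cases had : a = d
      · subst had
        by_cases hbc : b = c
        · subst hbc
          rw [hsq hab _ fun x => by ring]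
          simp [hab]
        · rw [hzero b _ fun x => by simp [flipCoord, hab, Ne.symm hbc]]
          simp [hab, hbc, hac]
      · rw [hzero a _ fun x => by simp [flipCoord, Ne.symm hab, Ne.symm hac, Ne.symm had]]
        simp [hab, hac, had]

theorem integral_lqLaw_quadratic {q : ℝ≥0∞} (hq : 1 ≤ q) {n : ℕ} (Q : Fin n → Fin n → ℝ) :
    ∫ x, ∑ a, ∑ b, Q a b * (x a * x b) ∂(lqLaw q n) = secondMoment (recip q) n * ∑ a, Q a a := by
  rw [integral_finsetSum _ fun a _ => integrable_lqLaw hq n (by fun_prop), Finset.mul_sum]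
  refine Finset.sum_congr rfl fun a _ => ?_
  rw [integral_finsetSum _ fun b _ => integrable_lqLaw hq n (by fun_prop)]
  simp_rw [integral_const_mul, integral_lqLaw_mul hq]
  simp [mul_comm]

/-- Contracting the fourth moment tensor with `Q ⊗ Q`: the three pairings give the squared trace and
twice the trace of `Q * Q`, and the correction gives the squared diagonal. -/
theorem integral_lqLaw_quadratic_sq {q : ℝ≥0∞} (hq : 1 ≤ q) {n : ℕ} {Q : Fin n → Fin n → ℝ}
    (hQ : ∀ a b, Q b a = Q a b) :
    ∫ x, (∑ a, ∑ b, Q a b * (x a * x b)) ^ 2 ∂(lqLaw q n) =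
      mixedMoment (recip q) n * ((∑ a, Q a a) ^ 2 + 2 * ∑ a, ∑ b, Q a b * Q b a)
      + (fourthMoment (recip q) n - 3 * mixedMoment (recip q) n) * ∑ a, Q a a ^ 2 := by
  have e : ∀ x : Fin n → ℝ, (∑ a, ∑ b, Q a b * (x a * x b)) ^ 2 =
      ∑ a, ∑ b, ∑ c, ∑ d, (Q a b * Q c d) * (x a * x b * (x c * x d)) := by
    intro x
    rw [sq, Finset.sum_mul]
    refine Finset.sum_congr rfl fun a _ => ?_
    rw [Finset.sum_mul]
    refine Finset.sum_congr rfl fun b _ => ?_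
    rw [Finset.mul_sum]
    refine Finset.sum_congr rfl fun c _ => ?_
    rw [Finset.mul_sum]
    exact Finset.sum_congr rfl fun d _ => by ring
  simp only [e]
  rw [integral_finsetSum _ fun a _ => integrable_lqLaw hq n (by fun_prop)]
  have h1 : ∀ a, ∫ x, ∑ b, ∑ c, ∑ d, (Q a b * Q c d) * (x a * x b * (x c * x d)) ∂(lqLaw q n) =
      ∑ b, ∑ c, ∑ d, (Q a b * Q c d) * ∫ x, (x a * x b * (x c * x d)) ∂(lqLaw q n) := by
    intro a
    rw [integral_finsetSum _ fun b _ => integrable_lqLaw hq n (by fun_prop)]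
    refine Finset.sum_congr rfl fun b _ => ?_
    rw [integral_finsetSum _ fun c _ => integrable_lqLaw hq n (by fun_prop)]
    refine Finset.sum_congr rfl fun c _ => ?_
    rw [integral_finsetSum _ fun d _ => integrable_lqLaw hq n (by fun_prop)]
    exact Finset.sum_congr rfl fun d _ => integral_const_mul _ _
  simp only [h1]
  simp only [integral_lqLaw_mul_mul_mul hq]
  simp only [mul_add, Finset.sum_add_distrib, ← mul_assoc]
  simp only [mul_ite, mul_one, mul_zero, Finset.sum_ite_eq, Finset.mem_univ,
    if_true, Finset.sum_ite_irrel, Finset.sum_const_zero]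
  have hsym : ∀ a b, Q a b * Q b a = Q a b * Q a b := fun a b => by rw [hQ]
  simp only [hsym, sq, Finset.sum_mul, Finset.mul_sum]
  congr 1
  · simp only [← Finset.sum_add_distrib]
    exact Finset.sum_congr rfl fun a _ => Finset.sum_congr rfl fun b _ => by ring
  · exact Finset.sum_congr rfl fun a _ => by ring

theorem continuous_gramDet {n k : ℕ} (S : Finset (Fin n)) :
    Continuous (gramDet S : (Fin k → Fin n → ℝ) → ℝ) :=
  Continuous.matrix_det (by fun_prop)

theorem sum_gramForm_diag {n k : ℕ} (S : Finset (Fin n)) (R : Fin k → Fin n → ℝ) :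
    ∑ a, gramForm S R a a = ((S.card : ℝ) - k) * gramDet S R :=
  trace_gramForm S R

theorem integral_gramDet_cons {q : ℝ≥0∞} (hq : 1 ≤ q) {n k : ℕ} (S : Finset (Fin n))
    (R : Fin k → Fin n → ℝ) :
    ∫ x, gramDet S (Fin.cons x R : Fin (k + 1) → Fin n → ℝ) ∂(lqLaw q n) =
      secondMoment (recip q) n * (((S.card : ℝ) - k) * gramDet S R) := by
  simp only [gramDet_cons]
  rw [integral_lqLaw_quadratic hq (fun a b => gramForm S R a b), sum_gramForm_diag]

/-- All three invariants of the form are known: the trace, the trace of the square by the projection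
identity, and the diagonal as Gram determinants with one column fewer. -/
theorem integral_gramDet_cons_sq {q : ℝ≥0∞} (hq : 1 ≤ q) {n k : ℕ} (S : Finset (Fin n))
    (R : Fin k → Fin n → ℝ) :
    ∫ x, gramDet S (Fin.cons x R : Fin (k + 1) → Fin n → ℝ) ^ 2 ∂(lqLaw q n) =
      mixedMoment (recip q) n * (((S.card : ℝ) - k) * ((S.card : ℝ) - k + 2)) * gramDet S R ^ 2
      + (fourthMoment (recip q) n - 3 * mixedMoment (recip q) n) *
        ∑ a ∈ S, gramDet (S.erase a) R ^ 2 := by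
  have hsym : ∀ a b, gramForm S R b a = gramForm S R a b := fun a b =>
    congrFun (congrFun (gramForm_transpose S R) a) b
  have htr : ∑ a, ∑ b, gramForm S R a b * gramForm S R b a =
      gramDet S R * (((S.card : ℝ) - k) * gramDet S R) := by
    have := congrArg Matrix.trace (gramForm_mul_self S R)
    rw [Matrix.trace_smul, trace_gramForm] at this
    simpa [Matrix.trace, Matrix.mul_apply] using this
  simp only [gramDet_cons]
  rw [integral_lqLaw_quadratic_sq hq (Q := fun a b => gramForm S R a b) hsym, sum_gramForm_diag, htr]
  simp only [gramForm_diag]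
  have : ∑ a, (if a ∈ S then gramDet (S.erase a) R else 0) ^ 2 =
      ∑ a ∈ S, gramDet (S.erase a) R ^ 2 := by
    simp [ite_pow]
  rw [this]
  ring

theorem integral_gramDet {q : ℝ≥0∞} (hq : 1 ≤ q) {n : ℕ} (S : Finset (Fin n)) (k : ℕ) :
    ∫ X, gramDet S X ∂(Measure.pi fun _ : Fin k => lqLaw q n) =
      ∏ i ∈ Finset.range k, (secondMoment (recip q) n * ((S.card : ℝ) - i)) := by
  have := isProbabilityMeasure_lqLaw hq n
  induction k with
  | zero => simp [gramDet]
  | succ k ih =>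
    rw [integral_pi_lqLaw_succ hq n k (continuous_gramDet S)]
    simp only [integral_gramDet_cons hq, integral_const_mul, ih]
    rw [Finset.prod_range_succ]
    ring

/-- The recursion satisfied by the second moments of Gram determinants. -/
def gramRec (A B : ℝ) : ℕ → ℕ → ℝ
  | _, 0 => 1
  | m, k + 1 => A * (((m : ℝ) - k) * ((m : ℝ) - k + 2)) * gramRec A B m k
      + B * (m * gramRec A B (m - 1) k)

theorem integral_gramDet_sq {q : ℝ≥0∞} (hq : 1 ≤ q) {n : ℕ} (k : ℕ) :
    ∀ S : Finset (Fin n), ∫ X, gramDet S X ^ 2 ∂(Measure.pi fun _ : Fin k => lqLaw q n) =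
      gramRec (mixedMoment (recip q) n)
        (fourthMoment (recip q) n - 3 * mixedMoment (recip q) n) S.card k := by
  have := isProbabilityMeasure_lqLaw hq n
  induction k with
  | zero => intro S; simp [gramDet, gramRec]
  | succ k ih =>
    intro S
    rw [integral_pi_lqLaw_succ hq n k (f := fun X => gramDet S X ^ 2) ((continuous_gramDet S).pow 2)]
    simp only [integral_gramDet_cons_sq hq]
    have hi : ∀ T : Finset (Fin n), Integrable (fun X : Fin k → Fin n → ℝ => gramDet T X ^ 2)
        (Measure.pi fun _ => lqLaw q n) := fun T =>
      integrable_pi_lqLaw hq n k ((continuous_gramDet T).pow 2)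
    rw [integral_add ((hi S).const_mul _)
      ((integrable_finsetSum _ fun a _ => hi (S.erase a)).const_mul _), integral_const_mul,
      integral_const_mul, integral_finsetSum _ fun a _ => hi (S.erase a), ih, gramRec]
    congr 2
    rw [Finset.sum_congr rfl fun a ha => by rw [ih, Finset.card_erase_of_mem ha]]
    simp

/-- Unrolling the recursion, each row either keeps the columns (factor `A`) or deletes one (factor
`B`). A deletion lowers the numbers of columns and of remaining rows together, so the factors of the
keeping steps do not depend on where deletions occur. Hence the binomial coefficient. -/
theorem gramRec_eq_sum (A B : ℝ) (k : ℕ) : ∀ m : ℕ, gramRec A B m k =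
    ∑ j ∈ Finset.range (k + 1), (k.choose j : ℝ) * (B ^ j * A ^ (k - j) * (m.descFactorial j : ℝ) *
      ∏ i ∈ Finset.range (k - j), (((m : ℝ) - j - i) * ((m : ℝ) - j - i + 2))) := by
  induction k with
  | zero => intro m; simp [gramRec]
  | succ k ih =>
    intro m
    rw [gramRec, ih, ih, Finset.sum_choose_succ_mul (fun j l => B ^ j * A ^ l *
      (m.descFactorial j : ℝ) * ∏ i ∈ Finset.range l, (((m : ℝ) - j - i) * ((m : ℝ) - j - i + 2))) k,
      Finset.mul_sum, Finset.mul_sum, Finset.mul_sum]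
    congr 1
    · refine Finset.sum_congr rfl fun j hj => ?_
      have hj : j ≤ k := Nat.lt_succ_iff.1 (Finset.mem_range.1 hj)
      rw [show k + 1 - j = k - j + 1 by omega, Finset.prod_range_succ, pow_succ, Nat.cast_sub hj]
      ring
    · refine Finset.sum_congr rfl fun j hj => ?_
      -- At `m = 0` the factor `m` annihilates the term with the truncated `m - 1`.
      cases m with
      | zero => simp
      | succ m =>
        rw [Nat.add_sub_cancel, Nat.succ_descFactorial_succ]
        have : ∀ i : ℕ, ((m + 1 : ℕ) : ℝ) - ((j + 1 : ℕ) : ℝ) - i = (m : ℝ) - j - i := by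
          intro i; push_cast; ring
        simp only [this, pow_succ]
        push_cast
        ring

theorem prod_range_mul_add_two (N : ℕ) :
    ∏ i ∈ Finset.range N, (((N : ℝ) - i) * ((N : ℝ) - i + 2)) = (N ! : ℝ) * ((N + 2)! : ℝ) / 2 := by
  induction N with
  | zero => simp
  | succ N ih =>
    rw [Finset.prod_range_succ']
    have : ∀ i : ℕ, ((N + 1 : ℕ) : ℝ) - ((i + 1 : ℕ) : ℝ) = (N : ℝ) - i := fun i => by push_cast; ring
    simp only [this, ih, show N + 1 + 2 = N + 2 + 1 by ring, Nat.factorial_succ]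
    push_cast
    ring

/-- Keeping `x` independent of the upper limit `N` is what allows the induction; `x = N = n` is the
case used. -/
theorem sum_pow_div_factorial_mul (s x : ℝ) (N : ℕ) :
    ∑ k ∈ Finset.range (N + 1), s ^ k / (k ! : ℝ) * ((x - k + 1) * (x - k + 2)) =
      ((x + 1) * (x + 2) - 2 * (x + 1) * s + s ^ 2) * ∑ k ∈ Finset.range (N + 1), s ^ k / (k ! : ℝ)
      + (2 * x + 2 - N - s) * (s ^ (N + 1) / (N ! : ℝ)) := by
  induction N with
  | zero => simp; ring
  | succ N ih =>
    rw [Finset.sum_range_succ, ih, Finset.sum_range_succ _ (N + 1), Nat.factorial_succ]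
    have : (N ! : ℝ) ≠ 0 := by positivity
    have : (N + 1 : ℝ) ≠ 0 := by positivity
    push_cast
    field_simp
    ring

theorem phiFun_eq_sum (s : ℝ) (n : ℕ) :
    ((n : ℝ) + 1) * ((n : ℝ) + 2) * phiFun s n =
      ∑ k ∈ Finset.range (n + 1), s ^ k / (k ! : ℝ) * (((n : ℝ) - k + 1) * ((n : ℝ) - k + 2)) := by
  rw [sum_pow_div_factorial_mul, phiFun, show n + 2 = n + 1 + 1 by ring, Nat.factorial_succ (n + 1),
    Nat.factorial_succ n]
  have : (n ! : ℝ) ≠ 0 := by positivity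
  push_cast
  field_simp
  ring

/-- For as many rows as columns the products are `(n - j)! * (n - j + 2)! / 2`. Together with the
binomial coefficients and falling factorials they produce the summands of `phiFun_eq_sum` with
argument `B / A`. -/
theorem gramRec_diag {A : ℝ} (hA : A ≠ 0) (B : ℝ) (n : ℕ) :
    gramRec A B n n = A ^ n * (n ! : ℝ) ^ 2 * (((n : ℝ) + 1) * ((n : ℝ) + 2) / 2) * phiFun (B / A) n := by
  have h := phiFun_eq_sum (B / A) n
  rw [gramRec_eq_sum, show A ^ n * (n ! : ℝ) ^ 2 * (((n : ℝ) + 1) * ((n : ℝ) + 2) / 2) *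
    phiFun (B / A) n = A ^ n * (n ! : ℝ) ^ 2 / 2 *
      (((n : ℝ) + 1) * ((n : ℝ) + 2) * phiFun (B / A) n) by ring, h, Finset.mul_sum]
  refine Finset.sum_congr rfl fun j hj => ?_
  have hj : j ≤ n := Nat.lt_succ_iff.1 (Finset.mem_range.1 hj)
  have e : ∀ i : ℕ, (n : ℝ) - j - i = ((n - j : ℕ) : ℝ) - i := fun i => by rw [Nat.cast_sub hj]
  simp only [e, prod_range_mul_add_two]
  have h1 : (n.choose j : ℝ) * (j ! : ℝ) * ((n - j)! : ℝ) = n ! := by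
    exact_mod_cast Nat.choose_mul_factorial_mul_factorial hj
  have h2 : ((n - j)! : ℝ) * (n.descFactorial j : ℝ) = n ! := by
    exact_mod_cast Nat.factorial_mul_descFactorial hj
  have h3 : ((n - j + 2)! : ℝ) = ((n : ℝ) - j + 2) * ((n : ℝ) - j + 1) * (n - j)! := by
    rw [Nat.factorial_succ, Nat.factorial_succ]; push_cast [Nat.cast_sub hj]; ring
  have h4 : A ^ n = A ^ j * A ^ (n - j) := by rw [← pow_add, Nat.add_sub_cancel' hj]
  have hf : (j ! : ℝ) ≠ 0 := by positivity
  rw [h3, h4, div_pow]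
  field_simp
  rw [← h2]
  nth_rewrite 1 [← h2] at h1
  linear_combination (B ^ j * ((n : ℝ) - j + 1) * ((n : ℝ) - j + 2) *
    (n.descFactorial j : ℝ) * ((n - j)! : ℝ)) * h1

theorem momentRatio_eq {t : ℝ} (ht : 0 ≤ t) (n : ℕ) :
    fourthMoment t n / mixedMoment t n = momentRatio t := by
  have h1 := Gamma_one_add_pos ht
  have h2 := Gamma_one_add_pos (s := 3 * t) (by positivity)
  have h3 := Gamma_one_add_pos (s := n * t) (by positivity)
  have h4 := Gamma_one_add_pos (s := ((n : ℝ) + 4) * t) (by positivity)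
  unfold fourthMoment mixedMoment momentRatio
  field_simp

theorem mixedMoment_pos {t : ℝ} (ht : 0 ≤ t) (n : ℕ) : 0 < mixedMoment t n := by
  have h1 := Gamma_one_add_pos ht
  have h2 := Gamma_one_add_pos (s := 3 * t) (by positivity)
  have h3 := Gamma_one_add_pos (s := n * t) (by positivity)
  have h4 := Gamma_one_add_pos (s := ((n : ℝ) + 4) * t) (by positivity)
  unfold mixedMoment
  positivity

theorem integral_det_sq {q : ℝ≥0∞} (hq : 1 ≤ q) (n : ℕ) :
    ∫ X, Matrix.det (Matrix.of X) ^ 2 ∂(Measure.pi fun _ : Fin n => lqLaw q n) =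
      (n ! : ℝ) * secondMoment (recip q) n ^ n := by
  simp only [← gramDet_univ_eq_sq]
  rw [integral_gramDet hq, Finset.prod_mul_distrib, Finset.prod_const, Finset.card_range, mul_comm]
  congr 1
  rw [Finset.card_univ, Fintype.card_fin, ← Finset.prod_range_reflect, ← Finset.prod_range_add_one_eq_factorial]
  push_cast
  refine Finset.prod_congr rfl fun i hi => ?_
  have := Finset.mem_range.1 hi
  rw [Nat.cast_sub (by omega), Nat.cast_sub (by omega)]
  push_cast
  ring

theorem integral_det_pow_four {q : ℝ≥0∞} (hq : 1 ≤ q) (n : ℕ) :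
    ∫ X, Matrix.det (Matrix.of X) ^ 4 ∂(Measure.pi fun _ : Fin n => lqLaw q n) =
      mixedMoment (recip q) n ^ n * (n ! : ℝ) ^ 2 * (((n : ℝ) + 1) * ((n : ℝ) + 2) / 2) *
        phiFun (momentRatio (recip q) - 3) n := by
  have hm := (mixedMoment_pos (recip_nonneg q) n).ne'
  have e : ∀ X : Fin n → Fin n → ℝ, Matrix.det (Matrix.of X) ^ 4 = gramDet Finset.univ X ^ 2 :=
    fun X => by rw [gramDet_univ_eq_sq]; ring
  simp only [e]
  rw [integral_gramDet_sq hq, Finset.card_univ, Fintype.card_fin, gramRec_diag hm, sub_div,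
    momentRatio_eq (recip_nonneg q), mul_div_cancel_right₀ _ hm]

/-! ### Volumes of the random bodies as determinants -/

/-- The standard crosspolytope in coordinates. -/
theorem volume_sum_abs_le_one (n : ℕ) :
    (volume {c : Fin n → ℝ | ∑ i, |c i| ≤ 1}).toReal = 2 ^ n / (n ! : ℝ) := by
  have h := vol_lqBall le_rfl n
  rw [lqBall_of_ne_top ENNReal.one_ne_top] at h
  simp only [ENNReal.toReal_one, Real.rpow_one, recip, inv_one, mul_one] at h
  rw [vol] at h
  rw [h, one_add_one_eq_two, Real.Gamma_two, add_comm, Real.Gamma_nat_eq_factorial]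
  simp

/-- `lintegral_ball_prod` with exponent `1` and the indicator of the half-line, homogeneous of
degree `0`, in each coordinate. -/
theorem volume_corner_simplex (n : ℕ) :
    (volume {c : Fin n → ℝ | (∀ i, 0 ≤ c i) ∧ ∑ i, c i ≤ 1}).toReal = 1 / (n ! : ℝ) := by
  have hint : ∀ _ : Fin n, Integrable fun x : ℝ =>
      (Set.Ici (0 : ℝ)).indicator (fun _ => (1 : ℝ)) x * Real.exp (-|x| ^ (1 : ℝ)) := by
    intro _
    have : (fun x : ℝ => (Set.Ici (0 : ℝ)).indicator (fun _ => (1 : ℝ)) x *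
        Real.exp (-|x| ^ (1 : ℝ))) = (Set.Ici (0 : ℝ)).indicator fun x => Real.exp (-x) := by
      ext x
      by_cases hx : 0 ≤ x <;> simp [Set.indicator, hx, abs_of_nonneg]
    rw [this, integrable_indicator_iff measurableSet_Ici]
    exact Iff.mpr integrableOn_Ici_iff_integrableOn_Ioi (integrableOn_exp_neg_Ioi 0)
  have h1 : ∫ x : ℝ, (Set.Ici (0 : ℝ)).indicator (fun _ => (1 : ℝ)) x *
      Real.exp (-|x| ^ (1 : ℝ)) = 1 := by
    have : (fun x : ℝ => (Set.Ici (0 : ℝ)).indicator (fun _ => (1 : ℝ)) x *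
        Real.exp (-|x| ^ (1 : ℝ))) = (Set.Ici (0 : ℝ)).indicator fun x => Real.exp (-x) := by
      ext x
      by_cases hx : 0 ≤ x <;> simp [Set.indicator, hx, abs_of_nonneg]
    rw [this, integral_indicator measurableSet_Ici, integral_Ici_eq_integral_Ioi,
      integral_exp_neg_Ioi]
    simp
  have key := lintegral_ball_prod (n := n) (r := 1) one_pos
    (g := fun _ => (Set.Ici (0 : ℝ)).indicator fun _ => (1 : ℝ)) (a := 0)
    (fun _ => measurable_const.indicator measurableSet_Ici)
    (fun _ x => Set.indicator_nonneg (fun _ _ => zero_le_one) x)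
    (fun _ s x hs => by simp [Set.indicator, mul_nonneg_iff_of_pos_left hs]) hint
  simp only [h1] at key
  simp only [Finset.prod_const_one, Pi.zero_apply, CharP.cast_eq_zero, Finset.sum_const_zero,
    add_zero, inv_one, mul_one, Real.rpow_one] at key
  have h2 : ∀ x : Fin n → ℝ, ENNReal.ofReal (∏ i, (Set.Ici (0 : ℝ)).indicator (fun _ => (1 : ℝ)) (x i))
      = Set.indicator {x : Fin n → ℝ | ∀ i, 0 ≤ x i} (fun _ => 1) x := by
    intro x
    by_cases hx : ∀ i, 0 ≤ x i
    · simp [Set.indicator, hx]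
    · have : ∏ i, (Set.Ici (0 : ℝ)).indicator (fun _ => (1 : ℝ)) (x i) = 0 := by
        push Not at hx
        obtain ⟨i, hi⟩ := hx
        exact Finset.prod_eq_zero (Finset.mem_univ i) (by simp [Set.indicator, hi])
      rw [this]
      simp [Set.indicator, hx]
  have hmeas : MeasurableSet {x : Fin n → ℝ | ∀ i, 0 ≤ x i} := by
    have : {x : Fin n → ℝ | ∀ i, 0 ≤ x i} = ⋂ i, {x | 0 ≤ x i} := by ext; simp
    rw [this]
    exact MeasurableSet.iInter fun i => measurableSet_le measurable_const (measurable_pi_apply i)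
  simp only [h2] at key
  rw [lintegral_indicator hmeas, setLIntegral_one, Measure.restrict_apply hmeas] at key
  have h3 : {c : Fin n → ℝ | (∀ i, 0 ≤ c i) ∧ ∑ i, c i ≤ 1} =
      {x : Fin n → ℝ | ∀ i, 0 ≤ x i} ∩ {x | ∑ i, |x i| ≤ 1} := by
    ext c
    simp only [Set.mem_ofPred_eq, Set.mem_inter_iff]
    refine and_congr_right fun h => ?_
    simp only [abs_of_nonneg (h _)]
  rw [h3, key, add_comm, Real.Gamma_nat_eq_factorial, ENNReal.toReal_ofReal (by positivity)]

/-- The linear map with matrix rows `x i`. -/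
noncomputable def rowMap {n : ℕ} (x : Fin n → Fin n → ℝ) : (Fin n → ℝ) →ₗ[ℝ] (Fin n → ℝ) :=
  (Matrix.of x).transpose.toLin'

theorem rowMap_apply {n : ℕ} (x : Fin n → Fin n → ℝ) (c : Fin n → ℝ) :
    rowMap x c = ∑ i, c i • x i := by
  ext j
  simp [rowMap, Matrix.mulVec, dotProduct, mul_comm]

theorem vol_rowMap_image {n : ℕ} (x : Fin n → Fin n → ℝ) (s : Set (Fin n → ℝ)) :
    (volume (rowMap x '' s)).toReal = |Matrix.det (Matrix.of x)| * (volume s).toReal := by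
  rw [Measure.addHaar_image_linearMap, ENNReal.toReal_mul, ENNReal.toReal_ofReal (abs_nonneg _),
    rowMap, LinearMap.det_toLin', Matrix.det_transpose]

/-- The assumption `1 ≤ n` is essential: for `n = 0` the hull of the empty set is empty, while the
image on the right is `{0}`. -/
theorem convexHull_range_union_neg {n : ℕ} (hn : 1 ≤ n) (x : Fin n → Fin n → ℝ) :
    convexHull ℝ (Set.range x ∪ -Set.range x) = rowMap x '' {c | ∑ i, |c i| ≤ 1} := by
  apply Set.Subset.antisymm
  · refine convexHull_min ?_ ?_
    · have h1 : ∀ i : Fin n, ∑ j, |(Pi.single i 1 : Fin n → ℝ) j| ≤ 1 := by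
        intro i
        simp [Pi.single_apply, apply_ite abs]
      rintro y (⟨i, rfl⟩ | ⟨i, hi⟩)
      · exact ⟨Pi.single i 1, h1 i, by simp [rowMap_apply, Pi.single_apply]⟩
      · refine ⟨-Pi.single i 1, by simpa using h1 i, ?_⟩
        rw [map_neg, neg_eq_iff_eq_neg, ← hi]
        simp [rowMap_apply, Pi.single_apply]
    · refine Convex.linear_image (fun c hc d hd a b ha hb hab => ?_) _
      simp only [Set.mem_ofPred_eq] at hc hd ⊢
      calc ∑ i, |(a • c + b • d) i| ≤ ∑ i, (a * |c i| + b * |d i|) := by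
            refine Finset.sum_le_sum fun i _ => ?_
            simp only [Pi.add_apply, Pi.smul_apply, smul_eq_mul]
            refine (abs_add_le _ _).trans_eq ?_
            rw [abs_mul, abs_mul, abs_of_nonneg ha, abs_of_nonneg hb]
        _ ≤ 1 := by
            rw [Finset.sum_add_distrib, ← Finset.mul_sum, ← Finset.mul_sum]
            nlinarith
  · set H := convexHull ℝ (Set.range x ∪ -Set.range x) with hH
    have hconv : Convex ℝ H := convex_convexHull ℝ _
    have hmem : ∀ i, x i ∈ H := fun i => subset_convexHull ℝ _ (Or.inl ⟨i, rfl⟩)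
    have hneg : ∀ i, -x i ∈ H := fun i => subset_convexHull ℝ _ (Or.inr (by simp))
    have h0 : (0 : Fin n → ℝ) ∈ H := by
      have := hconv (hmem ⟨0, hn⟩) (hneg ⟨0, hn⟩) (show (0 : ℝ) ≤ 1 / 2 by norm_num)
        (show (0 : ℝ) ≤ 1 / 2 by norm_num) (by norm_num)
      simpa using this
    rintro _ ⟨c, hc, rfl⟩
    simp only [Set.mem_ofPred_eq] at hc
    set s := ∑ i, |c i| with hs
    have hs0 : 0 ≤ s := by positivity
    rcases hs0.eq_or_lt with h | h
    · have : c = 0 := by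
        ext i
        have := (Finset.sum_eq_zero_iff_of_nonneg fun i _ => abs_nonneg (c i)).1 (hs ▸ h.symm) i
          (Finset.mem_univ i)
        simpa using this
      rw [this, map_zero]
      exact h0
    -- Dividing the weights by `s ≤ 1` gives a convex combination of signed points; multiplying back
    -- by `s` stays in the hull because it contains `0`.
    · have hmem' : ∑ i, (|c i| / s) • (if 0 ≤ c i then x i else -x i) ∈ H := by
        refine hconv.sum_mem (fun i _ => by positivity) ?_ fun i _ => ?_
        · rw [← Finset.sum_div, ← hs, div_self h.ne']
        · split_ifs
          · exact hmem i
          · exact hneg i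
      have := hconv.smul_mem_of_zero_mem h0 hmem' ⟨hs0, hc⟩
      convert this using 1
      rw [rowMap_apply, Finset.smul_sum]
      refine Finset.sum_congr rfl fun i _ => ?_
      rw [smul_smul, mul_div_cancel₀ _ h.ne']
      split_ifs with hi
      · rw [abs_of_nonneg hi]
      · rw [abs_of_neg (not_le.1 hi), smul_neg, neg_smul, neg_neg]

theorem crosspolytopeVol_eq {n : ℕ} (hn : 1 ≤ n) (K : Set (Fin n → ℝ)) (x : Fin n → Fin n → ℝ) :
    crosspolytopeVol K x = 2 ^ n / ((n ! : ℝ) * vol K) * |Matrix.det (Matrix.of x)| := by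
  rw [crosspolytopeVol, vol, convexHull_range_union_neg hn, vol_rowMap_image, volume_sum_abs_le_one]
  ring

theorem convexHull_range_fin_succ {n : ℕ} (x : Fin (n + 1) → Fin n → ℝ) :
    convexHull ℝ (Set.range x) = (fun y => x 0 + y) ''
      (rowMap (fun i => x i.succ - x 0) '' {c | (∀ i, 0 ≤ c i) ∧ ∑ i, c i ≤ 1}) := by
  apply Set.Subset.antisymm
  · refine convexHull_min ?_ ?_
    · rintro _ ⟨i, rfl⟩
      refine Fin.cases ?_ (fun i => ?_) i
      · exact ⟨0, ⟨0, by simp, by simp⟩, by simp⟩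
      · refine ⟨x i.succ - x 0, ⟨Pi.single i 1, ⟨fun j => ?_, by simp⟩, ?_⟩, by simp⟩
        · by_cases h : j = i <;> simp [h]
        · simp [rowMap_apply, Pi.single_apply]
    · refine Convex.translate (Convex.linear_image (fun c hc d hd a b ha hb hab => ?_) _) _
      simp only [Set.mem_ofPred_eq, Pi.add_apply, Pi.smul_apply, smul_eq_mul] at hc hd ⊢
      refine ⟨fun i => add_nonneg (mul_nonneg ha (hc.1 i)) (mul_nonneg hb (hd.1 i)), ?_⟩
      rw [Finset.sum_add_distrib, ← Finset.mul_sum, ← Finset.mul_sum]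
      nlinarith [hc.2, hd.2]
  · rintro _ ⟨_, ⟨c, ⟨hc0, hc1⟩, rfl⟩, rfl⟩
    have := (convex_convexHull ℝ (Set.range x)).sum_mem (t := Finset.univ)
      (w := (Fin.cons (1 - ∑ i, c i) c : Fin (n + 1) → ℝ)) (z := x) (fun i _ => by
        refine Fin.cases ?_ (fun i => ?_) i
        · simpa using hc1
        · simpa using hc0 i)
      (by rw [Fin.sum_univ_succ]; simp) (fun i _ => subset_convexHull ℝ _ ⟨i, rfl⟩)
    convert this using 1
    rw [Fin.sum_univ_succ, rowMap_apply]
    simp only [Fin.cons_zero, Fin.cons_succ, smul_sub, Finset.sum_sub_distrib, sub_smul, one_smul,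
      Finset.sum_smul]
    abel

/-- The determinant of the matrix with rows `x i - x 0`, as a bordered determinant. -/
theorem simplexVol_eq {n : ℕ} (K : Set (Fin n → ℝ)) (x : Fin (n + 1) → Fin n → ℝ) :
    simplexVol K x = 1 / ((n ! : ℝ) * vol K) *
      |Matrix.det (Matrix.of fun i : Fin n => x i.succ - x 0)| := by
  rw [simplexVol, vol, convexHull_range_fin_succ, Set.image_add_left, measure_preimage_add,
    vol_rowMap_image, volume_corner_simplex]
  ring

theorem det_sub_eq_det_cons_one {n : ℕ} (x : Fin (n + 1) → Fin n → ℝ) :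
    Matrix.det (Matrix.of fun i : Fin n => x i.succ - x 0) =
      Matrix.det (Matrix.of fun i => (Fin.cons 1 (x i) : Fin (n + 1) → ℝ)) := by
  rw [← Matrix.det_eq_of_forall_row_eq_smul_add_const
    (A := (Matrix.of (Fin.cons (Fin.cons 1 (x 0)) fun i => Fin.cons 0 (x i.succ - x 0)) :
      Matrix (Fin (n + 1)) (Fin (n + 1)) ℝ)) (Fin.cons 0 (-1)) 0 (by simp)]
  · rw [Matrix.det_succ_column_zero, Fin.sum_univ_succ]
    simp only [Matrix.of_apply, Fin.cons_zero, Fin.cons_succ, mul_zero, zero_mul,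
      Finset.sum_const_zero, add_zero, Fin.val_zero, pow_zero, one_mul]
    rfl
  · intro i j
    refine Fin.cases ?_ (fun i => ?_) i
    · simp
    · refine Fin.cases ?_ (fun j => ?_) j <;> simp [sub_eq_add_neg]

/-- Expansion along the column of ones. It bounds the simplex determinant by `n + 1` determinants,
each distributed as the one for V. -/
theorem det_cons_one_eq_sum {n : ℕ} (x : Fin (n + 1) → Fin n → ℝ) :
    Matrix.det (Matrix.of fun i => (Fin.cons 1 (x i) : Fin (n + 1) → ℝ)) =
      ∑ i : Fin (n + 1), (-1) ^ (i : ℕ) * Matrix.det (Matrix.of fun j => x (i.succAbove j)) := by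
  rw [Matrix.det_succ_column_zero]
  refine Finset.sum_congr rfl fun i _ => ?_
  simp only [Matrix.of_apply, Fin.cons_zero, mul_one]
  rfl

theorem crosspolytopeMoment_eq {n : ℕ} (hn : 1 ≤ n) (q : ℝ≥0∞) (m : ℕ) :
    crosspolytopeMoment (lqBall q n) m = (2 ^ n / ((n ! : ℝ) * vol (lqBall q n))) ^ m *
      ∫ X, |Matrix.det (Matrix.of X)| ^ m ∂(Measure.pi fun _ : Fin n => lqLaw q n) := by
  simp only [crosspolytopeMoment, crosspolytopeVol_eq hn, mul_pow, integral_const_mul,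
    uniformPoints_lqBall]

theorem crosspolytopeMoment_two {q : ℝ≥0∞} (hq : 1 ≤ q) {n : ℕ} (hn : 1 ≤ n) :
    crosspolytopeMoment (lqBall q n) 2 =
        1 / (n ! : ℝ) *
          (Real.Gamma (1 + 3 * recip q) * Real.Gamma (1 + n * recip q) /
            (3 * Real.Gamma (1 + recip q) ^ 3 *
              Real.Gamma (1 + ((n : ℝ) + 2) * recip q))) ^ n *
          Real.Gamma (1 + n * recip q) ^ 2 := by
  have ht := recip_nonneg q
  have h1 := Gamma_one_add_pos ht
  have h2 := Gamma_one_add_pos (s := n * recip q) (by positivity)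
  have h3 := Gamma_one_add_pos (s := ((n : ℝ) + 2) * recip q) (by positivity)
  rw [crosspolytopeMoment_eq hn]
  simp only [sq_abs]
  rw [integral_det_sq hq, vol_lqBall hq, secondMoment]
  have : (n ! : ℝ) ≠ 0 := by positivity
  simp only [div_pow, mul_pow]
  field_simp
  ring

theorem crosspolytopeMoment_four {q : ℝ≥0∞} (hq : 1 ≤ q) {n : ℕ} (hn : 1 ≤ n) :
    crosspolytopeMoment (lqBall q n) 4 =
        ((n : ℝ) + 1) * ((n : ℝ) + 2) / (2 * (n ! : ℝ) ^ 2) *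
          (Real.Gamma (1 + 3 * recip q) ^ 2 * Real.Gamma (1 + n * recip q) /
            (9 * Real.Gamma (1 + recip q) ^ 6 *
              Real.Gamma (1 + ((n : ℝ) + 4) * recip q))) ^ n *
          Real.Gamma (1 + n * recip q) ^ 4 *
          phiFun (momentRatio (recip q) - 3) n := by
  have ht := recip_nonneg q
  have h1 := Gamma_one_add_pos ht
  have h2 := Gamma_one_add_pos (s := n * recip q) (by positivity)
  have h3 := Gamma_one_add_pos (s := ((n : ℝ) + 4) * recip q) (by positivity)
  rw [crosspolytopeMoment_eq hn]
  simp only [Even.pow_abs (show Even 4 by decide)]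
  rw [integral_det_pow_four hq, vol_lqBall hq, mixedMoment]
  have : (n ! : ℝ) ≠ 0 := by positivity
  simp only [div_pow, mul_pow]
  field_simp
  ring

theorem lqBall_moment_ratio {q : ℝ≥0∞} (hq : 1 ≤ q) {n : ℕ} {i j : Fin n} (hij : i ≠ j) :
    (∫ x in lqBall q n, x i ^ 4) / (∫ x in lqBall q n, x i ^ 2 * x j ^ 2)
          = momentRatio (recip q) := by
  rw [setIntegral_lqBall_pow_four hq, setIntegral_lqBall_sq_mul_sq hq hij,
    mul_div_mul_left _ _ (vol_lqBall_pos hq n).ne', momentRatio_eq (recip_nonneg q)]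

/-! ### Asymptotics of the second and fourth moments -/

theorem isEquivalent_of_log_sub {u v : ℕ → ℝ} (hu : ∀ᶠ n in atTop, 0 < u n)
    (hv : ∀ᶠ n in atTop, 0 < v n)
    (h : Tendsto (fun n => Real.log (u n) - Real.log (v n)) atTop (nhds 0)) : u ~[atTop] v := by
  rw [isEquivalent_iff_tendsto_one (hv.mono fun n hn => hn.ne')]
  have := (Real.continuous_exp.tendsto 0).comp h
  rw [Real.exp_zero] at this
  refine this.congr' ?_
  filter_upwards [hu, hv] with n h1 h2
  simp only [Function.comp_apply, Pi.div_apply]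
  rw [Real.exp_sub, Real.exp_log h1, Real.exp_log h2]

theorem tendsto_const_div_nat (c : ℝ) : Tendsto (fun n : ℕ => c / (n : ℝ)) atTop (nhds 0) :=
  tendsto_const_div_atTop_nhds_zero_nat c

theorem tendsto_log_add_one_div : Tendsto (fun n : ℕ => Real.log ((n : ℝ) + 1) / n) atTop (nhds 0) := by
  have h1 : Tendsto (fun x : ℝ => Real.log x / x) atTop (nhds 0) := by
    simpa using Real.isLittleO_log_id_atTop.tendsto_div_nhds_zero
  have h2 : Tendsto (fun n : ℕ => (n : ℝ) + 1) atTop atTop :=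
    tendsto_atTop_add_const_right _ _ tendsto_natCast_atTop_atTop
  have h3 : Tendsto (fun n : ℕ => 1 + 1 / (n : ℝ)) atTop (nhds 1) := by
    simpa using (tendsto_const_div_nat 1).const_add 1
  have h4 := (h1.comp h2).mul h3
  rw [zero_mul] at h4
  refine h4.congr' ?_
  filter_upwards [eventually_gt_atTop 0] with n hn
  have : (0 : ℝ) < n := by exact_mod_cast hn
  simp only [Function.comp_apply]
  field_simp

theorem tendsto_log_one_add_mul_div {t : ℝ} (ht : 0 ≤ t) :
    Tendsto (fun n : ℕ => Real.log (1 + n * t) / n) atTop (nhds 0) := by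
  have h := (tendsto_const_div_nat (Real.log (1 + t))).add tendsto_log_add_one_div
  rw [add_zero] at h
  refine squeeze_zero (fun n => ?_) (fun n => ?_) h
  · exact div_nonneg (Real.log_nonneg (by nlinarith [(n.cast_nonneg : (0 : ℝ) ≤ n)])) n.cast_nonneg
  · rw [← add_div, ← Real.log_mul (by positivity) (by positivity)]
    gcongr
    nlinarith [(n.cast_nonneg : (0 : ℝ) ≤ n)]

/-- Stirling to the accuracy that survives an `n`-th root. The convention `log 0 = 0` makes `t = 0`,
that is `q = ∞`, part of the same statement. -/
theorem tendsto_log_Gamma_div {t : ℝ} (ht : 0 ≤ t) :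
    Tendsto (fun n : ℕ => Real.log (Real.Gamma (1 + n * t)) / n - t * Real.log n) atTop
      (nhds (t * Real.log t - t)) := by
  have hup : Tendsto (fun n : ℕ => t * Real.log t - t + (1 / (n : ℝ) + Real.log (1 + n * t) / n))
      atTop (nhds (t * Real.log t - t)) := by
    simpa using ((tendsto_const_div_nat 1).add (tendsto_log_one_add_mul_div ht)).const_add
      (t * Real.log t - t)
  have e : ∀ n : ℕ, 0 < n → (n * t * Real.log (n * t) - n * t) / n =
      t * Real.log n + (t * Real.log t - t) := by
    intro n hn
    have hn' : (n : ℝ) ≠ 0 := by positivity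
    rcases ht.eq_or_lt with rfl | ht
    · simp
    rw [Real.log_mul hn' ht.ne']
    field_simp
    ring
  refine tendsto_of_tendsto_of_tendsto_of_le_of_le' tendsto_const_nhds hup ?_ ?_
  · filter_upwards [eventually_gt_atTop 0] with n hn
    have h1 := mul_log_sub_le_log_Gamma (c := n * t) (by positivity)
    have h2 := div_le_div_of_nonneg_right h1 (n.cast_nonneg : (0 : ℝ) ≤ n)
    rw [e n hn] at h2
    linarith
  · filter_upwards [eventually_gt_atTop 0] with n hn
    have h1 := log_Gamma_le_mul_log_sub (c := n * t) (by positivity)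
    have h2 := div_le_div_of_nonneg_right h1 (n.cast_nonneg : (0 : ℝ) ≤ n)
    rw [add_div, add_div, e n hn] at h2
    linarith

theorem tendsto_log_Gamma_add_sub {t a : ℝ} (ht : 0 ≤ t) (ha : 0 ≤ a) :
    Tendsto (fun n : ℕ => Real.log (Real.Gamma (1 + ((n : ℝ) + a) * t))
      - Real.log (Real.Gamma (1 + n * t)) - a * t * Real.log n) atTop (nhds (a * t * Real.log t)) := by
  rcases ht.eq_or_lt with rfl | ht
  · simp
  have hlog : Tendsto (fun n : ℕ => Real.log (t + (1 + a * t) / n)) atTop (nhds (Real.log t)) := by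
    have : Tendsto (fun n : ℕ => t + (1 + a * t) / (n : ℝ)) atTop (nhds t) := by
      simpa using (tendsto_const_div_nat (1 + a * t)).const_add t
    exact this.log ht.ne'
  refine tendsto_of_tendsto_of_tendsto_of_le_of_le' tendsto_const_nhds (hlog.const_mul (a * t)) ?_ ?_
  · filter_upwards [eventually_gt_atTop 0] with n hn
    have hn' : (0 : ℝ) < n := by exact_mod_cast hn
    have h1 := mul_log_le_log_Gamma_sub (c := n * t) (h := a * t) (by positivity) (by positivity)
    rw [Real.log_mul hn'.ne' ht.ne', show n * t + a * t = ((n : ℝ) + a) * t by ring] at h1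
    linarith
  · filter_upwards [eventually_gt_atTop 0] with n hn
    have hn' : (0 : ℝ) < n := by exact_mod_cast hn
    have h1 := log_Gamma_sub_le_mul_log (c := n * t) (h := a * t) (by positivity) (by positivity)
    rw [show 1 + (n * t + a * t) = n * (t + (1 + a * t) / n) by field_simp; ring,
      Real.log_mul hn'.ne' (by positivity),
      show n * (t + (1 + a * t) / n) = 1 + ((n : ℝ) + a) * t by field_simp; ring] at h1
    linarith

theorem log_factorial_eq (n : ℕ) : Real.log (n ! : ℝ) = Real.log (Real.Gamma (1 + n * 1)) := by
  rw [mul_one, add_comm, Real.Gamma_nat_eq_factorial]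

/-- The rational prefactor tends to `1`, the partial exponential sums tend to `exp s`, and the two
extra terms vanish. Hence `phiFun` is eventually positive and does not influence `n`-th roots. -/
theorem tendsto_phiFun (s : ℝ) : Tendsto (fun n => phiFun s n) atTop (nhds (Real.exp s)) := by
  have hsum : Tendsto (fun n : ℕ => ∑ k ∈ Finset.range (n + 1), s ^ k / (k ! : ℝ)) atTop
      (nhds (Real.exp s)) := by
    have h := NormedSpace.expSeries_div_hasSum_exp (𝔸 := ℝ) s
    rw [← Real.exp_eq_exp_ℝ] at h
    exact (tendsto_add_atTop_iff_nat 1).2 h.tendsto_sum_nat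
  have hp := FloorSemiring.tendsto_pow_div_factorial_atTop s
  have h1 := (tendsto_add_atTop_iff_nat 1).2 hp
  have h2 := (tendsto_add_atTop_iff_nat 2).2 hp
  have h3 : Tendsto (fun n : ℕ => 2 * s / ((n : ℝ) + 2)) atTop (nhds 0) := by
    have := (tendsto_add_atTop_iff_nat 2).2 (tendsto_const_div_nat (2 * s))
    simpa using this
  have h4 : Tendsto (fun n : ℕ => s ^ 2 / (((n : ℝ) + 1) * ((n : ℝ) + 2))) atTop (nhds 0) := by
    have a := (tendsto_add_atTop_iff_nat 2).2 (tendsto_const_div_nat 1)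
    have b := (tendsto_add_atTop_iff_nat 1).2 (tendsto_const_div_nat (s ^ 2))
    have := b.mul a
    rw [zero_mul] at this
    refine this.congr fun n => ?_
    push_cast
    rw [div_mul_div_comm, mul_one]
  have := ((((h3.const_sub 1).add h4).mul hsum).add h1).sub h2
  simpa [phiFun] using this

theorem crosspolytopeMoment_two_pos {q : ℝ≥0∞} (hq : 1 ≤ q) {n : ℕ} (hn : 1 ≤ n) :
    0 < crosspolytopeMoment (lqBall q n) 2 := by
  have ht := recip_nonneg q
  have h1 := Gamma_one_add_pos ht
  have h2 := Gamma_one_add_pos (s := n * recip q) (by positivity)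
  have h3 := Gamma_one_add_pos (s := ((n : ℝ) + 2) * recip q) (by positivity)
  have h4 := Gamma_one_add_pos (s := 3 * recip q) (by positivity)
  rw [crosspolytopeMoment_two hq hn]
  positivity

theorem log_crosspolytopeMoment_two {q : ℝ≥0∞} (hq : 1 ≤ q) {n : ℕ} (hn : 1 ≤ n) :
    Real.log (crosspolytopeMoment (lqBall q n) 2) = -Real.log (n ! : ℝ)
      + n * (Real.log (Real.Gamma (1 + 3 * recip q)) - Real.log 3
        - 3 * Real.log (Real.Gamma (1 + recip q))
        - (Real.log (Real.Gamma (1 + ((n : ℝ) + 2) * recip q))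
          - Real.log (Real.Gamma (1 + n * recip q))))
      + 2 * Real.log (Real.Gamma (1 + n * recip q)) := by
  have ht := recip_nonneg q
  have h1 := Gamma_one_add_pos ht
  have h2 := Gamma_one_add_pos (s := n * recip q) (by positivity)
  have h3 := Gamma_one_add_pos (s := ((n : ℝ) + 2) * recip q) (by positivity)
  have h4 := Gamma_one_add_pos (s := 3 * recip q) (by positivity)
  have hf : (0 : ℝ) < n ! := by positivity
  rw [crosspolytopeMoment_two hq hn, Real.log_mul (by positivity) (by positivity),
    Real.log_mul (by positivity) (by positivity), Real.log_pow, Real.log_pow,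
    Real.log_div (by positivity) (by positivity), Real.log_div (by positivity) (by positivity),
    Real.log_mul (by positivity) (by positivity), Real.log_mul (by positivity) (by positivity),
    Real.log_mul (by positivity) (by positivity), Real.log_pow, Real.log_one]
  push_cast
  ring

theorem log_crosspolytopeMoment_four {q : ℝ≥0∞} (hq : 1 ≤ q) {n : ℕ} (hn : 1 ≤ n)
    (hphi : 0 < phiFun (momentRatio (recip q) - 3) n) :
    Real.log (crosspolytopeMoment (lqBall q n) 4) =
      Real.log (((n : ℝ) + 1) * ((n : ℝ) + 2) / 2 * phiFun (momentRatio (recip q) - 3) n)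
      - 2 * Real.log (n ! : ℝ)
      + n * (2 * Real.log (Real.Gamma (1 + 3 * recip q)) - 2 * Real.log 3
        - 6 * Real.log (Real.Gamma (1 + recip q))
        - (Real.log (Real.Gamma (1 + ((n : ℝ) + 4) * recip q))
          - Real.log (Real.Gamma (1 + n * recip q))))
      + 4 * Real.log (Real.Gamma (1 + n * recip q)) := by
  have ht := recip_nonneg q
  have h1 := Gamma_one_add_pos ht
  have h2 := Gamma_one_add_pos (s := n * recip q) (by positivity)
  have h3 := Gamma_one_add_pos (s := ((n : ℝ) + 4) * recip q) (by positivity)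
  have h4 := Gamma_one_add_pos (s := 3 * recip q) (by positivity)
  have hf : (0 : ℝ) < n ! := by positivity
  have h9 : Real.log 9 = 2 * Real.log 3 := by
    rw [show (9 : ℝ) = 3 ^ 2 by norm_num, Real.log_pow]; norm_num
  rw [crosspolytopeMoment_four hq hn]
  set P := phiFun (momentRatio (recip q) - 3) n
  rw [show ((n : ℝ) + 1) * ((n : ℝ) + 2) / (2 * (n ! : ℝ) ^ 2) *
          (Real.Gamma (1 + 3 * recip q) ^ 2 * Real.Gamma (1 + n * recip q) /
            (9 * Real.Gamma (1 + recip q) ^ 6 *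
              Real.Gamma (1 + ((n : ℝ) + 4) * recip q))) ^ n *
          Real.Gamma (1 + n * recip q) ^ 4 * P =
        (((n : ℝ) + 1) * ((n : ℝ) + 2) / 2 * P) / (n ! : ℝ) ^ 2 *
          (Real.Gamma (1 + 3 * recip q) ^ 2 * Real.Gamma (1 + n * recip q) /
            (9 * Real.Gamma (1 + recip q) ^ 6 *
              Real.Gamma (1 + ((n : ℝ) + 4) * recip q))) ^ n *
          Real.Gamma (1 + n * recip q) ^ 4 by field_simp,
    Real.log_mul (by positivity) (by positivity),
    Real.log_mul (by positivity) (by positivity), Real.log_pow, Real.log_pow,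
    Real.log_div (by positivity) (by positivity), Real.log_div (by positivity) (by positivity),
    Real.log_mul (x := Real.Gamma (1 + 3 * recip q) ^ 2) (by positivity) (by positivity),
    Real.log_mul (x := 9 * Real.Gamma (1 + recip q) ^ 6) (by positivity) (by positivity),
    Real.log_mul (x := 9) (by positivity) (by positivity), Real.log_pow, Real.log_pow, Real.log_pow, h9]
  push_cast
  ring

/-- The terms in `t * log n` and in `t * log t` cancel between `Γ (1 + n * t) ^ 2` and the quotient
of Gamma values raised to the power `n`. The factorial leaves `-log n + 1`. -/
theorem tendsto_log_crosspolytopeMoment_two {q : ℝ≥0∞} (hq : 1 ≤ q) :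
    Tendsto (fun n : ℕ => Real.log (crosspolytopeMoment (lqBall q n) 2) / n + Real.log n) atTop
      (nhds (Real.log (alphaFun (recip q)))) := by
  have ht := recip_nonneg q
  have h1 := tendsto_log_Gamma_div zero_le_one
  have h2 := tendsto_log_Gamma_div ht
  have h3 := tendsto_log_Gamma_add_sub ht zero_le_two
  have h := ((h2.const_mul 2).sub h1).sub h3
  have h' := h.add_const (Real.log (Real.Gamma (1 + 3 * recip q)) - Real.log 3
        - 3 * Real.log (Real.Gamma (1 + recip q)))
  rw [log_alphaFun ht]
  convert h'.congr' ?_ using 2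
  · simp; ring
  · filter_upwards [eventually_ge_atTop 1] with n hn
    have hn' : (n : ℝ) ≠ 0 := by positivity
    rw [log_crosspolytopeMoment_two hq hn, log_factorial_eq]
    field_simp
    ring

theorem eventually_phiFun_pos (s : ℝ) : ∀ᶠ n in atTop, 0 < phiFun s n :=
  (tendsto_phiFun s).eventually (lt_mem_nhds (Real.exp_pos s))

theorem tendsto_log_phiFun_div (s : ℝ) :
    Tendsto (fun n : ℕ => Real.log (((n : ℝ) + 1) * ((n : ℝ) + 2) / 2 * phiFun s n) / n) atTop
      (nhds 0) := by
  have h1 : Tendsto (fun n : ℕ => Real.log (phiFun s n) / n) atTop (nhds 0) := by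
    have := ((tendsto_phiFun s).log (Real.exp_pos s).ne').mul (tendsto_const_div_nat 1)
    simpa [div_eq_mul_inv] using this
  have h2 := tendsto_log_one_add_mul_div (t := 1 / 2) (by norm_num)
  have h := (tendsto_log_add_one_div.add h2).add h1
  simp only [add_zero] at h
  refine h.congr' ?_
  filter_upwards [eventually_phiFun_pos s] with n hn
  rw [← add_div, ← add_div, ← Real.log_mul (by positivity) (by positivity),
    ← Real.log_mul (by positivity) hn.ne']
  congr 3
  ring

theorem eventually_crosspolytopeMoment_four_pos {q : ℝ≥0∞} (hq : 1 ≤ q) :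
    ∀ᶠ n : ℕ in atTop, 0 < crosspolytopeMoment (lqBall q n) 4 := by
  filter_upwards [eventually_ge_atTop 1, eventually_phiFun_pos (momentRatio (recip q) - 3)]
    with n hn hphi
  have ht := recip_nonneg q
  have h1 := Gamma_one_add_pos ht
  have h2 := Gamma_one_add_pos (s := n * recip q) (by positivity)
  have h3 := Gamma_one_add_pos (s := ((n : ℝ) + 4) * recip q) (by positivity)
  have h4 := Gamma_one_add_pos (s := 3 * recip q) (by positivity)
  rw [crosspolytopeMoment_four hq hn]
  positivity

theorem tendsto_log_crosspolytopeMoment_four {q : ℝ≥0∞} (hq : 1 ≤ q) :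
    Tendsto (fun n : ℕ => Real.log (crosspolytopeMoment (lqBall q n) 4) / n + 2 * Real.log n) atTop
      (nhds (2 * Real.log (alphaFun (recip q)))) := by
  have ht := recip_nonneg q
  have h1 := tendsto_log_Gamma_div zero_le_one
  have h2 := tendsto_log_Gamma_div ht
  have h3 := tendsto_log_Gamma_add_sub ht zero_le_four
  have h := (((h2.const_mul 4).sub (h1.const_mul 2)).sub h3).add
    (tendsto_log_phiFun_div (momentRatio (recip q) - 3))
  have h' := h.add_const (2 * Real.log (Real.Gamma (1 + 3 * recip q)) - 2 * Real.log 3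
        - 6 * Real.log (Real.Gamma (1 + recip q)))
  rw [log_alphaFun ht]
  convert h'.congr' ?_ using 2
  · simp; ring
  · filter_upwards [eventually_ge_atTop 1, eventually_phiFun_pos (momentRatio (recip q) - 3)]
      with n hn hphi
    have hn' : (n : ℝ) ≠ 0 := by positivity
    rw [log_crosspolytopeMoment_four hq hn hphi, log_factorial_eq]
    field_simp
    ring

theorem isEquivalent_rpow_inv_of_tendsto {u v : ℕ → ℝ} {l : ℝ} (hu : ∀ᶠ n in atTop, 0 < u n)
    (hv : ∀ᶠ n in atTop, 0 < v n) {k : ℝ}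
    (h : Tendsto (fun n : ℕ => Real.log (u n) / n + k * Real.log n) atTop (nhds l))
    (hlv : ∀ᶠ n : ℕ in atTop, Real.log (v n) = l - k * Real.log n) :
    (fun n : ℕ => u n ^ (1 / (n : ℝ))) ~[atTop] v := by
  refine isEquivalent_of_log_sub (hu.mono fun n hn => Real.rpow_pos_of_pos hn _) hv ?_
  have := h.sub_const l
  rw [sub_self] at this
  refine this.congr' ?_
  filter_upwards [hu, hlv] with n h1 h2
  rw [Real.log_rpow h1, h2]
  ring

theorem isEquivalent_crosspolytopeMoment {q : ℝ≥0∞} (hq : 1 ≤ q) :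
      (fun n : ℕ => crosspolytopeMoment (lqBall q n) 2 ^ (1 / (n : ℝ))) ~[atTop]
        (fun n : ℕ => alphaFun (recip q) * (n : ℝ)⁻¹) ∧
      (fun n : ℕ => crosspolytopeMoment (lqBall q n) 4 ^ (1 / (n : ℝ))) ~[atTop]
        (fun n : ℕ => alphaFun (recip q) ^ 2 * ((n : ℝ) ^ 2)⁻¹) := by
  have ha := alphaFun_pos (recip_nonneg q)
  constructor
  · refine isEquivalent_rpow_inv_of_tendsto (k := 1) (l := Real.log (alphaFun (recip q)))
      ((eventually_ge_atTop 1).mono fun n hn => crosspolytopeMoment_two_pos hq hn) ?_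
      (by simpa using tendsto_log_crosspolytopeMoment_two hq) ?_
    all_goals
      filter_upwards [eventually_gt_atTop 0] with n hn
      have : (0 : ℝ) < n := by exact_mod_cast hn
    · positivity
    · rw [Real.log_mul ha.ne' (by positivity), Real.log_inv]; ring
  · refine isEquivalent_rpow_inv_of_tendsto (k := 2) (l := 2 * Real.log (alphaFun (recip q)))
      (eventually_crosspolytopeMoment_four_pos hq) ?_
      (tendsto_log_crosspolytopeMoment_four hq) ?_
    all_goals
      filter_upwards [eventually_gt_atTop 0] with n hn
      have : (0 : ℝ) < n := by exact_mod_cast hn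
    · positivity
    · rw [Real.log_mul (by positivity) (by positivity), Real.log_inv, Real.log_pow, Real.log_pow]
      push_cast
      ring

/-! ### The p-norms of V and U -/

/-- The bordered determinant whose absolute value is `n!` times the volume of a simplex. -/
noncomputable def simplexDet {n : ℕ} (X : Fin (n + 1) → Fin n → ℝ) : ℝ :=
  Matrix.det (Matrix.of fun i => (Fin.cons 1 (X i) : Fin (n + 1) → ℝ))

theorem continuous_det_of (n : ℕ) :
    Continuous fun X : Fin n → Fin n → ℝ => Matrix.det (Matrix.of X) :=
  Continuous.matrix_det (continuous_id)

theorem continuous_simplexDet (n : ℕ) :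
    Continuous (simplexDet : (Fin (n + 1) → Fin n → ℝ) → ℝ) := by
  have : (simplexDet : (Fin (n + 1) → Fin n → ℝ) → ℝ) = fun X =>
      ∑ i : Fin (n + 1), (-1) ^ (i : ℕ) * Matrix.det (Matrix.of fun j => X (i.succAbove j)) := by
    ext X; exact det_cons_one_eq_sum X
  rw [this]
  refine continuous_finsetSum _ fun i _ => continuous_const.mul ?_
  exact (continuous_det_of n).comp (by fun_prop)

theorem lpNorm_mono_exponent {α : Type*} [MeasurableSpace α] {μ : Measure α} [IsProbabilityMeasure μ]
    {f : α → ℝ} {p r : ℝ≥0∞} (hpr : p ≤ r) (hf : MemLp f r μ) : lpNorm f p μ ≤ lpNorm f r μ := by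
  rw [← toReal_eLpNorm hf.1, ← toReal_eLpNorm hf.1]
  exact ENNReal.toReal_mono hf.2.ne (eLpNorm_le_eLpNorm_of_exponent_le hpr hf.1)

theorem lpNorm_comp_measurePreserving {α β : Type*} [MeasurableSpace α] [MeasurableSpace β]
    {μ : Measure α} {ν : Measure β} {g : β → ℝ} {T : α → β} (p : ℝ≥0∞)
    (hg : AEStronglyMeasurable g ν) (hT : MeasurePreserving T μ ν) :
    lpNorm (fun x => g (T x)) p μ = lpNorm g p ν := by
  change lpNorm (g ∘ T) p μ = _
  rw [← toReal_eLpNorm hg, ← toReal_eLpNorm (hg.comp_measurePreserving hT)]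
  exact congrArg _ (eLpNorm_comp_measurePreserving hg hT)

theorem lpNorm_const_mul_abs {α : Type*} [MeasurableSpace α] {μ : Measure α} {f : α → ℝ}
    (hf : AEStronglyMeasurable f μ) (p : ℝ≥0∞) {c : ℝ} (hc : 0 ≤ c) :
    lpNorm (fun x => c * |f x|) p μ = c * lpNorm f p μ := by
  have := lpNorm_const_smul (p := p) c (fun x => |f x|) μ
  rw [lpNorm_fun_abs hf, coe_nnnorm, Real.norm_of_nonneg hc] at this
  exact this

theorem crosspolytopeNorm_eq {q : ℝ≥0∞} (hq : 1 ≤ q) {n : ℕ} (hn : 1 ≤ n) (p : ℝ≥0∞) :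
    crosspolytopeNorm (lqBall q n) p = 2 ^ n / ((n ! : ℝ) * vol (lqBall q n)) *
      lpNorm (fun X => Matrix.det (Matrix.of X)) p (Measure.pi fun _ : Fin n => lqLaw q n) := by
  have hv := vol_lqBall_pos hq n
  rw [← lpNorm_const_mul_abs (continuous_det_of n).aestronglyMeasurable p (by positivity)]
  simp only [crosspolytopeNorm, uniformPoints_lqBall]
  congr 1
  ext x
  exact crosspolytopeVol_eq hn _ x

theorem simplexNorm_eq {q : ℝ≥0∞} (hq : 1 ≤ q) (n : ℕ) (p : ℝ≥0∞) :
    simplexNorm (lqBall q n) p = 1 / ((n ! : ℝ) * vol (lqBall q n)) *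
      lpNorm simplexDet p (Measure.pi fun _ : Fin (n + 1) => lqLaw q n) := by
  have hv := vol_lqBall_pos hq n
  rw [← lpNorm_const_mul_abs (continuous_simplexDet n).aestronglyMeasurable p (by positivity)]
  simp only [simplexNorm, uniformPoints_lqBall]
  congr 1
  ext x
  rw [simplexVol_eq, det_sub_eq_det_cons_one, simplexDet]

theorem measurePreserving_neg_lqLaw {q : ℝ≥0∞} (n : ℕ) :
    MeasurePreserving (fun x : Fin n → ℝ => -x) (lqLaw q n) (lqLaw q n) := by
  have h := (Measure.measurePreserving_neg (volume : Measure (Fin n → ℝ))).restrict_preimage_emb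
    (MeasurableEquiv.neg (Fin n → ℝ)).measurableEmbedding (lqBall q n)
  have h2 : (Neg.neg : (Fin n → ℝ) → Fin n → ℝ) ⁻¹' lqBall q n = lqBall q n := by
    ext x; unfold lqBall; split_ifs <;> simp
  rw [h2] at h
  exact h.smul_measure _

/-- The determinant is affine in the point `X 0`, so averaging over `± X 0` leaves its value at `X 0
= 0`. -/
theorem simplexDet_add_simplexDet_neg {n : ℕ} (X : Fin (n + 1) → Fin n → ℝ) :
    simplexDet X + simplexDet (fun i => if i = 0 then -X i else X i) =
      2 * Matrix.det (Matrix.of fun i : Fin n => X i.succ) := by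
  simp only [simplexDet]
  rw [Matrix.det_succ_row_zero, Matrix.det_succ_row_zero, Fin.sum_univ_succ, Fin.sum_univ_succ]
  have h : ∀ j : Fin (n + 1), (Matrix.of fun i => (Fin.cons 1 (if i = 0 then -X i else X i) :
      Fin (n + 1) → ℝ)).submatrix Fin.succ j.succAbove =
      (Matrix.of fun i => (Fin.cons 1 (X i) : Fin (n + 1) → ℝ)).submatrix Fin.succ j.succAbove := by
    intro j; ext a b; simp
  have h0 : (Matrix.of fun i => (Fin.cons 1 (X i) : Fin (n + 1) → ℝ)).submatrix Fin.succ
      (Fin.succAbove 0) = Matrix.of fun i : Fin n => X i.succ := by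
    ext a b; simp
  simp only [h, h0, Matrix.of_apply, Fin.cons_zero, Fin.cons_succ, if_true, Fin.val_zero, pow_zero,
    one_mul, Pi.neg_apply, mul_neg, neg_mul, Finset.sum_neg_distrib]
  ring

theorem measurePreserving_succAbove {q : ℝ≥0∞} (hq : 1 ≤ q) {n : ℕ} (N : ℕ) (i : Fin (N + 1)) :
    MeasurePreserving (fun (X : Fin (N + 1) → Fin n → ℝ) j => X (i.succAbove j))
      (Measure.pi fun _ => lqLaw q n) (Measure.pi fun _ => lqLaw q n) := by
  have := isProbabilityMeasure_lqLaw hq n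
  exact measurePreserving_snd.comp
    (measurePreserving_piFinSuccAbove (fun _ : Fin (N + 1) => lqLaw q n) i)

/-- The uniform law is symmetric, so both determinants in `simplexDet_add_simplexDet_neg` have the
same norm; then the triangle inequality applies. -/
theorem lpNorm_det_le_lpNorm_simplexDet {q : ℝ≥0∞} (hq : 1 ≤ q) (n : ℕ) {p : ℝ≥0∞} (hp : 1 ≤ p) :
    lpNorm (fun X => Matrix.det (Matrix.of X)) p (Measure.pi fun _ : Fin n => lqLaw q n) ≤
      lpNorm simplexDet p (Measure.pi fun _ : Fin (n + 1) => lqLaw q n) := by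
  have := isProbabilityMeasure_lqLaw hq n
  have hT : MeasurePreserving (fun (X : Fin (n + 1) → Fin n → ℝ) i => if i = 0 then -X i else X i)
      (Measure.pi fun _ => lqLaw q n) (Measure.pi fun _ => lqLaw q n) := by
    have := measurePreserving_pi (fun _ : Fin (n + 1) => lqLaw q n) (fun _ => lqLaw q n)
      (f := fun i => if i = 0 then fun x => -x else id) (fun i => by
        split_ifs
        · exact measurePreserving_neg_lqLaw n
        · exact MeasurePreserving.id _)
    convert this using 3 with X i
    split_ifs <;> rfl
  have hS := continuous_simplexDet n
  have h1 := lpNorm_comp_measurePreserving p hS.aestronglyMeasurable hT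
  have h2 := lpNorm_comp_measurePreserving p (continuous_det_of n).aestronglyMeasurable
    (measurePreserving_succAbove hq n 0)
  simp only [Fin.succAbove_zero] at h2
  have hc : Continuous fun X : Fin (n + 1) → Fin n → ℝ =>
      simplexDet (fun i => if i = 0 then -X i else X i) := by
    refine hS.comp (continuous_pi fun i => ?_)
    split_ifs <;> fun_prop
  have h3 := lpNorm_add_le (g := fun X : Fin (n + 1) → Fin n → ℝ =>
      simplexDet (fun i => if i = 0 then -X i else X i)) (memLp_pi_lqLaw hq n (n + 1) hS p) hp
  have h4 : (simplexDet + fun X : Fin (n + 1) → Fin n → ℝ =>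
      simplexDet (fun i => if i = 0 then -X i else X i)) =
      fun X => (2 : ℝ) • Matrix.det (Matrix.of fun i : Fin n => X i.succ) := by
    ext X; exact simplexDet_add_simplexDet_neg X
  have h5 := lpNorm_const_smul (p := p) (2 : ℝ)
    (fun X : Fin (n + 1) → Fin n → ℝ => Matrix.det (Matrix.of fun i : Fin n => X i.succ))
    (Measure.pi fun _ => lqLaw q n)
  rw [h4, h1] at h3
  rw [coe_nnnorm, Real.norm_of_nonneg zero_le_two, h2] at h5
  have h6 := h5.symm.trans_le h3
  linarith

theorem lpNorm_simplexDet_le {q : ℝ≥0∞} (hq : 1 ≤ q) (n : ℕ) {p : ℝ≥0∞} (hp : 1 ≤ p) :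
    lpNorm simplexDet p (Measure.pi fun _ : Fin (n + 1) => lqLaw q n) ≤ ((n : ℝ) + 1) *
      lpNorm (fun X => Matrix.det (Matrix.of X)) p (Measure.pi fun _ : Fin n => lqLaw q n) := by
  have e : (simplexDet : (Fin (n + 1) → Fin n → ℝ) → ℝ) = ∑ i : Fin (n + 1),
      ((-1 : ℝ) ^ (i : ℕ)) • fun X : Fin (n + 1) → Fin n → ℝ =>
        Matrix.det (Matrix.of fun j => X (i.succAbove j)) := by
    ext X
    simpa [simplexDet] using det_cons_one_eq_sum X
  rw [e]
  have hc : ∀ i : Fin (n + 1), Continuous fun X : Fin (n + 1) → Fin n → ℝ =>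
        Matrix.det (Matrix.of fun j => X (i.succAbove j)) := fun i =>
    (continuous_det_of n).comp (by fun_prop)
  refine (lpNorm_sum_le (fun i _ => (memLp_pi_lqLaw hq n (n + 1) (hc i) p).const_smul _) hp).trans_eq ?_
  have : ∀ i : Fin (n + 1), lpNorm (((-1 : ℝ) ^ (i : ℕ)) • fun X : Fin (n + 1) → Fin n → ℝ =>
        Matrix.det (Matrix.of fun j => X (i.succAbove j))) p (Measure.pi fun _ => lqLaw q n) =
      lpNorm (fun X => Matrix.det (Matrix.of X)) p (Measure.pi fun _ : Fin n => lqLaw q n) := by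
    intro i
    rw [lpNorm_const_smul, coe_nnnorm, norm_pow, norm_neg, norm_one, one_pow, one_mul]
    exact lpNorm_comp_measurePreserving (g := fun X : Fin n → Fin n → ℝ =>
      Matrix.det (Matrix.of X)) p (continuous_det_of n).aestronglyMeasurable
      (measurePreserving_succAbove hq n i)
  simp [this]

theorem crosspolytopeNorm_le_simplexNorm {q : ℝ≥0∞} (hq : 1 ≤ q) {n : ℕ} (hn : 1 ≤ n) {p : ℝ≥0∞}
    (hp : 1 ≤ p) :
    crosspolytopeNorm (lqBall q n) p ≤ 2 ^ n * simplexNorm (lqBall q n) p := by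
  have hv := vol_lqBall_pos hq n
  rw [crosspolytopeNorm_eq hq hn, simplexNorm_eq hq, ← mul_assoc, mul_one_div]
  exact mul_le_mul_of_nonneg_left (lpNorm_det_le_lpNorm_simplexDet hq n hp) (by positivity)

theorem simplexNorm_le_crosspolytopeNorm {q : ℝ≥0∞} (hq : 1 ≤ q) {n : ℕ} (hn : 1 ≤ n) {p : ℝ≥0∞}
    (hp : 1 ≤ p) :
    2 ^ n * simplexNorm (lqBall q n) p ≤ ((n : ℝ) + 1) * crosspolytopeNorm (lqBall q n) p := by
  have hv := vol_lqBall_pos hq n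
  rw [crosspolytopeNorm_eq hq hn, simplexNorm_eq hq, ← mul_assoc, mul_one_div, mul_left_comm]
  exact mul_le_mul_of_nonneg_left (lpNorm_simplexDet_le hq n hp) (by positivity)

theorem continuous_crosspolytopeVol {n : ℕ} (hn : 1 ≤ n) (K : Set (Fin n → ℝ)) :
    Continuous (crosspolytopeVol K) := by
  have : crosspolytopeVol K = fun x => 2 ^ n / ((n ! : ℝ) * vol K) * |Matrix.det (Matrix.of x)| := by
    ext x; exact crosspolytopeVol_eq hn K x
  rw [this]
  exact continuous_const.mul (continuous_det_of n).abs

theorem crosspolytopeVol_nonneg {n : ℕ} (K : Set (Fin n → ℝ)) (x : Fin n → Fin n → ℝ) :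
    0 ≤ crosspolytopeVol K x :=
  div_nonneg ENNReal.toReal_nonneg ENNReal.toReal_nonneg

theorem crosspolytopeNorm_mono {q : ℝ≥0∞} (hq : 1 ≤ q) {n : ℕ} (hn : 1 ≤ n) {p r : ℝ≥0∞}
    (hpr : p ≤ r) : crosspolytopeNorm (lqBall q n) p ≤ crosspolytopeNorm (lqBall q n) r := by
  have := isProbabilityMeasure_lqLaw hq n
  have : IsProbabilityMeasure (uniformPoints (lqBall q n) n) := by
    rw [uniformPoints_lqBall]; infer_instance
  exact lpNorm_mono_exponent hpr
    (memLp_pi_lqLaw hq n n (continuous_crosspolytopeVol hn (lqBall q n)) r)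

theorem crosspolytopeNorm_one {q : ℝ≥0∞} {n : ℕ} (hn : 1 ≤ n) :
    crosspolytopeNorm (lqBall q n) 1 = crosspolytopeMoment (lqBall q n) 1 := by
  rw [crosspolytopeNorm, lpNorm_one_eq_integral_norm
    (continuous_crosspolytopeVol hn (lqBall q n)).aestronglyMeasurable, crosspolytopeMoment]
  simp only [Real.norm_of_nonneg (crosspolytopeVol_nonneg _ _), pow_one]

theorem crosspolytopeNorm_four {q : ℝ≥0∞} {n : ℕ} (hn : 1 ≤ n) :
    crosspolytopeNorm (lqBall q n) 4 = crosspolytopeMoment (lqBall q n) 4 ^ (1 / 4 : ℝ) := by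
  rw [crosspolytopeNorm, lpNorm_eq_integral_norm_rpow_toReal (by norm_num) (by norm_num)
    (continuous_crosspolytopeVol hn (lqBall q n)).aestronglyMeasurable, crosspolytopeMoment]
  have : (4 : ℝ≥0∞).toReal = ((4 : ℕ) : ℝ) := by norm_num
  simp only [Real.norm_of_nonneg (crosspolytopeVol_nonneg _ _), this, Real.rpow_natCast]
  norm_num

/-- A reverse Hölder bound: the first moment is controlled from below by the second and fourth. -/
theorem crosspolytopeMoment_one_ge {q : ℝ≥0∞} (hq : 1 ≤ q) {n : ℕ} (hn : 1 ≤ n) (r : ℝ) (hr : 0 < r) :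
    r * crosspolytopeMoment (lqBall q n) 2 - r ^ 3 * crosspolytopeMoment (lqBall q n) 4 ≤
      crosspolytopeMoment (lqBall q n) 1 := by
  have hc := continuous_crosspolytopeVol hn (lqBall q n)
  have hi : ∀ m : ℕ, Integrable (fun x => crosspolytopeVol (lqBall q n) x ^ m)
      (uniformPoints (lqBall q n) n) := fun m => integrable_pi_lqLaw hq n n (hc.pow m)
  simp only [crosspolytopeMoment]
  rw [← integral_const_mul, ← integral_const_mul, ← integral_sub ((hi 2).const_mul _)
    ((hi 4).const_mul _)]
  refine integral_mono (((hi 2).const_mul _).sub ((hi 4).const_mul _)) (hi 1) fun x => ?_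
  have hx := crosspolytopeVol_nonneg (lqBall q n) x
  set y := crosspolytopeVol (lqBall q n) x
  -- The pointwise inequality is `1 - z + z ^ 3 ≥ 0` for `z = r * y ≥ 0`, multiplied by `y`.
  have h : 0 ≤ 1 - r * y + (r * y) ^ 3 := by
    have : 0 ≤ r * y := by positivity
    nlinarith [sq_nonneg (r * y - 1 / 2), mul_nonneg this (sq_nonneg (r * y - 1 / 2))]
  show r * y ^ 2 - r ^ 3 * y ^ 4 ≤ y ^ 1
  nlinarith [mul_nonneg hx h]

/-- Since norms increase with `p`, the first moment suffices: up to a constant it is at least `(E V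
^ 2) ^ (3 / 2) * (E V ^ 4) ^ (-1 / 2)`. -/
theorem log_crosspolytopeNorm_ge {q : ℝ≥0∞} (hq : 1 ≤ q) {n : ℕ} (hn : 1 ≤ n) {p : ℝ≥0∞} (hp : 1 ≤ p)
    (h4 : 0 < crosspolytopeMoment (lqBall q n) 4) :
    0 < crosspolytopeNorm (lqBall q n) p ∧
    3 / 2 * Real.log (crosspolytopeMoment (lqBall q n) 2)
      - 1 / 2 * Real.log (crosspolytopeMoment (lqBall q n) 4) - 3 / 2 * Real.log 2 ≤
      Real.log (crosspolytopeNorm (lqBall q n) p) := by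
  have h2 := crosspolytopeMoment_two_pos hq hn
  set a := crosspolytopeMoment (lqBall q n) 2
  set b := crosspolytopeMoment (lqBall q n) 4
  -- This `r` makes the subtracted term `r ^ 3 * b` exactly half of `r * a`.
  set r := Real.sqrt (a / (2 * b)) with hr
  have hr0 : 0 < r := Real.sqrt_pos.2 (by positivity)
  have hr2 : r ^ 2 = a / (2 * b) := Real.sq_sqrt (by positivity)
  have h1 := crosspolytopeMoment_one_ge hq hn r hr0
  have h3 : r * a / 2 ≤ crosspolytopeNorm (lqBall q n) p := by
    refine le_trans ?_ (crosspolytopeNorm_mono hq hn hp)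
    rw [crosspolytopeNorm_one hn]
    refine le_trans (le_of_eq ?_) h1
    have : r ^ 3 * b = r * (r ^ 2 * b) := by ring
    rw [this, hr2]
    field_simp
    ring
  have hpos : 0 < r * a / 2 := by positivity
  refine ⟨hpos.trans_le h3, le_trans (le_of_eq ?_) (Real.log_le_log hpos h3)⟩
  rw [Real.log_div (by positivity) (by positivity), Real.log_mul hr0.ne' h2.ne', hr,
    Real.log_sqrt (by positivity), Real.log_div h2.ne' (by positivity),
    Real.log_mul (by positivity) h4.ne']
  ring

theorem crosspolytopeNorm_le_four {q : ℝ≥0∞} (hq : 1 ≤ q) {n : ℕ} (hn : 1 ≤ n) {p : ℝ≥0∞} (hp : p ≤ 4) :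
    crosspolytopeNorm (lqBall q n) p ≤ crosspolytopeMoment (lqBall q n) 4 ^ (1 / 4 : ℝ) :=
  (crosspolytopeNorm_mono hq hn hp).trans_eq (crosspolytopeNorm_four hn)

/-- The lower bound from moments two and four and the upper bound from moment four have the same
limit, since `3 / 2 - 1 / 2 * 2 = 1 / 4 * 2`. -/
theorem tendsto_log_crosspolytopeNorm {p q : ℝ≥0∞} (hp : 1 ≤ p) (hp4 : p ≤ 4) (hq : 1 ≤ q) :
    Tendsto (fun n : ℕ => Real.log (crosspolytopeNorm (lqBall q n) p) / n + 1 / 2 * Real.log n) atTop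
      (nhds (1 / 2 * Real.log (alphaFun (recip q)))) := by
  have h2 := tendsto_log_crosspolytopeMoment_two hq
  have h4 := tendsto_log_crosspolytopeMoment_four hq
  have hlow := ((h2.const_mul (3 / 2)).sub (h4.const_mul (1 / 2))).sub
    (tendsto_const_div_nat (3 / 2 * Real.log 2))
  have hup := h4.const_mul (1 / 4)
  have e1 : 3 / 2 * Real.log (alphaFun (recip q)) - 1 / 2 * (2 * Real.log (alphaFun (recip q))) - 0 =
    1 / 2 * Real.log (alphaFun (recip q)) := by ring
  have e2 : 1 / 4 * (2 * Real.log (alphaFun (recip q))) = 1 / 2 * Real.log (alphaFun (recip q)) := by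
    ring
  rw [e1] at hlow
  rw [e2] at hup
  refine tendsto_of_tendsto_of_tendsto_of_le_of_le' hlow hup ?_ ?_
  · filter_upwards [eventually_ge_atTop 1, eventually_crosspolytopeMoment_four_pos hq] with n hn hb
    have := div_le_div_of_nonneg_right (log_crosspolytopeNorm_ge hq hn hp hb).2
      (n.cast_nonneg : (0 : ℝ) ≤ n)
    refine le_trans (le_of_eq ?_) (add_le_add_left this _)
    ring
  · filter_upwards [eventually_ge_atTop 1, eventually_crosspolytopeMoment_four_pos hq] with n hn hb
    have h := Real.log_le_log (log_crosspolytopeNorm_ge hq hn hp hb).1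
      (crosspolytopeNorm_le_four hq hn hp4)
    rw [Real.log_rpow hb] at h
    have := div_le_div_of_nonneg_right h (n.cast_nonneg : (0 : ℝ) ≤ n)
    refine (add_le_add_left this _).trans_eq ?_
    ring

theorem eventually_crosspolytopeNorm_pos {p q : ℝ≥0∞} (hp : 1 ≤ p) (hq : 1 ≤ q) :
    ∀ᶠ n : ℕ in atTop, 0 < crosspolytopeNorm (lqBall q n) p := by
  filter_upwards [eventually_ge_atTop 1, eventually_crosspolytopeMoment_four_pos hq] with n hn hb
  exact (log_crosspolytopeNorm_ge hq hn hp hb).1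

theorem eventually_simplexNorm_pos {p q : ℝ≥0∞} (hp : 1 ≤ p) (hq : 1 ≤ q) :
    ∀ᶠ n : ℕ in atTop, 0 < simplexNorm (lqBall q n) p := by
  filter_upwards [eventually_ge_atTop 1, eventually_crosspolytopeNorm_pos hp hq] with n hn hb
  exact pos_of_mul_pos_right (hb.trans_le (crosspolytopeNorm_le_simplexNorm hq hn hp)) (by positivity)

theorem tendsto_log_simplexNorm {p q : ℝ≥0∞} (hp : 1 ≤ p) (hp4 : p ≤ 4) (hq : 1 ≤ q) :
    Tendsto (fun n : ℕ => Real.log (simplexNorm (lqBall q n) p) / n + 1 / 2 * Real.log n) atTop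
      (nhds (1 / 2 * Real.log (alphaFun (recip q)) - Real.log 2)) := by
  have h := tendsto_log_crosspolytopeNorm hp hp4 hq
  have hlow := h.sub_const (Real.log 2)
  have hup := hlow.add tendsto_log_add_one_div
  rw [add_zero] at hup
  refine tendsto_of_tendsto_of_tendsto_of_le_of_le' hlow hup ?_ ?_
  · filter_upwards [eventually_ge_atTop 1, eventually_crosspolytopeNorm_pos hp hq,
      eventually_simplexNorm_pos hp hq] with n hn hV hU
    have h := Real.log_le_log hV (crosspolytopeNorm_le_simplexNorm hq hn hp)
    rw [Real.log_mul (by positivity) hU.ne', Real.log_pow] at h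
    have h' := div_le_div_of_nonneg_right h (n.cast_nonneg : (0 : ℝ) ≤ n)
    have hn' : (n : ℝ) ≠ 0 := by positivity
    rw [add_div, mul_div_cancel_left₀ _ hn'] at h'
    linarith
  · filter_upwards [eventually_ge_atTop 1, eventually_crosspolytopeNorm_pos hp hq,
      eventually_simplexNorm_pos hp hq] with n hn hV hU
    have h := Real.log_le_log (by positivity) (simplexNorm_le_crosspolytopeNorm hq hn hp)
    rw [Real.log_mul (by positivity) hU.ne', Real.log_pow, Real.log_mul (by positivity) hV.ne'] at h
    have h' := div_le_div_of_nonneg_right h (n.cast_nonneg : (0 : ℝ) ≤ n)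
    have hn' : (n : ℝ) ≠ 0 := by positivity
    rw [add_div, mul_div_cancel_left₀ _ hn', add_div] at h'
    linarith

theorem isEquivalent_norms {p q : ℝ≥0∞} (hp : 1 ≤ p) (hp4 : p ≤ 4) (hq : 1 ≤ q) :
      (fun n : ℕ => crosspolytopeNorm (lqBall q n) p ^ (1 / (n : ℝ))) ~[atTop]
        (fun n : ℕ => Real.sqrt (alphaFun (recip q)) * (n : ℝ) ^ (-(1 / 2) : ℝ)) ∧
      (fun n : ℕ => simplexNorm (lqBall q n) p ^ (1 / (n : ℝ))) ~[atTop]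
        (fun n : ℕ => 1 / 2 * Real.sqrt (alphaFun (recip q)) * (n : ℝ) ^ (-(1 / 2) : ℝ)) := by
  have ha := alphaFun_pos (recip_nonneg q)
  have hs := Real.sqrt_pos.2 ha
  constructor
  · refine isEquivalent_rpow_inv_of_tendsto (eventually_crosspolytopeNorm_pos hp hq) ?_
      (tendsto_log_crosspolytopeNorm hp hp4 hq) ?_
    all_goals
      filter_upwards [eventually_gt_atTop 0] with n hn
      have : (0 : ℝ) < n := by exact_mod_cast hn
    · positivity
    · rw [Real.log_mul (by positivity) (by positivity), Real.log_rpow this, Real.log_sqrt ha.le]; ring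
  · refine isEquivalent_rpow_inv_of_tendsto (eventually_simplexNorm_pos hp hq) ?_
      (tendsto_log_simplexNorm hp hp4 hq) ?_
    all_goals
      filter_upwards [eventually_gt_atTop 0] with n hn
      have : (0 : ℝ) < n := by exact_mod_cast hn
    · positivity
    · rw [Real.log_mul (by positivity) (by positivity), Real.log_rpow this,
        Real.log_mul (by positivity) (by positivity), Real.log_sqrt ha.le, one_div, Real.log_inv]
      ring

/-! ### One-dimensional comparison of `exp (-|y| ^ r)` with a uniform density -/

open Real.BohrMollerup in
-- The difference vanishes to first order at `t = 0`. In the product approximations each factor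
-- contributes at most `(k * t) ^ 2 / 2` times `1 / (m + 1) ^ 2`, and these weights sum to at most
-- `2`.
theorem log_Gamma_mul_sub_le {k t : ℝ} (hk : 1 ≤ k) (ht : 0 ≤ t) :
    Real.log (Real.Gamma (1 + k * t)) - k * Real.log (Real.Gamma (1 + t)) ≤ k ^ 2 * t ^ 2 := by
  have h1 := tendsto_log_gamma (x := 1 + k * t) (by positivity)
  have h2 := tendsto_log_gamma (x := 1 + t) (by positivity)
  have h3 := tendsto_log_gamma (x := 1) one_pos
  rw [Real.Gamma_one, Real.log_one] at h3
  -- Adding `(k - 1) * log Γ 1 = 0` cancels the `log n` and `log n!` terms of the approximations,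
  -- leaving only the sum over factors.
  have h := ((h1.sub (h2.const_mul k)).add (h3.const_mul (k - 1)))
  rw [mul_zero, add_zero] at h
  refine le_of_tendsto h (Eventually.of_forall fun n => ?_)
  have hsum : ∀ n : ℕ, ∑ m ∈ Finset.range (n + 1), ((m : ℝ) + 1)⁻¹ ^ 2 ≤ 2 - ((n : ℝ) + 1)⁻¹ := by
    intro n
    induction n with
    | zero => norm_num
    | succ n ih =>
      rw [Finset.sum_range_succ]
      push_cast
      have : ((n : ℝ) + 1 + 1)⁻¹ ^ 2 ≤ ((n : ℝ) + 1)⁻¹ - ((n : ℝ) + 1 + 1)⁻¹ := by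
        have hn : (0 : ℝ) < n + 1 := by positivity
        rw [inv_sub_inv (by positivity) (by positivity), inv_pow, ← one_div,
          div_le_div_iff₀ (by positivity) (by positivity)]
        nlinarith
      linarith
  have hterm : ∀ m ∈ Finset.range (n + 1), k * Real.log (1 + t + m) - Real.log (1 + k * t + m)
      - (k - 1) * Real.log (1 + m) ≤ k ^ 2 * t ^ 2 / 2 * ((m : ℝ) + 1)⁻¹ ^ 2 := by
    intro m _
    have hm : (0 : ℝ) < 1 + m := by positivity
    have e1 : 1 + t + m = (1 + m) * (1 + t / (1 + m)) := by field_simp; ring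
    have e2 : 1 + k * t + m = (1 + m) * (1 + k * (t / (1 + m))) := by field_simp; ring
    set y := t / (1 + m) with hy
    have hy0 : 0 ≤ y := by positivity
    have hx0 : 0 ≤ k * y := by positivity
    have e3 : k ^ 2 * t ^ 2 / 2 * ((m : ℝ) + 1)⁻¹ ^ 2 = (k * y) ^ 2 / 2 := by
      rw [hy]; field_simp; ring
    have l1 := Real.log_le_sub_one_of_pos (x := 1 + y) (by positivity)
    have l2 := Real.le_log_one_add_of_nonneg hx0
    have l3 : k * y - (k * y) ^ 2 / 2 ≤ 2 * (k * y) / (k * y + 2) := by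
      rw [le_div_iff₀ (by positivity)]
      nlinarith [pow_nonneg hx0 3]
    rw [e1, e2, e3, Real.log_mul (by positivity) (by positivity),
      Real.log_mul (by positivity) (by positivity)]
    nlinarith
  have hs := Finset.sum_le_sum hterm
  rw [← Finset.mul_sum] at hs
  simp only [Finset.sum_sub_distrib, ← Finset.mul_sum] at hs
  have h5 := mul_le_mul_of_nonneg_left (hsum n) (show 0 ≤ k ^ 2 * t ^ 2 / 2 by positivity)
  have h6 : 0 ≤ k ^ 2 * t ^ 2 / 2 * ((n : ℝ) + 1)⁻¹ := by positivity
  simp only [logGammaSeq]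
  linarith

theorem Gamma_one_add_le_one {t : ℝ} (ht : 0 ≤ t) (ht1 : t ≤ 1) : Real.Gamma (1 + t) ≤ 1 := by
  have h := Real.convexOn_Gamma.2 (show (1 : ℝ) ∈ Set.Ioi 0 from Set.mem_Ioi.2 one_pos)
    (show (2 : ℝ) ∈ Set.Ioi 0 from Set.mem_Ioi.2 two_pos) (sub_nonneg.2 ht1) ht (by ring)
  simp only [smul_eq_mul, Real.Gamma_one, Real.Gamma_two] at h
  rw [show (1 - t) * 1 + t * 2 = 1 + t by ring] at h
  linarith

theorem Gamma_pow_le_Gamma_mul {t : ℝ} (ht : 0 ≤ t) {k : ℕ} (hk : 1 ≤ k) :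
    Real.Gamma (1 + t) ^ k ≤ Real.Gamma (1 + k * t) := by
  have hk' : (1 : ℝ) ≤ k := by exact_mod_cast hk
  rw [← Real.log_le_log_iff (pow_pos (Gamma_one_add_pos ht) _) (Gamma_one_add_pos (by positivity)),
    Real.log_pow]
  have := mul_log_Gamma_le ht hk'
  have h2 : 0 ≤ ((k : ℝ) - 1) * (t ^ 2 / (4 * (1 + t))) :=
    mul_nonneg (by linarith) (by positivity)
  linarith

/-- Up to a factor `2 / k`, the two terms are the absolute moments of order `k - 1` of the weight
`exp (-|y| ^ r)`, `r = 1 / t`, and of the indicator of `[-l, l]`, `l = Γ (1 + t)`. The moments thus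
agree up to `O(t ^ 2)`. -/
theorem Gamma_mul_sub_Gamma_pow_le {t : ℝ} (ht : 0 ≤ t) (ht1 : t ≤ 1) {k : ℕ} (hk : 1 ≤ k) :
    Real.Gamma (1 + k * t) - Real.Gamma (1 + t) ^ k ≤ k ^ 2 * Real.exp (k ^ 2) * t ^ 2 := by
  have hk' : (1 : ℝ) ≤ k := by exact_mod_cast hk
  have hp := Gamma_one_add_pos ht
  have hp2 : 0 < Real.Gamma (1 + k * t) := Gamma_one_add_pos (by positivity)
  have h := log_Gamma_mul_sub_le hk' ht
  set D := Real.log (Real.Gamma (1 + k * t)) - k * Real.log (Real.Gamma (1 + t)) with hD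
  have e : Real.Gamma (1 + k * t) = Real.Gamma (1 + t) ^ k * Real.exp D := by
    rw [hD, Real.exp_sub, Real.exp_log hp2, ← Real.log_pow, Real.exp_log (pow_pos hp _)]
    field_simp
  have hpk : Real.Gamma (1 + t) ^ k ≤ 1 := pow_le_one₀ hp.le (Gamma_one_add_le_one ht ht1)
  have hpk0 : 0 < Real.Gamma (1 + t) ^ k := pow_pos hp _
  have hD0 : 0 ≤ D := by
    have := Gamma_pow_le_Gamma_mul ht hk
    rw [hD, ← Real.log_pow, sub_nonneg]
    exact Real.log_le_log hpk0 this
  have h1 : Real.exp D - 1 ≤ D * Real.exp D := by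
    have := Real.add_one_le_exp (-D)
    have h2 : Real.exp D * Real.exp (-D) = 1 := by rw [← Real.exp_add]; simp
    nlinarith [Real.exp_pos D]
  have h2 : Real.exp D ≤ Real.exp ((k : ℝ) ^ 2) :=
    Real.exp_le_exp.2 (h.trans (by nlinarith [sq_nonneg (k : ℝ), pow_le_one₀ ht ht1 (n := 2)]))
  have h3 : D * Real.exp D ≤ k ^ 2 * t ^ 2 * Real.exp ((k : ℝ) ^ 2) :=
    mul_le_mul h h2 (Real.exp_pos _).le (by positivity)
  have h4 : 0 ≤ Real.exp D - 1 := by linarith [Real.one_le_exp hD0]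
  rw [e]
  nlinarith

theorem abs_rpow_sub_rpow_le {p A B m : ℝ} (hp : 1 ≤ p) (hA : 0 ≤ A) (hB : 0 ≤ B) (hAm : A ≤ m)
    (hBm : B ≤ m) : |A ^ p - B ^ p| ≤ p * m ^ (p - 1) * |A - B| := by
  have := Convex.norm_image_sub_le_of_norm_hasDerivWithin_le (f := fun x : ℝ => x ^ p)
    (f' := fun x => p * x ^ (p - 1)) (s := Set.Icc 0 m) (C := p * m ^ (p - 1)) (x := B) (y := A)
    (fun x _ => (Real.hasDerivAt_rpow_const (Or.inr hp)).hasDerivWithinAt) (fun x hx => by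
      rw [Real.norm_of_nonneg (mul_nonneg (by linarith) (Real.rpow_nonneg hx.1 _))]
      exact mul_le_mul_of_nonneg_left (Real.rpow_le_rpow hx.1 hx.2 (by linarith)) (by linarith))
    (convex_Icc _ _) ⟨hB, hBm⟩ ⟨hA, hAm⟩
  simpa [Real.norm_eq_abs] using this

theorem max_one_rpow_le {p y : ℝ} (hp : p ≤ 4) (hy : 0 ≤ y) : max 1 y ^ (p - 1) ≤ 1 + y ^ 3 := by
  have h1 : (1 : ℝ) ≤ max 1 y := le_max_left _ _
  calc max 1 y ^ (p - 1) ≤ max 1 y ^ ((3 : ℕ) : ℝ) :=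
        Real.rpow_le_rpow_of_exponent_le h1 (by push_cast; linarith)
    _ = max 1 y ^ 3 := Real.rpow_natCast _ _
    _ ≤ 1 + y ^ 3 := by
      rcases max_cases 1 y with h | h <;> rw [h.1]
      · have := pow_nonneg hy 3; linarith
      · linarith

/-- The even part of `y ↦ |s + a y| ^ p` is Lipschitz with polynomially growing constant. -/
theorem abs_even_part_rpow_sub_le {p s a l : ℝ} (hp : 1 ≤ p) (hp4 : p ≤ 4) (hl : 0 ≤ l) (hl1 : l ≤ 1)
    (y : ℝ) :
    |(|s + a * y| ^ p + |s - a * y| ^ p) / 2 - (|s + a * l| ^ p + |s - a * l| ^ p) / 2| ≤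
      p * |a| * (|s| + |a|) ^ (p - 1) * (|(|y| - l)| * (1 + |y| ^ 3)) := by
  have hev : (|s + a * y| ^ p + |s - a * y| ^ p) / 2 =
      (|s + a * (|y|)| ^ p + |s - a * (|y|)| ^ p) / 2 := by
    rcases abs_cases y with h | h <;> rw [h.1]
    rw [mul_neg, sub_neg_eq_add, ← sub_eq_add_neg, add_comm]
  rw [hev]
  have hy := abs_nonneg y
  generalize |y| = y at hy
  -- Taking `b = a` and `b = -a` treats both summands of the even part.
  have key : ∀ b : ℝ, |b| = |a| → |(|s + b * y| ^ p - |s + b * l| ^ p)| ≤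
      p * |a| * (|s| + |a|) ^ (p - 1) * (|y - l| * (1 + y ^ 3)) := by
    intro b hb
    set m := (|s| + |a|) * max 1 y with hm
    have hsa : 0 ≤ |s| + |a| := by positivity
    have hM : ∀ z : ℝ, 0 ≤ z → z ≤ max 1 y → |s + b * z| ≤ m := by
      intro z hz hzm
      refine (abs_add_le _ _).trans ?_
      rw [abs_mul, hb, abs_of_nonneg hz, hm, add_mul]
      have h1 : (1 : ℝ) ≤ max 1 y := le_max_left _ _
      exact add_le_add (le_mul_of_one_le_right (abs_nonneg _) h1)
        (mul_le_mul_of_nonneg_left hzm (abs_nonneg _))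
    have h := abs_rpow_sub_rpow_le hp (abs_nonneg _) (abs_nonneg _) (hM y hy (le_max_right _ _))
      (hM l hl (hl1.trans (le_max_left _ _)))
    refine h.trans ?_
    have h2 : |(|s + b * y| - |s + b * l|)| ≤ |a| * |y - l| := by
      refine (abs_abs_sub_abs_le_abs_sub _ _).trans_eq ?_
      rw [show s + b * y - (s + b * l) = b * (y - l) by ring, abs_mul, hb]
    have h3 : m ^ (p - 1) ≤ (|s| + |a|) ^ (p - 1) * (1 + y ^ 3) := by
      rw [hm, Real.mul_rpow hsa (by positivity)]
      exact mul_le_mul_of_nonneg_left (max_one_rpow_le hp4 hy) (by positivity)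
    calc p * m ^ (p - 1) * |(|s + b * y| - |s + b * l|)|
        ≤ p * ((|s| + |a|) ^ (p - 1) * (1 + y ^ 3)) * (|a| * |y - l|) := by
          have : 0 ≤ m ^ (p - 1) := by positivity
          gcongr
      _ = _ := by ring
  have k1 := key a rfl
  have k2 := key (-a) (abs_neg a)
  simp only [neg_mul, ← sub_eq_add_neg] at k2
  have : (|s + a * y| ^ p + |s - a * y| ^ p) / 2 - (|s + a * l| ^ p + |s - a * l| ^ p) / 2 =
      ((|s + a * y| ^ p - |s + a * l| ^ p) + (|s - a * y| ^ p - |s - a * l| ^ p)) / 2 := by ring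
  rw [this, abs_div, abs_two, div_le_iff₀ two_pos]
  refine (abs_add_le _ _).trans ?_
  linarith

theorem half_le_Gamma_one_add {t : ℝ} (ht : 0 ≤ t) (ht1 : t ≤ 1) : 1 / 2 ≤ Real.Gamma (1 + t) := by
  have h := log_Gamma_sub_le_mul_log ht (sub_nonneg.2 ht1)
  rw [show 1 + (t + (1 - t)) = (2 : ℝ) by ring, Real.Gamma_two, Real.log_one] at h
  have h2 := Real.log_pos one_lt_two
  have h3 : -Real.log 2 ≤ Real.log (Real.Gamma (1 + t)) := by nlinarith
  have h4 := Real.exp_le_exp.2 h3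
  rwa [Real.exp_log (Gamma_one_add_pos ht), Real.exp_neg, Real.exp_log two_pos, ← one_div] at h4

theorem integral_abs_pow_neg_self {l : ℝ} (hl : 0 ≤ l) (a : ℕ) :
    ∫ y in (-l)..l, |y| ^ a = 2 / ((a : ℝ) + 1) * l ^ (a + 1) := by
  have hi : ∀ x y : ℝ, IntervalIntegrable (fun y : ℝ => |y| ^ a) volume x y := fun x y =>
    Continuous.intervalIntegrable (by fun_prop) _ _
  rw [← intervalIntegral.integral_add_adjacent_intervals (hi (-l) 0) (hi 0 l)]
  have h1 : ∫ y in (-l)..0, |y| ^ a = ∫ y in 0..l, |y| ^ a := by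
    have := intervalIntegral.integral_comp_neg (a := -l) (b := 0) (fun y : ℝ => |y| ^ a)
    simpa using this
  have h2 : ∫ y in 0..l, |y| ^ a = l ^ (a + 1) / ((a : ℝ) + 1) := by
    have : Set.EqOn (fun y : ℝ => |y| ^ a) (fun y => y ^ a) (Set.uIcc 0 l) := by
      intro y hy
      rw [Set.uIcc_of_le hl] at hy
      simp only [abs_of_nonneg hy.1]
    rw [intervalIntegral.integral_congr this, integral_pow]
    simp
  rw [h1, h2]
  ring

theorem integrable_mul_exp_neg_abs_rpow {r : ℝ} (hr : 0 < r) {f : ℝ → ℝ} (hf : Continuous f) {C : ℝ}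
    (hC : ∀ y, |f y| ≤ C * (1 + |y| ^ 4)) : Integrable fun y => f y * Real.exp (-|y| ^ r) := by
  have h0 := (integral_abs_pow_mul_exp_neg hr 0).1
  have h4 := (integral_abs_pow_mul_exp_neg hr 4).1
  refine Integrable.mono' ((h0.add h4).const_mul C) ?_ (ae_of_all _ fun y => ?_)
  · have : Measurable fun y : ℝ => Real.exp (-|y| ^ r) := by fun_prop
    exact (hf.measurable.mul this).aestronglyMeasurable
  · rw [norm_mul, Real.norm_eq_abs, Real.norm_of_nonneg (Real.exp_pos _).le]
    refine (mul_le_mul_of_nonneg_right (hC y) (Real.exp_pos _).le).trans_eq ?_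
    simp only [Pi.add_apply]
    ring

theorem integral_weight_sub {r : ℝ} (hr : 1 ≤ r) {f : ℝ → ℝ} (hf : Continuous f) {C : ℝ}
    (hC : ∀ y, |f y| ≤ C * (1 + |y| ^ 4)) {l : ℝ} (hl : 0 ≤ l) :
    Integrable (fun y => f y * (Real.exp (-|y| ^ r) - (Set.Ioc (-l) l).indicator 1 y)) ∧
    ∫ y, f y * (Real.exp (-|y| ^ r) - (Set.Ioc (-l) l).indicator 1 y) =
      (∫ y, f y * Real.exp (-|y| ^ r)) - ∫ y in (-l)..l, f y := by
  have h1 := integrable_mul_exp_neg_abs_rpow (by linarith : 0 < r) hf hC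
  have h2 : Integrable (fun y => (Set.Ioc (-l) l).indicator f y) :=
    IntegrableOn.integrable_indicator (hf.integrableOn_Ioc) measurableSet_Ioc
  have e : (fun y => f y * (Real.exp (-|y| ^ r) - (Set.Ioc (-l) l).indicator 1 y)) =
      fun y => f y * Real.exp (-|y| ^ r) - (Set.Ioc (-l) l).indicator f y := by
    ext y; by_cases h : y ∈ Set.Ioc (-l) l
    · simp [h]; ring
    · simp [h]
  rw [e]
  refine ⟨h1.sub h2, ?_⟩
  rw [integral_sub h1 h2, integral_indicator measurableSet_Ioc,
    intervalIntegral.integral_of_le (by linarith)]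

theorem abs_add_mul_rpow_le {p : ℝ} (hp : 1 ≤ p) (hp4 : p ≤ 4) (s a y : ℝ) :
    |s + a * y| ^ p ≤ (|s| + |a|) ^ p * (1 + |y| ^ 4) := by
  have hm : (1 : ℝ) ≤ max 1 |y| := le_max_left _ _
  have h1 : |s + a * y| ≤ (|s| + |a|) * max 1 |y| := by
    refine (abs_add_le _ _).trans ?_
    rw [abs_mul, add_mul]
    exact add_le_add (le_mul_of_one_le_right (abs_nonneg _) hm)
      (mul_le_mul_of_nonneg_left (le_max_right _ _) (abs_nonneg _))
  refine (Real.rpow_le_rpow (abs_nonneg _) h1 (by linarith)).trans ?_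
  rw [Real.mul_rpow (by positivity) (by positivity)]
  refine mul_le_mul_of_nonneg_left ?_ (by positivity)
  calc max 1 |y| ^ p ≤ max 1 |y| ^ ((4 : ℕ) : ℝ) :=
        Real.rpow_le_rpow_of_exponent_le hm (by push_cast; linarith)
    _ = max 1 |y| ^ 4 := Real.rpow_natCast _ _
    _ ≤ 1 + |y| ^ 4 := by
      rcases max_cases 1 |y| with h | h <;> rw [h.1]
      · have := pow_nonneg (abs_nonneg y) 4; linarith
      · linarith

/-- Replacing the density `exp (-|y| ^ r)` by the indicator of the interval of the same mass
decreases the `p`-th moment of an affine function by at most `O(r⁻²)`. -/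
theorem integral_abs_rpow_mul_exp_le {p r s a : ℝ} (hp : 1 ≤ p) (hp4 : p ≤ 4) (hr : 1 ≤ r) :
    ∫ y, |s + a * y| ^ p * Real.exp (-|y| ^ r) ≤
      (∫ y in (-Real.Gamma (1 + r⁻¹))..Real.Gamma (1 + r⁻¹), |s + a * y| ^ p) +
        4 * |a| * (|s| + |a|) ^ (p - 1) * (50 * Real.exp 25 * r⁻¹ ^ 2) := by
  have hr0 : 0 < r := by linarith
  have ht : 0 ≤ r⁻¹ := by positivity
  have ht1 : r⁻¹ ≤ 1 := inv_le_one_of_one_le₀ hr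
  set l := Real.Gamma (1 + r⁻¹) with hl
  have hl0 : 0 < l := Gamma_one_add_pos ht
  have hl1 : l ≤ 1 := Gamma_one_add_le_one ht ht1
  have hm := fun a => (integral_abs_pow_mul_exp_neg hr0 a).2
  have hcf : ∀ b : ℝ, Continuous fun y : ℝ => |s + b * y| ^ p := fun b =>
    Continuous.rpow_const (by fun_prop) fun _ => Or.inr (by linarith)
  have hbf : ∀ b y : ℝ, |(|s + b * y| ^ p)| ≤ (|s| + |b|) ^ p * (1 + |y| ^ 4) := fun b y => by
    rw [abs_of_nonneg (by positivity)]; exact abs_add_mul_rpow_le hp hp4 s b y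
  have hneg1 : ∫ y, |s - a * y| ^ p * Real.exp (-|y| ^ r) =
      ∫ y, |s + a * y| ^ p * Real.exp (-|y| ^ r) := by
    rw [← integral_neg_eq_self]; simp
  have hneg2 : ∫ y in (-l)..l, |s - a * y| ^ p = ∫ y in (-l)..l, |s + a * y| ^ p := by
    have := intervalIntegral.integral_comp_neg (a := -l) (b := l) (fun y : ℝ => |s + a * y| ^ p)
    simpa [sub_eq_add_neg] using this
  -- The difference of the two weights has total mass zero, so the value at `y = l` of the even part
  -- may be subtracted for free.
  set kl := (|s + a * l| ^ p + |s - a * l| ^ p) / 2 with hkl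
  set g : ℝ → ℝ := fun y => (|s + a * y| ^ p + |s - a * y| ^ p) / 2 - kl with hg
  have hcs : Continuous fun y : ℝ => |s - a * y| ^ p := by simpa [sub_eq_add_neg] using hcf (-a)
  have hbs : ∀ y, |(|s - a * y| ^ p)| ≤ (|s| + |a|) ^ p * (1 + |y| ^ 4) := fun y => by
    simpa [sub_eq_add_neg] using hbf (-a) y
  have hcg : Continuous g := ((hcf a).add hcs).div_const 2 |>.sub continuous_const
  have hbg : ∀ y, |g y| ≤ ((|s| + |a|) ^ p + |kl|) * (1 + |y| ^ 4) := by
    intro y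
    have h1 := abs_le.1 (hbf a y)
    have h2 := abs_le.1 (hbs y)
    have h3 : |kl| ≤ |kl| * (1 + |y| ^ 4) := le_mul_of_one_le_right (abs_nonneg _) (by
      have := pow_nonneg (abs_nonneg y) 4; linarith)
    have h4 := abs_le.1 h3
    rw [add_mul, abs_le]
    constructor <;> simp only [hg] <;> linarith [h1.1, h1.2, h2.1, h2.2, neg_abs_le kl, le_abs_self kl]
  obtain ⟨gi, ge⟩ := integral_weight_sub hr hcg hbg hl0.le
  set P : ℝ → ℝ := fun y => (|y| - l) * (1 + |y| ^ 3) with hP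
  have hcP : Continuous P := by fun_prop
  have hbP : ∀ y, |P y| ≤ 4 * (1 + |y| ^ 4) := by
    intro y
    have hy := abs_nonneg y
    simp only [hP, abs_mul]
    generalize |y| = y at hy
    rw [abs_of_nonneg (by positivity : 0 ≤ 1 + y ^ 3)]
    have : |y - l| ≤ y + 1 := by rw [abs_le]; constructor <;> linarith
    refine (mul_le_mul_of_nonneg_right this (by positivity)).trans ?_
    nlinarith [sq_nonneg (y - 1), sq_nonneg (y ^ 2 - 1), sq_nonneg (y ^ 2 - y)]
  obtain ⟨hPi, Pe⟩ := integral_weight_sub hr hcP hbP hl0.le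
  set M := p * |a| * (|s| + |a|) ^ (p - 1) with hM
  have hM0 : 0 ≤ M := by positivity
  -- The weight difference is nonpositive for `|y| ≤ l` and nonnegative beyond, exactly like `|y| -
  -- l`. The Lipschitz bound on `g` therefore turns into a one-sided bound by `M * P`, with no
  -- absolute values on the weight.
  have hmain : ∫ y, g y * (Real.exp (-|y| ^ r) - (Set.Ioc (-l) l).indicator 1 y) ≤
      M * ∫ y, P y * (Real.exp (-|y| ^ r) - (Set.Ioc (-l) l).indicator 1 y) := by
    rw [← integral_const_mul]
    refine integral_mono_ae gi (hPi.const_mul M) ?_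
    have hne : ∀ᵐ y : ℝ, y ≠ -l := by simp [ae_iff]
    filter_upwards [hne] with y hy
    have hk := abs_even_part_rpow_sub_le (s := s) (a := a) hp hp4 hl0.le hl1 y
    rw [← hkl] at hk
    have hk' := abs_le.1 hk
    by_cases h : y ∈ Set.Ioc (-l) l
    · have hyl : |y| ≤ l := abs_le.2 ⟨h.1.le, h.2⟩
      have hw : Real.exp (-|y| ^ r) ≤ 1 := Real.exp_le_one_iff.2 (by simp; positivity)
      simp only [Set.indicator_of_mem h, Pi.one_apply]
      rw [abs_of_nonpos (by linarith : |y| - l ≤ 0)] at hk'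
      have := mul_le_mul_of_nonneg_right hk'.1 (sub_nonneg.2 hw)
      simp only [hg, hP, hM]
      linarith
    · have hyl : l ≤ |y| := by
        by_contra hc
        have := abs_lt.1 (not_le.1 hc)
        exact h ⟨this.1, this.2.le⟩
      simp only [Set.indicator_of_notMem h, sub_zero]
      rw [abs_of_nonneg (by linarith : 0 ≤ |y| - l)] at hk'
      have := mul_le_mul_of_nonneg_right hk'.2 (Real.exp_pos (-|y| ^ r)).le
      simp only [hg, hP, hM]
      linarith
  have hw0 : ∫ y : ℝ, Real.exp (-|y| ^ r) = 2 * l := by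
    have := hm 0; simp only [pow_zero, one_mul] at this; rw [this, hl]; norm_num
  have hi := fun a => (integral_abs_pow_mul_exp_neg hr0 a).1
  have ge1 : ∫ y, g y * Real.exp (-|y| ^ r) =
      (∫ y, |s + a * y| ^ p * Real.exp (-|y| ^ r)) - kl * (2 * l) := by
    have i1 := integrable_mul_exp_neg_abs_rpow hr0 (hcf a) (hbf a)
    have i2 := integrable_mul_exp_neg_abs_rpow hr0 hcs hbs
    have i0 : Integrable fun y : ℝ => Real.exp (-|y| ^ r) := by simpa using hi 0
    have e : ∀ y, g y * Real.exp (-|y| ^ r) = 1 / 2 * (|s + a * y| ^ p * Real.exp (-|y| ^ r)) +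
        1 / 2 * (|s - a * y| ^ p * Real.exp (-|y| ^ r)) - kl * Real.exp (-|y| ^ r) := by
      intro y; simp only [hg]; ring
    simp only [e]
    rw [integral_sub ((i1.const_mul _).fun_add (i2.const_mul _)) (i0.const_mul _),
      integral_add (i1.const_mul _) (i2.const_mul _), integral_const_mul, integral_const_mul,
      integral_const_mul, hneg1, hw0]
    ring
  have ge2 : ∫ y in (-l)..l, g y = (∫ y in (-l)..l, |s + a * y| ^ p) - kl * (2 * l) := by
    have i1 := (hcf a).intervalIntegrable (μ := volume) (-l) l
    have i2 := hcs.intervalIntegrable (μ := volume) (-l) l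
    have e : ∀ y, g y = 1 / 2 * |s + a * y| ^ p + 1 / 2 * |s - a * y| ^ p - kl := by
      intro y; simp only [hg]; ring
    simp only [e]
    rw [intervalIntegral.integral_sub ((i1.const_mul _).add (i2.const_mul _)) (by simp),
      intervalIntegral.integral_add (i1.const_mul _) (i2.const_mul _),
      intervalIntegral.integral_const_mul, intervalIntegral.integral_const_mul, hneg2,
      intervalIntegral.integral_const]
    simp only [smul_eq_mul]
    ring
  have Pe1 : ∫ y, P y * Real.exp (-|y| ^ r) = Real.Gamma (1 + (2 : ℕ) * r⁻¹) +
      2 / 5 * Real.Gamma (1 + (5 : ℕ) * r⁻¹) - 2 * l ^ 2 - l / 2 * Real.Gamma (1 + (4 : ℕ) * r⁻¹) := by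
    have e : ∀ y : ℝ, P y * Real.exp (-|y| ^ r) = |y| ^ 1 * Real.exp (-|y| ^ r) +
        |y| ^ 4 * Real.exp (-|y| ^ r) - (l * (|y| ^ 0 * Real.exp (-|y| ^ r)) +
        l * (|y| ^ 3 * Real.exp (-|y| ^ r))) := by
      intro y; simp only [hP]; ring
    simp only [e]
    rw [integral_sub ((hi 1).fun_add (hi 4)) (((hi 0).const_mul _).fun_add ((hi 3).const_mul _)),
      integral_add (hi 1) (hi 4), integral_add ((hi 0).const_mul _) ((hi 3).const_mul _),
      integral_const_mul, integral_const_mul, hm, hm, hm, hm]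
    norm_num
    rw [← hl]
    ring
  have Pe2 : ∫ y in (-l)..l, P y = l ^ 2 + 2 / 5 * l ^ 5 - 2 * l ^ 2 - l / 2 * l ^ 4 := by
    have i : ∀ a : ℕ, IntervalIntegrable (fun y : ℝ => |y| ^ a) volume (-l) l := fun a =>
      Continuous.intervalIntegrable (by fun_prop) _ _
    have e : ∀ y : ℝ, P y = |y| ^ 1 + |y| ^ 4 - (l * |y| ^ 0 + l * |y| ^ 3) := by
      intro y; simp only [hP]; ring
    simp only [e]
    rw [intervalIntegral.integral_sub ((i 1).add (i 4)) (((i 0).const_mul _).add ((i 3).const_mul _)),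
      intervalIntegral.integral_add (i 1) (i 4),
      intervalIntegral.integral_add ((i 0).const_mul _) ((i 3).const_mul _),
      intervalIntegral.integral_const_mul, intervalIntegral.integral_const_mul,
      integral_abs_pow_neg_self hl0.le, integral_abs_pow_neg_self hl0.le,
      integral_abs_pow_neg_self hl0.le, integral_abs_pow_neg_self hl0.le]
    norm_num
    ring
  have g2 := Gamma_mul_sub_Gamma_pow_le ht ht1 (k := 2) (by norm_num)
  have g5 := Gamma_mul_sub_Gamma_pow_le ht ht1 (k := 5) (by norm_num)
  have g4 := Gamma_pow_le_Gamma_mul ht (k := 4) (by norm_num)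
  -- In this integral the `|y| ^ 0` terms cancel, the `|y| ^ 3` term is favourable, and the `|y|`
  -- and `|y| ^ 4` terms are `O(r⁻¹ ^ 2)`, giving `4 * exp 4` and `10 * exp 25`.
  have hPle : ∫ y, P y * (Real.exp (-|y| ^ r) - (Set.Ioc (-l) l).indicator 1 y) ≤
      50 * Real.exp 25 * r⁻¹ ^ 2 := by
    rw [Pe, Pe1, Pe2]
    rw [← hl] at g2 g5 g4
    have h1 : l / 2 * l ^ 4 ≤ l / 2 * Real.Gamma (1 + (4 : ℕ) * r⁻¹) :=
      mul_le_mul_of_nonneg_left g4 (by positivity)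
    have h2 : Real.exp 4 * r⁻¹ ^ 2 ≤ Real.exp 25 * r⁻¹ ^ 2 :=
      mul_le_mul_of_nonneg_right (Real.exp_le_exp.2 (by norm_num)) (by positivity)
    norm_num at g2 g5 h1 h2 ⊢
    have h3 : 0 ≤ Real.exp 25 * (r ^ 2)⁻¹ := by positivity
    linarith
  rw [ge, ge1, ge2] at hmain
  have hM4 : M ≤ 4 * |a| * (|s| + |a|) ^ (p - 1) := by rw [hM]; gcongr
  have hfin : M * ∫ y, P y * (Real.exp (-|y| ^ r) - (Set.Ioc (-l) l).indicator 1 y) ≤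
      4 * |a| * (|s| + |a|) ^ (p - 1) * (50 * Real.exp 25 * r⁻¹ ^ 2) :=
    (mul_le_mul_of_nonneg_left hPle hM0).trans (mul_le_mul_of_nonneg_right hM4 (by positivity))
  linarith

/-! ### Affine forms in independent coordinates -/

theorem lintegral_pi_succ {α : Type*} [MeasurableSpace α] (μ : Measure α) [SigmaFinite μ] (N : ℕ)
    {f : (Fin (N + 1) → α) → ℝ≥0∞} (hf : Measurable f) :
    ∫⁻ X, f X ∂(Measure.pi fun _ => μ) =
      ∫⁻ x, ∫⁻ R, f (Fin.cons x R) ∂(Measure.pi fun _ : Fin N => μ) ∂μ := by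
  have h := (measurePreserving_piFinSuccAbove (fun _ : Fin (N + 1) => μ) 0).symm
  rw [← h.map_eq, lintegral_map hf (MeasurableEquiv.measurable _)]
  have hm : Measurable fun z => f ((MeasurableEquiv.piFinSuccAbove (fun _ : Fin (N + 1) => α) 0).symm z) :=
    hf.comp (MeasurableEquiv.measurable _)
  rw [lintegral_prod _ hm.aemeasurable]
  simp [MeasurableEquiv.piFinSuccAbove, Fin.insertNthEquiv, Fin.insertNth_zero']

theorem lintegral_pi_succ' {α : Type*} [MeasurableSpace α] (μ : Measure α) [SigmaFinite μ] (N : ℕ)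
    {f : (Fin (N + 1) → α) → ℝ≥0∞} (hf : Measurable f) :
    ∫⁻ X, f X ∂(Measure.pi fun _ => μ) =
      ∫⁻ R, ∫⁻ x, f (Fin.cons x R) ∂μ ∂(Measure.pi fun _ : Fin N => μ) := by
  have h := (measurePreserving_piFinSuccAbove (fun _ : Fin (N + 1) => μ) 0).symm
  rw [← h.map_eq, lintegral_map hf (MeasurableEquiv.measurable _)]
  have hm : Measurable fun z => f ((MeasurableEquiv.piFinSuccAbove (fun _ : Fin (N + 1) => α) 0).symm z) :=
    hf.comp (MeasurableEquiv.measurable _)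
  rw [lintegral_prod_symm _ hm.aemeasurable]
  simp [MeasurableEquiv.piFinSuccAbove, Fin.insertNthEquiv, Fin.insertNth_zero']

theorem affine_cons {n : ℕ} (c : ℝ) (u : Fin (n + 1) → ℝ) (y : ℝ) (x : Fin n → ℝ) :
    c + ∑ i, u i * (Fin.cons y x : Fin (n + 1) → ℝ) i =
      (c + u 0 * y) + ∑ i : Fin n, u i.succ * x i := by
  rw [Fin.sum_univ_succ]; simp [add_assoc]

/-- `U` accumulates the squares of the coefficients already integrated out, so a one-coordinate
inequality iterates. It is applied with `G c U = (c ^ 2 + 12 * U) ^ 2` to bound fourth moments; the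
reversed version below takes `c ^ 2 + U / 12` for second moments. -/
theorem lintegral_pi_affine_le {ν : Measure ℝ} [SigmaFinite ν] {G : ℝ → ℝ → ℝ≥0∞}
    (hG : ∀ U, Measurable fun c => G c U)
    (h : ∀ c a U, 0 ≤ U → ∫⁻ y, G (c + a * y) U ∂ν ≤ G c (U + a ^ 2)) (n : ℕ) :
    ∀ (u : Fin n → ℝ) (c U : ℝ), 0 ≤ U →
      ∫⁻ x, G (c + ∑ i, u i * x i) U ∂(Measure.pi fun _ => ν) ≤ G c (U + ∑ i, u i ^ 2) := by
  induction n with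
  | zero => intro u c U _; simp [lintegral_const]
  | succ n ih =>
    intro u c U hU
    have hm : Measurable fun x : Fin (n + 1) → ℝ => G (c + ∑ i, u i * x i) U :=
      (hG U).comp (by fun_prop)
    rw [lintegral_pi_succ' ν n hm]
    calc _ ≤ ∫⁻ R : Fin n → ℝ, G (c + ∑ i : Fin n, u i.succ * R i) (U + u 0 ^ 2)
            ∂(Measure.pi fun _ => ν) := by
          refine lintegral_mono fun R => ?_
          refine le_trans (le_of_eq (lintegral_congr fun y => ?_)) (h _ (u 0) U hU)
          rw [affine_cons]; ring_nf
      _ ≤ _ := (ih (fun i => u i.succ) c (U + u 0 ^ 2) (by positivity)).trans_eq (by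
          rw [Fin.sum_univ_succ, add_assoc])

theorem le_lintegral_pi_affine {ν : Measure ℝ} [SigmaFinite ν] {G : ℝ → ℝ → ℝ≥0∞}
    (hG : ∀ U, Measurable fun c => G c U)
    (h : ∀ c a U, 0 ≤ U → G c (U + a ^ 2) ≤ ∫⁻ y, G (c + a * y) U ∂ν) (n : ℕ) :
    ∀ (u : Fin n → ℝ) (c U : ℝ), 0 ≤ U →
      G c (U + ∑ i, u i ^ 2) ≤ ∫⁻ x, G (c + ∑ i, u i * x i) U ∂(Measure.pi fun _ => ν) := by
  induction n with
  | zero => intro u c U _; simp [lintegral_const]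
  | succ n ih =>
    intro u c U hU
    have hm : Measurable fun x : Fin (n + 1) → ℝ => G (c + ∑ i, u i * x i) U :=
      (hG U).comp (by fun_prop)
    rw [lintegral_pi_succ' ν n hm]
    calc _ ≤ ∫⁻ R : Fin n → ℝ, G (c + ∑ i : Fin n, u i.succ * R i) (U + u 0 ^ 2)
            ∂(Measure.pi fun _ => ν) :=
          le_trans (le_of_eq (by rw [Fin.sum_univ_succ, add_assoc]))
            (ih (fun i => u i.succ) c (U + u 0 ^ 2) (by positivity))
      _ ≤ _ := by
          refine lintegral_mono fun R => ?_
          refine le_trans (h _ (u 0) U hU) (le_of_eq (lintegral_congr fun y => ?_))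
          rw [affine_cons]; ring_nf

theorem enorm_rpow_eq_ofReal {p : ℝ} (hp : 0 ≤ p) (x : ℝ) : ‖x‖ₑ ^ p = ENNReal.ofReal (|x| ^ p) := by
  rw [Real.enorm_eq_ofReal_abs, ENNReal.ofReal_rpow_of_nonneg (abs_nonneg _) hp]

/-- A Paley–Zygmund type bound: a lower bound for the `p`-th moment in terms of the second and
fourth. -/
theorem le_lintegral_enorm_rpow {α : Type*} [MeasurableSpace α] {μ : Measure α}
    [IsProbabilityMeasure μ] {X : α → ℝ} (hX : Measurable X) {p k R : ℝ} (hp : 1 ≤ p) (hp4 : p ≤ 4)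
    (hk : 0 ≤ k) (hR : 0 < R) (h2 : ENNReal.ofReal (k * R ^ 2) ≤ ∫⁻ x, ENNReal.ofReal (X x ^ 2) ∂μ)
    (h4 : ∫⁻ x, ENNReal.ofReal (X x ^ 4) ∂μ ≤ ENNReal.ofReal (R ^ 4)) :
    ENNReal.ofReal (k ^ 2 / 5 * R ^ p) ≤ ∫⁻ x, ‖X x‖ₑ ^ p ∂μ := by
  -- This value maximizes `a * k - 5 / 4 * a ^ 2`, with maximum `k ^ 2 / 5`.
  set a := 2 * k / 5 with ha
  have ha0 : 0 ≤ a := by positivity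
  have hRp : 0 < R ^ p := by positivity
  -- For `y ≤ 1` use `y ^ p ≥ y ^ 4`, for `y ≥ 1` use `y ^ p ≥ 1`; each case is then the inequality
  -- between arithmetic and geometric means.
  have key : ∀ y : ℝ, 0 ≤ y → a * y ^ 2 ≤ y ^ p + a ^ 2 * y ^ 4 + a ^ 2 / 4 := by
    intro y hy
    rcases le_total y 1 with h | h
    · have h1 : y ^ (4 : ℝ) ≤ y ^ p := by
        rcases hy.eq_or_lt with rfl | hy
        · rw [Real.zero_rpow (by norm_num), Real.zero_rpow (by linarith)]
        · exact Real.rpow_le_rpow_of_exponent_ge hy h hp4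
      rw [show (4 : ℝ) = ((4 : ℕ) : ℝ) by norm_num, Real.rpow_natCast] at h1
      nlinarith [sq_nonneg (y ^ 2 - a / 2), mul_nonneg (sq_nonneg a) (pow_nonneg hy 4)]
    · have h1 := Real.one_le_rpow h (by linarith : 0 ≤ p)
      nlinarith [sq_nonneg (a * y ^ 2 - 1 / 2), sq_nonneg a]
  have hpt : ∀ x, ENNReal.ofReal (a * R ^ p / R ^ 2) * ENNReal.ofReal (X x ^ 2) ≤
      ‖X x‖ₑ ^ p + ENNReal.ofReal (a ^ 2 * R ^ p / R ^ 4) * ENNReal.ofReal (X x ^ 4) +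
        ENNReal.ofReal (a ^ 2 / 4 * R ^ p) := by
    intro x
    rw [enorm_rpow_eq_ofReal (by linarith), ← ENNReal.ofReal_mul (by positivity),
      ← ENNReal.ofReal_mul (by positivity), ← ENNReal.ofReal_add (by positivity) (by positivity),
      ← ENNReal.ofReal_add (by positivity) (by positivity)]
    refine ENNReal.ofReal_le_ofReal ?_
    have h := mul_le_mul_of_nonneg_left (key (|X x| / R) (by positivity)) hRp.le
    have e2 : (|X x| / R) ^ 2 = X x ^ 2 / R ^ 2 := by rw [div_pow, sq_abs]
    have e4 : (|X x| / R) ^ 4 = X x ^ 4 / R ^ 4 := by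
      rw [div_pow, Even.pow_abs (by decide : Even 4)]
    rw [Real.div_rpow (abs_nonneg _) hR.le, e2, e4] at h
    refine le_trans (le_of_eq ?_) (h.trans (le_of_eq ?_))
    · ring
    · field_simp
  have hint := lintegral_mono (μ := μ) hpt
  have hm : Measurable fun x => ‖X x‖ₑ ^ p := by fun_prop
  rw [lintegral_const_mul _ (by fun_prop), lintegral_add_right _ measurable_const,
    lintegral_add_left hm, lintegral_const_mul _ (by fun_prop), lintegral_const, measure_univ,
    mul_one] at hint
  have hup : ENNReal.ofReal (a * k * R ^ p) ≤ ∫⁻ x, ‖X x‖ₑ ^ p ∂μ +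
      ENNReal.ofReal (5 / 4 * a ^ 2 * R ^ p) := by
    calc ENNReal.ofReal (a * k * R ^ p) = ENNReal.ofReal (a * R ^ p / R ^ 2) *
          ENNReal.ofReal (k * R ^ 2) := by
          rw [← ENNReal.ofReal_mul (by positivity)]; congr 1; field_simp
      _ ≤ _ := mul_le_mul_right h2 _
      _ ≤ _ := hint
      _ ≤ ∫⁻ x, ‖X x‖ₑ ^ p ∂μ + ENNReal.ofReal (a ^ 2 * R ^ p / R ^ 4) * ENNReal.ofReal (R ^ 4) +
            ENNReal.ofReal (a ^ 2 / 4 * R ^ p) := by gcongr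
      _ = _ := by
          rw [add_assoc, ← ENNReal.ofReal_mul (by positivity),
            ← ENNReal.ofReal_add (by positivity) (by positivity)]
          congr 2; field_simp; ring
  have e : k ^ 2 / 5 * R ^ p = a * k * R ^ p - 5 / 4 * a ^ 2 * R ^ p := by rw [ha]; ring
  rw [e, ENNReal.ofReal_sub _ (by positivity)]
  exact tsub_le_iff_right.2 hup

theorem rpow_sub_one_le_of_pos {p w R : ℝ} (hp : 1 ≤ p) (hp4 : p ≤ 4) (hw : 0 ≤ w) (hR : 0 < R) :
    w ^ (p - 1) ≤ R ^ (p - 1) * (1 + w ^ 4 / R ^ 4) := by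
  have h : (w / R) ^ (p - 1) ≤ 1 + (w / R) ^ 4 := by
    have h0 : 0 ≤ w / R := by positivity
    rcases le_total (w / R) 1 with h | h
    · have := Real.rpow_le_one h0 h (by linarith : 0 ≤ p - 1)
      have := pow_nonneg h0 4
      linarith
    · have h1 := Real.rpow_le_rpow_of_exponent_le h (by linarith : p - 1 ≤ 4)
      rw [show (4 : ℝ) = ((4 : ℕ) : ℝ) by norm_num, Real.rpow_natCast] at h1
      linarith
  rw [Real.div_rpow hw hR.le, div_le_iff₀ (by positivity), div_pow] at h
  linarith

/-- Coordinatewise replacement of `ν` by `μ` in the `p`-th moment of an affine form. -/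
theorem lintegral_pi_affine_le_add {ν μ : Measure ℝ} [IsProbabilityMeasure ν] [IsProbabilityMeasure μ]
    {p ε R : ℝ} (hp : 1 ≤ p) (hp4 : p ≤ 4) (hε : 0 ≤ ε) (hR : 0 < R)
    (h1 : ∀ s a : ℝ, ∫⁻ y, ‖s + a * y‖ₑ ^ p ∂ν ≤
      ∫⁻ y, ‖s + a * y‖ₑ ^ p ∂μ + ENNReal.ofReal (ε * |a| * (|s| + |a|) ^ (p - 1)))
    (hν : ∀ c a U : ℝ, 0 ≤ U → ∫⁻ y, ENNReal.ofReal (((c + a * y) ^ 2 + 12 * U) ^ 2) ∂ν ≤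
      ENNReal.ofReal ((c ^ 2 + 12 * (U + a ^ 2)) ^ 2))
    (hμ : ∀ c a U : ℝ, 0 ≤ U → ∫⁻ y, ENNReal.ofReal (((c + a * y) ^ 2 + 12 * U) ^ 2) ∂μ ≤
      ENNReal.ofReal ((c ^ 2 + 12 * (U + a ^ 2)) ^ 2)) (n : ℕ) :
    ∀ (u : Fin n → ℝ) (c : ℝ),
      ∫⁻ x, ‖c + ∑ i, u i * x i‖ₑ ^ p ∂(Measure.pi fun _ => ν) ≤
        ∫⁻ x, ‖c + ∑ i, u i * x i‖ₑ ^ p ∂(Measure.pi fun _ => μ) +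
          ENNReal.ofReal (ε * R ^ (p - 1) * ∑ i, |u i|) * (1 + ENNReal.ofReal (4 / R ^ 4) *
            ENNReal.ofReal ((c ^ 2 + 12 * ∑ i, u i ^ 2) ^ 2)) := by
  induction n with
  | zero => intro u c; simp
  | succ n ih =>
    intro u c
    rw [lintegral_pi_succ' ν n (by fun_prop), lintegral_pi_succ μ n (by fun_prop)]
    simp only [affine_cons]
    set K := ENNReal.ofReal (4 / R ^ 4)
    set S := ENNReal.ofReal ((c ^ 2 + 12 * ∑ i, u i ^ 2) ^ 2) with hS
    set v : Fin n → ℝ := fun i => u i.succ with hv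
    have hsum : ∑ i, u i ^ 2 = ∑ i, v i ^ 2 + u 0 ^ 2 := by rw [Fin.sum_univ_succ, add_comm]
    have hsum1 : ∑ i, |u i| = |u 0| + ∑ i, |v i| := by rw [Fin.sum_univ_succ]
    -- Coordinate `0` is replaced while the others still follow `ν`. The growth factor `(|s| + |a|)
    -- ^ (p - 1)` is absorbed by the fourth moment of the affine form, measured at scale `R`.
    have hfirst : ∫⁻ x : Fin n → ℝ, ∫⁻ y, ‖c + u 0 * y + ∑ i, v i * x i‖ₑ ^ p ∂ν
          ∂(Measure.pi fun _ => ν) ≤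
        ∫⁻ x : Fin n → ℝ, ∫⁻ y, ‖c + u 0 * y + ∑ i, v i * x i‖ₑ ^ p ∂μ ∂(Measure.pi fun _ => ν) +
        ENNReal.ofReal (ε * R ^ (p - 1) * |u 0|) * (1 + K * S) := by
      have hpt : ∀ x : Fin n → ℝ, ∫⁻ y, ‖c + u 0 * y + ∑ i, v i * x i‖ₑ ^ p ∂ν ≤
          ∫⁻ y, ‖c + u 0 * y + ∑ i, v i * x i‖ₑ ^ p ∂μ +
          ENNReal.ofReal (ε * R ^ (p - 1) * |u 0|) * (1 + K *
            ENNReal.ofReal (((c + ∑ i, v i * x i) ^ 2 + 12 * u 0 ^ 2) ^ 2)) := by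
        intro x
        have e : ∀ y, c + u 0 * y + ∑ i, v i * x i = (c + ∑ i, v i * x i) + u 0 * y := fun y => by ring
        simp only [e]
        refine (h1 _ _).trans (add_le_add_right ?_ _)
        generalize c + ∑ i, v i * x i = s
        generalize u 0 = a
        rw [← ENNReal.ofReal_mul (by positivity), ← ENNReal.ofReal_one,
          ← ENNReal.ofReal_add zero_le_one (by positivity), ← ENNReal.ofReal_mul (by positivity)]
        refine ENNReal.ofReal_le_ofReal ?_
        have hw := rpow_sub_one_le_of_pos hp hp4 (by positivity : 0 ≤ |s| + |a|) hR
        have h4 : (|s| + |a|) ^ 4 ≤ 4 * (s ^ 2 + 12 * a ^ 2) ^ 2 := by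
          have h2 : (|s| + |a|) ^ 2 ≤ 2 * (s ^ 2 + 12 * a ^ 2) := by
            nlinarith [sq_nonneg (|s| - |a|), sq_abs s, sq_abs a, sq_nonneg a]
          calc (|s| + |a|) ^ 4 = ((|s| + |a|) ^ 2) ^ 2 := by ring
            _ ≤ (2 * (s ^ 2 + 12 * a ^ 2)) ^ 2 := pow_le_pow_left₀ (by positivity) h2 2
            _ = _ := by ring
        calc ε * |a| * (|s| + |a|) ^ (p - 1) ≤ ε * |a| * (R ^ (p - 1) * (1 +
              4 * (s ^ 2 + 12 * a ^ 2) ^ 2 / R ^ 4)) := by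
              refine mul_le_mul_of_nonneg_left (hw.trans ?_) (by positivity)
              gcongr
          _ = _ := by ring
      refine (lintegral_mono hpt).trans ?_
      rw [lintegral_add_right _ (by fun_prop), lintegral_const_mul _ (by fun_prop),
        lintegral_add_left measurable_const, lintegral_const_mul _ (by fun_prop), lintegral_const,
        measure_univ, mul_one]
      have := lintegral_pi_affine_le (G := fun c U => ENNReal.ofReal ((c ^ 2 + 12 * U) ^ 2))
        (fun U => by fun_prop) hν n v c (u 0 ^ 2) (by positivity)
      rw [add_comm (u 0 ^ 2), ← hsum] at this
      gcongr
    -- With coordinate `0` now following `μ` and held fixed, the induction hypothesis replaces the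
    -- others.
    have hsecond : ∫⁻ x : Fin n → ℝ, ∫⁻ y, ‖c + u 0 * y + ∑ i, v i * x i‖ₑ ^ p ∂μ
          ∂(Measure.pi fun _ => ν) ≤
        ∫⁻ y, ∫⁻ x : Fin n → ℝ, ‖c + u 0 * y + ∑ i, v i * x i‖ₑ ^ p ∂(Measure.pi fun _ => μ) ∂μ +
        ENNReal.ofReal (ε * R ^ (p - 1) * ∑ i, |v i|) * (1 + K * S) := by
      rw [lintegral_lintegral_swap (by fun_prop)]
      refine (lintegral_mono fun y => ih v (c + u 0 * y)).trans ?_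
      rw [lintegral_add_right _ (by fun_prop), lintegral_const_mul _ (by fun_prop),
        lintegral_add_left measurable_const, lintegral_const_mul _ (by fun_prop), lintegral_const,
        measure_univ, mul_one]
      have := hμ c (u 0) (∑ i, v i ^ 2) (by positivity)
      rw [← hsum] at this
      gcongr
    refine hfirst.trans ((add_le_add_left hsecond _).trans_eq ?_)
    rw [hsum1, mul_add (ε * R ^ (p - 1)), ENNReal.ofReal_add (by positivity) (by positivity), add_mul,
      add_assoc, add_comm (_ * (1 + K * S))]

/-- At the natural scale `R ^ 2 = c ^ 2 + 12 * ∑ u i ^ 2`, Cauchy–Schwarz bounds the additive error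
by `5 * ε * √n * R ^ p`. The Paley–Zygmund bound with `k = 1 / 144` bounds the `p`-th moment below
by `R ^ p / 103680`, hence the factor `518400 = 5 * 103680`. -/
theorem lintegral_pi_affine_le_mul {ν μ : Measure ℝ} [IsProbabilityMeasure ν] [IsProbabilityMeasure μ]
    {p ε : ℝ} (hp : 1 ≤ p) (hp4 : p ≤ 4) (hε : 0 ≤ ε)
    (h1 : ∀ s a : ℝ, ∫⁻ y, ‖s + a * y‖ₑ ^ p ∂ν ≤
      ∫⁻ y, ‖s + a * y‖ₑ ^ p ∂μ + ENNReal.ofReal (ε * |a| * (|s| + |a|) ^ (p - 1)))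
    (hν : ∀ c a U : ℝ, 0 ≤ U → ∫⁻ y, ENNReal.ofReal (((c + a * y) ^ 2 + 12 * U) ^ 2) ∂ν ≤
      ENNReal.ofReal ((c ^ 2 + 12 * (U + a ^ 2)) ^ 2))
    (hμ : ∀ c a U : ℝ, 0 ≤ U → ∫⁻ y, ENNReal.ofReal (((c + a * y) ^ 2 + 12 * U) ^ 2) ∂μ ≤
      ENNReal.ofReal ((c ^ 2 + 12 * (U + a ^ 2)) ^ 2))
    (hμ2 : ∀ c a U : ℝ, 0 ≤ U → ENNReal.ofReal (c ^ 2 + 1 / 12 * (U + a ^ 2)) ≤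
      ∫⁻ y, ENNReal.ofReal ((c + a * y) ^ 2 + 1 / 12 * U) ∂μ)
    (n : ℕ) (u : Fin n → ℝ) (c : ℝ) :
    ∫⁻ x, ‖c + ∑ i, u i * x i‖ₑ ^ p ∂(Measure.pi fun _ => ν) ≤
      ENNReal.ofReal (1 + 518400 * ε * Real.sqrt n) *
        ∫⁻ x, ‖c + ∑ i, u i * x i‖ₑ ^ p ∂(Measure.pi fun _ => μ) := by
  set T := c ^ 2 + 12 * ∑ i, u i ^ 2 with hT
  have hT0 : 0 ≤ T := by positivity
  rcases hT0.eq_or_lt with h0 | hTpos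
  · have hc2 : c ^ 2 = 0 := by
      have : 0 ≤ ∑ i, u i ^ 2 := by positivity
      nlinarith [sq_nonneg c]
    have hu2 : ∑ i, u i ^ 2 = 0 := by
      have : 0 ≤ ∑ i, u i ^ 2 := by positivity
      nlinarith [sq_nonneg c]
    have hu : ∀ i, u i = 0 := fun i => by
      have := (Finset.sum_eq_zero_iff_of_nonneg (fun i _ => sq_nonneg (u i))).1 hu2 i (Finset.mem_univ i)
      exact pow_eq_zero_iff (two_ne_zero) |>.1 this
    have hc : c = 0 := pow_eq_zero_iff (two_ne_zero) |>.1 hc2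
    simp [hu, hc, ENNReal.zero_rpow_of_pos (by linarith : 0 < p)]
  set R := Real.sqrt T with hR
  have hR0 : 0 < R := Real.sqrt_pos.2 hTpos
  have hR2 : R ^ 2 = T := Real.sq_sqrt hT0
  have hR4 : R ^ 4 = T ^ 2 := by rw [← hR2]; ring
  have hadd := lintegral_pi_affine_le_add hp hp4 hε hR0 h1 hν hμ n u c
  have hl1 : ∑ i, |u i| ≤ Real.sqrt n * R := by
    rw [← Real.sqrt_mul (Nat.cast_nonneg n)]
    refine Real.le_sqrt_of_sq_le ?_
    have := sq_sum_le_card_mul_sum_sq (s := Finset.univ) (f := fun i => |u i|)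
    simp only [sq_abs, Finset.card_univ, Fintype.card_fin] at this
    refine this.trans (mul_le_mul_of_nonneg_left ?_ (Nat.cast_nonneg n))
    have : 0 ≤ ∑ i, u i ^ 2 := by positivity
    nlinarith [sq_nonneg c]
  have hlow : ENNReal.ofReal ((1 / 144 : ℝ) ^ 2 / 5 * R ^ p) ≤
      ∫⁻ x, ‖c + ∑ i, u i * x i‖ₑ ^ p ∂(Measure.pi fun _ => μ) := by
    refine le_lintegral_enorm_rpow (by fun_prop) hp hp4 (by norm_num) hR0 ?_ ?_
    · have := le_lintegral_pi_affine (G := fun c U => ENNReal.ofReal (c ^ 2 + 1 / 12 * U))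
        (fun U => by fun_prop) hμ2 n u c 0 le_rfl
      simp only [zero_add, mul_zero, add_zero] at this
      refine le_trans (ENNReal.ofReal_le_ofReal ?_) this
      rw [hR2, hT]
      nlinarith [sq_nonneg c]
    · have := lintegral_pi_affine_le (G := fun c U => ENNReal.ofReal ((c ^ 2 + 12 * U) ^ 2))
        (fun U => by fun_prop) hμ n u c 0 le_rfl
      simp only [zero_add, mul_zero, add_zero, ← pow_mul] at this
      rw [hR4, hT]
      exact this
  refine hadd.trans ?_
  rw [ENNReal.ofReal_add zero_le_one (by positivity), add_mul, ENNReal.ofReal_one, one_mul]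
  refine add_le_add_right ?_ _
  refine le_trans ?_ (mul_le_mul_right hlow _)
  rw [← ENNReal.ofReal_mul (by positivity), ← ENNReal.ofReal_one,
    ← ENNReal.ofReal_add zero_le_one (by positivity), ← ENNReal.ofReal_mul (by positivity),
    ← ENNReal.ofReal_mul (by positivity)]
  refine ENNReal.ofReal_le_ofReal ?_
  rw [← hT, ← hR4]
  have e1 : 1 + 4 / R ^ 4 * R ^ 4 = 5 := by field_simp; norm_num
  have e2 : R ^ p = R ^ (p - 1) * R := by
    rw [← Real.rpow_add_one hR0.ne']; ring_nf
  rw [e1, e2]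
  have : 0 ≤ ε * R ^ (p - 1) := by positivity
  nlinarith [mul_le_mul_of_nonneg_left hl1 this]

/-- The law on `ℝ` with density proportional to `exp (-|y| ^ r)`. -/
noncomputable def expLaw (r : ℝ) : Measure ℝ :=
  (volume : Measure ℝ).withDensity fun y =>
    ENNReal.ofReal ((2 * Real.Gamma (1 + r⁻¹))⁻¹ * Real.exp (-|y| ^ r))

/-- The uniform law on `[-l, l]`. -/
noncomputable def unifLaw (l : ℝ) : Measure ℝ :=
  Measure.map (fun z => l * z) (ProbabilityTheory.cond volume (Set.Icc (-1 : ℝ) 1))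

theorem lintegral_expLaw {r : ℝ} (hr : 1 ≤ r) {f : ℝ → ℝ} (hf : Continuous f) (h0 : ∀ y, 0 ≤ f y) {C : ℝ}
    (hC : ∀ y, f y ≤ C * (1 + |y| ^ 4)) :
    ∫⁻ y, ENNReal.ofReal (f y) ∂(expLaw r) =
      ENNReal.ofReal ((2 * Real.Gamma (1 + r⁻¹))⁻¹ * ∫ y, f y * Real.exp (-|y| ^ r)) := by
  have hl : 0 < Real.Gamma (1 + r⁻¹) := Gamma_one_add_pos (by positivity)
  rw [expLaw, lintegral_withDensity_eq_lintegral_mul _ (by fun_prop) (by fun_prop)]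
  have hi := integrable_mul_exp_neg_abs_rpow (by linarith : 0 < r) hf (C := C)
    (fun y => by rw [abs_of_nonneg (h0 y)]; exact hC y)
  rw [← integral_const_mul, ofReal_integral_eq_lintegral_ofReal (hi.const_mul _)
    (ae_of_all _ fun y => by have := h0 y; positivity)]
  refine lintegral_congr fun y => ?_
  rw [Pi.mul_apply, ← ENNReal.ofReal_mul (by positivity)]
  ring_nf

theorem isProbabilityMeasure_expLaw {r : ℝ} (hr : 1 ≤ r) : IsProbabilityMeasure (expLaw r) := by
  constructor
  have h := lintegral_expLaw hr (f := fun _ => 1) continuous_const (fun _ => zero_le_one) (C := 1)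
    (fun y => by have := pow_nonneg (abs_nonneg y) 4; linarith)
  have hm := (integral_abs_pow_mul_exp_neg (by linarith : 0 < r) 0).2
  have hl : 0 < Real.Gamma (1 + r⁻¹) := Gamma_one_add_pos (by positivity)
  simp only [pow_zero, one_mul] at hm
  simp only [ENNReal.ofReal_one, lintegral_const, one_mul, hm] at h
  rw [h, ← ENNReal.ofReal_one]
  congr 1
  norm_num
  field_simp

theorem lintegral_unifLaw {l : ℝ} (hl : 0 < l) {f : ℝ → ℝ} (hf : Continuous f) (h0 : ∀ y, 0 ≤ f y) :
    ∫⁻ y, ENNReal.ofReal (f y) ∂(unifLaw l) = ENNReal.ofReal ((2 * l)⁻¹ * ∫ y in (-l)..l, f y) := by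
  rw [unifLaw, lintegral_map (by fun_prop) (by fun_prop), ProbabilityTheory.cond,
    lintegral_smul_measure, Real.volume_Icc, ← ofReal_integral_eq_lintegral_ofReal
      (Continuous.integrableOn_Icc (by fun_prop)) (ae_of_all _ fun y => h0 _),
    integral_Icc_eq_integral_Ioc, ← intervalIntegral.integral_of_le (by norm_num), smul_eq_mul,
    ← ENNReal.ofReal_inv_of_pos (by norm_num), ← ENNReal.ofReal_mul (by norm_num)]
  congr 1
  have := intervalIntegral.mul_integral_comp_mul_left (a := -1) (b := 1) (f := f) l
  rw [mul_neg, mul_one] at this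
  rw [← this]
  norm_num
  field_simp
  exact this

theorem isProbabilityMeasure_cond_Icc :
    IsProbabilityMeasure (ProbabilityTheory.cond volume (Set.Icc (-1 : ℝ) 1)) :=
  ProbabilityTheory.cond_isProbabilityMeasure_of_finite (by simp) (by simp)

theorem isProbabilityMeasure_unifLaw (l : ℝ) : IsProbabilityMeasure (unifLaw l) := by
  have := isProbabilityMeasure_cond_Icc
  exact Measure.isProbabilityMeasure_map (by fun_prop)

/-- The interval half-length `Γ (1 + r⁻¹)` gives both laws the same normalizing constant, which is
at most `1`; the error constant is `200 = 4 * 50`. -/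
theorem lintegral_enorm_rpow_expLaw_le {p r : ℝ} (hp : 1 ≤ p) (hp4 : p ≤ 4) (hr : 1 ≤ r) (s a : ℝ) :
    ∫⁻ y, ‖s + a * y‖ₑ ^ p ∂(expLaw r) ≤
      ∫⁻ y, ‖s + a * y‖ₑ ^ p ∂(unifLaw (Real.Gamma (1 + r⁻¹))) +
        ENNReal.ofReal (200 * Real.exp 25 * r⁻¹ ^ 2 * |a| * (|s| + |a|) ^ (p - 1)) := by
  have ht : 0 ≤ r⁻¹ := by positivity
  have ht1 : r⁻¹ ≤ 1 := inv_le_one_of_one_le₀ hr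
  have hl : 0 < Real.Gamma (1 + r⁻¹) := Gamma_one_add_pos ht
  have hl2 := half_le_Gamma_one_add ht ht1
  have hc : Continuous fun y : ℝ => |s + a * y| ^ p :=
    Continuous.rpow_const (by fun_prop) fun _ => Or.inr (by linarith)
  simp only [enorm_rpow_eq_ofReal (by linarith : 0 ≤ p)]
  rw [lintegral_expLaw hr hc (fun y => by positivity) (abs_add_mul_rpow_le hp hp4 s a),
    lintegral_unifLaw hl hc (fun y => by positivity), ← ENNReal.ofReal_add ?_ (by positivity)]
  · refine ENNReal.ofReal_le_ofReal ?_
    have h := mul_le_mul_of_nonneg_left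
      (integral_abs_rpow_mul_exp_le (s := s) (a := a) hp hp4 hr)
      (inv_nonneg.2 (by positivity : 0 ≤ 2 * Real.Gamma (1 + r⁻¹)))
    refine h.trans ?_
    rw [mul_add]
    refine add_le_add_right ?_ _
    have h1 : (2 * Real.Gamma (1 + r⁻¹))⁻¹ ≤ 1 := inv_le_one_of_one_le₀ (by linarith)
    refine (mul_le_of_le_one_left (by positivity) h1).trans (le_of_eq ?_)
    ring
  · exact mul_nonneg (by positivity) (intervalIntegral.integral_nonneg (by linarith)
      fun y _ => by positivity)

theorem Gamma_one_add_three_mul_le {t : ℝ} (ht : 0 ≤ t) (ht1 : t ≤ 1) :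
    Real.Gamma (1 + 3 * t) ≤ 6 := by
  have h := Real.convexOn_Gamma.2 (show (1 : ℝ) ∈ Set.Ioi 0 from Set.mem_Ioi.2 one_pos)
    (show (4 : ℝ) ∈ Set.Ioi 0 from Set.mem_Ioi.2 four_pos) (sub_nonneg.2 ht1) ht (by ring)
  have h4 : Real.Gamma 4 = 6 := by
    rw [show (4 : ℝ) = (3 : ℕ) + 1 by norm_num, Real.Gamma_nat_eq_factorial]; norm_num [Nat.factorial]
  simp only [smul_eq_mul, Real.Gamma_one, h4] at h
  rw [show (1 - t) * 1 + t * 4 = 1 + 3 * t by ring] at h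
  linarith

theorem Gamma_one_add_five_mul_le {t : ℝ} (ht : 0 ≤ t) (ht1 : t ≤ 1) :
    Real.Gamma (1 + 5 * t) ≤ 120 := by
  have h := Real.convexOn_Gamma.2 (show (1 : ℝ) ∈ Set.Ioi 0 from Set.mem_Ioi.2 one_pos)
    (show (6 : ℝ) ∈ Set.Ioi 0 from Set.mem_Ioi.2 (by norm_num)) (sub_nonneg.2 ht1) ht (by ring)
  have h4 : Real.Gamma 6 = 120 := by
    rw [show (6 : ℝ) = (5 : ℕ) + 1 by norm_num, Real.Gamma_nat_eq_factorial]; norm_num [Nat.factorial]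
  simp only [smul_eq_mul, Real.Gamma_one, h4] at h
  rw [show (1 - t) * 1 + t * 6 = 1 + 5 * t by ring] at h
  linarith

theorem sq_add_sq_polynomial_le (a c : ℝ) {U : ℝ} (hU : 0 ≤ U) (y : ℝ) :
    ((c + a * y) ^ 2 + 12 * U) ^ 2 ≤ 4 * (c ^ 2 + a ^ 2 + 6 * U) ^ 2 * (1 + |y| ^ 4) * 2 := by
  have h1 : (c + a * y) ^ 2 + 12 * U ≤ 2 * (c ^ 2 + a ^ 2 + 6 * U) * (1 + y ^ 2) := by
    nlinarith [sq_nonneg (c - a * y), sq_nonneg (c * y), sq_nonneg a, mul_nonneg hU (sq_nonneg y)]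
  have h2 : (1 + y ^ 2) ^ 2 ≤ 2 * (1 + |y| ^ 4) := by
    rw [Even.pow_abs (by decide : Even 4)]
    nlinarith [sq_nonneg (y ^ 2 - 1)]
  calc ((c + a * y) ^ 2 + 12 * U) ^ 2 ≤ (2 * (c ^ 2 + a ^ 2 + 6 * U) * (1 + y ^ 2)) ^ 2 :=
        pow_le_pow_left₀ (by positivity) h1 2
    _ = 4 * (c ^ 2 + a ^ 2 + 6 * U) ^ 2 * (1 + y ^ 2) ^ 2 := by ring
    _ ≤ 4 * (c ^ 2 + a ^ 2 + 6 * U) ^ 2 * (2 * (1 + |y| ^ 4)) :=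
        mul_le_mul_of_nonneg_left h2 (by positivity)
    _ = _ := by ring

/-- The constant `12` is what the bound `m2 ≤ 4` requires: the mixed term `6 * c ^ 2 * a ^ 2 * m2`
must not exceed `24 * c ^ 2 * a ^ 2`. -/
theorem fourth_moment_aux {a c U m2 m4 : ℝ} (hU : 0 ≤ U) (h2 : m2 ≤ 4) (h4 : m4 ≤ 144) :
    (c ^ 2 + 12 * U) ^ 2 + (6 * c ^ 2 + 24 * U) * a ^ 2 * m2 + a ^ 4 * m4 ≤
      (c ^ 2 + 12 * (U + a ^ 2)) ^ 2 := by
  have h3 : 0 ≤ (6 * c ^ 2 + 24 * U) * a ^ 2 := by positivity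
  have h5 : 0 ≤ a ^ 4 := by positivity
  nlinarith [mul_le_mul_of_nonneg_left h2 h3, mul_le_mul_of_nonneg_left h4 h5,
    mul_nonneg hU (sq_nonneg a)]

theorem lintegral_expLaw_fourth {r : ℝ} (hr : 1 ≤ r) (c a U : ℝ) (hU : 0 ≤ U) :
    ∫⁻ y, ENNReal.ofReal (((c + a * y) ^ 2 + 12 * U) ^ 2) ∂(expLaw r) ≤
      ENNReal.ofReal ((c ^ 2 + 12 * (U + a ^ 2)) ^ 2) := by
  have hr0 : 0 < r := by linarith
  have ht : 0 ≤ r⁻¹ := by positivity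
  have ht1 : r⁻¹ ≤ 1 := inv_le_one_of_one_le₀ hr
  have hl : 0 < Real.Gamma (1 + r⁻¹) := Gamma_one_add_pos ht
  have hl2 := half_le_Gamma_one_add ht ht1
  have hb := fun (a y : ℝ) => (sq_add_sq_polynomial_le a c hU y).trans_eq
    (by ring : _ = 8 * (c ^ 2 + a ^ 2 + 6 * U) ^ 2 * (1 + |y| ^ 4))
  rw [lintegral_expLaw hr (by fun_prop) (fun y => by positivity) (hb a)]
  refine ENNReal.ofReal_le_ofReal ?_
  have hi := fun k => (integral_abs_pow_mul_exp_neg hr0 k).1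
  have hm := fun k => (integral_abs_pow_mul_exp_neg hr0 k).2
  have i1 : ∀ a : ℝ, Integrable fun y : ℝ => ((c + a * y) ^ 2 + 12 * U) ^ 2 * Real.exp (-|y| ^ r) :=
    fun a => integrable_mul_exp_neg_abs_rpow hr0 (by fun_prop)
      (fun y => by rw [abs_of_nonneg (by positivity)]; exact hb a y)
  -- Averaging over `a` and `-a` removes the odd powers of `y`.
  have hneg : ∫ y, ((c + a * y) ^ 2 + 12 * U) ^ 2 * Real.exp (-|y| ^ r) =
      ∫ y, ((c + -a * y) ^ 2 + 12 * U) ^ 2 * Real.exp (-|y| ^ r) := by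
    rw [← integral_neg_eq_self]; simp
  have e : ∫ y, ((c + a * y) ^ 2 + 12 * U) ^ 2 * Real.exp (-|y| ^ r) =
      (c ^ 2 + 12 * U) ^ 2 * (2 * Real.Gamma (1 + r⁻¹)) + (6 * c ^ 2 + 24 * U) * a ^ 2 *
        (2 / 3 * Real.Gamma (1 + 3 * r⁻¹)) + a ^ 4 * (2 / 5 * Real.Gamma (1 + 5 * r⁻¹)) := by
    have h2 : (2 : ℝ) * ∫ y, ((c + a * y) ^ 2 + 12 * U) ^ 2 * Real.exp (-|y| ^ r) =
        ∫ y, 2 * ((c ^ 2 + 12 * U) ^ 2 * (|y| ^ 0 * Real.exp (-|y| ^ r)) +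
          (6 * c ^ 2 + 24 * U) * a ^ 2 * (|y| ^ 2 * Real.exp (-|y| ^ r)) +
          a ^ 4 * (|y| ^ 4 * Real.exp (-|y| ^ r))) := by
      rw [two_mul]
      nth_rewrite 2 [hneg]
      rw [← integral_add (i1 a) (i1 (-a))]
      refine integral_congr_ae (ae_of_all _ fun y => ?_)
      simp only [sq_abs, Even.pow_abs (by decide : Even 4)]
      ring
    rw [integral_const_mul, integral_add (((hi 0).const_mul _).fun_add ((hi 2).const_mul _))
      ((hi 4).const_mul _), integral_add ((hi 0).const_mul _) ((hi 2).const_mul _),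
      integral_const_mul, integral_const_mul, integral_const_mul, hm, hm, hm] at h2
    norm_num at h2 ⊢
    linarith
  rw [e]
  refine le_trans (le_of_eq ?_) (fourth_moment_aux hU
    (m2 := Real.Gamma (1 + 3 * r⁻¹) / (3 * Real.Gamma (1 + r⁻¹)))
    (m4 := Real.Gamma (1 + 5 * r⁻¹) / (5 * Real.Gamma (1 + r⁻¹))) ?_ ?_)
  · field_simp
  · rw [div_le_iff₀ (by positivity)]
    have := Gamma_one_add_three_mul_le ht ht1
    linarith
  · rw [div_le_iff₀ (by positivity)]
    have := Gamma_one_add_five_mul_le ht ht1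
    linarith

theorem integral_polynomial_four (l : ℝ) (b0 b1 b2 b3 b4 : ℝ) :
    ∫ y in (-l)..l, (b0 + b1 * y + b2 * y ^ 2 + b3 * y ^ 3 + b4 * y ^ 4) =
      2 * l * (b0 + b2 * (l ^ 2 / 3) + b4 * (l ^ 4 / 5)) := by
  have h : ∀ y ∈ Set.uIcc (-l) l, HasDerivAt (fun y : ℝ => b0 * y + b1 * (y ^ 2 / 2) + b2 * (y ^ 3 / 3) +
      b3 * (y ^ 4 / 4) + b4 * (y ^ 5 / 5)) (b0 + b1 * y + b2 * y ^ 2 + b3 * y ^ 3 + b4 * y ^ 4) y := by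
    intro y _
    have h0 := ((hasDerivAt_id' y).const_mul b0)
    have h1 := ((hasDerivAt_pow 2 y).div_const 2).const_mul b1
    have h2 := ((hasDerivAt_pow 3 y).div_const 3).const_mul b2
    have h3 := ((hasDerivAt_pow 4 y).div_const 4).const_mul b3
    have h4 := ((hasDerivAt_pow 5 y).div_const 5).const_mul b4
    refine ((((h0.fun_add h1).fun_add h2).fun_add h3).fun_add h4).congr_deriv ?_
    norm_num
  rw [intervalIntegral.integral_eq_sub_of_hasDerivAt h (Continuous.intervalIntegrable (by fun_prop) _ _)]
  ring

theorem lintegral_unifLaw_fourth {l : ℝ} (hl : 0 < l) (hl1 : l ≤ 1) (c a U : ℝ) (hU : 0 ≤ U) :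
    ∫⁻ y, ENNReal.ofReal (((c + a * y) ^ 2 + 12 * U) ^ 2) ∂(unifLaw l) ≤
      ENNReal.ofReal ((c ^ 2 + 12 * (U + a ^ 2)) ^ 2) := by
  rw [lintegral_unifLaw hl (by fun_prop) (fun y => by positivity)]
  refine ENNReal.ofReal_le_ofReal ?_
  have e : ∀ y : ℝ, ((c + a * y) ^ 2 + 12 * U) ^ 2 = (c ^ 2 + 12 * U) ^ 2 +
      (4 * c * a * (c ^ 2 + 12 * U)) * y + ((6 * c ^ 2 + 24 * U) * a ^ 2) * y ^ 2 +
      (4 * c * a ^ 3) * y ^ 3 + a ^ 4 * y ^ 4 := fun y => by ring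
  simp only [e]
  rw [integral_polynomial_four, inv_mul_cancel_left₀ (by positivity)]
  refine fourth_moment_aux hU ?_ ?_
  · have := pow_le_one₀ hl.le hl1 (n := 2); linarith
  · have := pow_le_one₀ hl.le hl1 (n := 4); linarith

theorem le_lintegral_unifLaw_second {l : ℝ} (hl : 1 / 2 ≤ l) (c a U : ℝ) (hU : 0 ≤ U) :
    ENNReal.ofReal (c ^ 2 + 1 / 12 * (U + a ^ 2)) ≤
      ∫⁻ y, ENNReal.ofReal ((c + a * y) ^ 2 + 1 / 12 * U) ∂(unifLaw l) := by
  have hl0 : 0 < l := by linarith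
  rw [lintegral_unifLaw hl0 (by fun_prop) (fun y => by positivity)]
  refine ENNReal.ofReal_le_ofReal ?_
  have e : ∀ y : ℝ, (c + a * y) ^ 2 + 1 / 12 * U = (c ^ 2 + 1 / 12 * U) +
      (2 * c * a) * y + a ^ 2 * y ^ 2 + 0 * y ^ 3 + 0 * y ^ 4 := fun y => by ring
  simp only [e]
  rw [integral_polynomial_four, inv_mul_cancel_left₀ (by positivity)]
  have : 1 / 12 ≤ l ^ 2 / 3 := by nlinarith
  nlinarith [mul_le_mul_of_nonneg_left this (sq_nonneg a)]

theorem lintegral_pi_expLaw_le {p r : ℝ} (hp : 1 ≤ p) (hp4 : p ≤ 4) (hr : 1 ≤ r) (n : ℕ)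
    (u : Fin n → ℝ) (c : ℝ) :
    ∫⁻ x, ‖c + ∑ i, u i * x i‖ₑ ^ p ∂(Measure.pi fun _ => expLaw r) ≤
      ENNReal.ofReal (1 + 518400 * (200 * Real.exp 25 * r⁻¹ ^ 2) * Real.sqrt n) *
        ∫⁻ x, ‖c + ∑ i, u i * x i‖ₑ ^ p
          ∂(Measure.pi fun _ => unifLaw (Real.Gamma (1 + r⁻¹))) := by
  have := isProbabilityMeasure_expLaw hr
  have := isProbabilityMeasure_unifLaw (Real.Gamma (1 + r⁻¹))
  have ht : 0 ≤ r⁻¹ := by positivity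
  have ht1 : r⁻¹ ≤ 1 := inv_le_one_of_one_le₀ hr
  exact lintegral_pi_affine_le_mul hp hp4 (by positivity)
    (lintegral_enorm_rpow_expLaw_le hp hp4 hr) (lintegral_expLaw_fourth hr)
    (lintegral_unifLaw_fourth (Gamma_one_add_pos ht) (Gamma_one_add_le_one ht ht1))
    (le_lintegral_unifLaw_second (half_le_Gamma_one_add ht ht1)) n u c

/-! ### From independent coordinates to the ball -/

theorem measurable_fin_cons {α : Type*} [MeasurableSpace α] (n : ℕ) :
    Measurable fun z : α × (Fin n → α) => (Fin.cons z.1 z.2 : Fin (n + 1) → α) := by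
  refine measurable_pi_lambda _ fun i => Fin.cases ?_ (fun j => ?_) i
  · simpa using measurable_fst
  · simpa [Function.comp_def] using (measurable_pi_apply j).comp (measurable_snd (α := α))

theorem lintegral_pi_withDensity {α : Type*} [MeasurableSpace α] {μ : Measure α} [SigmaFinite μ]
    {g : α → ℝ≥0∞} (hg : Measurable g) [SigmaFinite (μ.withDensity g)] (n : ℕ) :
    ∀ {f : (Fin n → α) → ℝ≥0∞}, Measurable f →
      ∫⁻ x, f x ∂(Measure.pi fun _ => μ.withDensity g) =
        ∫⁻ x, f x * ∏ i, g (x i) ∂(Measure.pi fun _ => μ) := by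
  induction n with
  | zero => intro f hf; rw [Measure.pi_of_empty, Measure.pi_of_empty]; simp
  | succ n ih =>
    intro f hf
    have hm : Measurable fun z : α × (Fin n → α) => f (Fin.cons z.1 z.2) :=
      hf.comp (measurable_fin_cons n)
    have hp : Measurable fun x : Fin n → α => ∏ i, g (x i) :=
      Finset.measurable_fun_prod _ fun i _ => hg.comp (measurable_pi_apply i)
    have hp' : Measurable fun x : Fin (n + 1) → α => ∏ i, g (x i) :=
      Finset.measurable_fun_prod _ fun i _ => hg.comp (measurable_pi_apply i)
    rw [lintegral_pi_succ _ n hf, lintegral_pi_succ μ n (hf.fun_mul hp'),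
      lintegral_withDensity_eq_lintegral_mul _ hg hm.lintegral_prod_right']
    refine lintegral_congr fun x => ?_
    have hx : Measurable fun R : Fin n → α => f (Fin.cons x R) := hm.comp measurable_prodMk_left
    rw [Pi.mul_apply, ih hx, ← lintegral_const_mul _ (hx.fun_mul hp)]
    refine lintegral_congr fun R => ?_
    rw [Fin.prod_univ_succ]
    simp only [Fin.cons_zero, Fin.cons_succ]
    ring

theorem pi_unifLaw (l : ℝ) (n : ℕ) :
    (Measure.pi fun _ : Fin n => unifLaw l) = Measure.map (fun z => l • z) (lqLaw ∞ n) := by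
  have := isProbabilityMeasure_cond_Icc
  have h := Measure.pi_map_pi (μ := fun _ : Fin n => ProbabilityTheory.cond volume (Set.Icc (-1 : ℝ) 1))
    (f := fun _ z => l * z) (fun _ => by fun_prop)
  have h2 : lqLaw ∞ n = Measure.pi fun _ : Fin n =>
      ProbabilityTheory.cond volume (Set.Icc (-1 : ℝ) 1) := by
    refine (Measure.pi_eq fun s hs => ?_).symm
    rw [lqLaw, lqBall_top, ProbabilityTheory.cond_apply (MeasurableSet.univ_pi fun _ => measurableSet_Icc),
      ← Set.pi_inter_distrib, volume_pi_pi, volume_pi_pi]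
    simp only [ProbabilityTheory.cond_apply measurableSet_Icc]
    rw [Finset.prod_mul_distrib]
    simp [ENNReal.inv_pow]
  rw [h2, unifLaw, ← h]
  rfl

/-- Jensen's inequality for `|x| ^ p`, obtained from monotonicity of the `L ^ p` norms on a
probability space. -/
theorem enorm_integral_rpow_le {α : Type*} [MeasurableSpace α] {μ : Measure α} [IsProbabilityMeasure μ]
    {X : α → ℝ} (hX : AEStronglyMeasurable X μ) {p : ℝ} (hp : 1 ≤ p) :
    ‖∫ x, X x ∂μ‖ₑ ^ p ≤ ∫⁻ x, ‖X x‖ₑ ^ p ∂μ := by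
  have h1 : ‖∫ x, X x ∂μ‖ₑ ≤ eLpNorm X (ENNReal.ofReal p) μ := by
    refine (enorm_integral_le_lintegral_enorm X).trans ?_
    rw [← eLpNorm_one_eq_lintegral_enorm]
    exact eLpNorm_le_eLpNorm_of_exponent_le (by simpa using hp) hX
  have hp0 : 0 < p := by linarith
  rw [eLpNorm_eq_lintegral_rpow_enorm_toReal (by simpa using hp0) (by simp),
    ENNReal.toReal_ofReal hp0.le] at h1
  have h2 := ENNReal.rpow_le_rpow h1 hp0.le
  rwa [← ENNReal.rpow_mul, one_div, inv_mul_cancel₀ hp0.ne', ENNReal.rpow_one] at h2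

/-- Jensen's inequality for the radial variable, which follows a Gamma distribution. -/
theorem ofReal_Gamma_mul_enorm_rpow_le {p s t : ℝ} (hp : 1 ≤ p) (hs : 0 ≤ s) (ht : 0 ≤ t) (c v : ℝ) :
    ENNReal.ofReal (Real.Gamma (1 + s)) * ‖c + v‖ₑ ^ p ≤
      ∫⁻ y in Set.Ioi (0 : ℝ), ENNReal.ofReal (Real.exp (-y) * y ^ s) *
        ‖c + y ^ t * (v * (Real.Gamma (1 + s) / Real.Gamma (1 + (s + t))))‖ₑ ^ p := by
  have hG : 0 < Real.Gamma (1 + s) := Gamma_one_add_pos hs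
  have hG' : 0 < Real.Gamma (1 + (s + t)) := Gamma_one_add_pos (by positivity)
  obtain ⟨i1, e1⟩ := integral_exp_neg_mul_rpow_Ioi hs
  obtain ⟨i2, e2⟩ := integral_exp_neg_mul_rpow_Ioi (add_nonneg hs ht)
  set w : ℝ → NNReal := fun y => Real.toNNReal (Real.exp (-y) * y ^ s / Real.Gamma (1 + s)) with hw
  have hwm : Measurable w := by fun_prop
  have hw0 : ∀ y ∈ Set.Ioi (0 : ℝ), 0 ≤ Real.exp (-y) * y ^ s := fun y hy => by
    have : 0 < y := hy
    positivity
  have hwe : ∀ y ∈ Set.Ioi (0 : ℝ), (w y : ℝ) = Real.exp (-y) * y ^ s / Real.Gamma (1 + s) :=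
    fun y hy => Real.coe_toNNReal _ (div_nonneg (hw0 y hy) hG.le)
  set γ : Measure ℝ := (volume.restrict (Set.Ioi 0)).withDensity fun y => (w y : ℝ≥0∞) with hγ
  have hprob : IsProbabilityMeasure γ := by
    constructor
    rw [hγ, withDensity_apply _ MeasurableSet.univ, Measure.restrict_univ]
    have : ∀ y, (w y : ℝ≥0∞) = ENNReal.ofReal (Real.exp (-y) * y ^ s / Real.Gamma (1 + s)) :=
      fun y => rfl
    simp only [this]
    rw [← ofReal_integral_eq_lintegral_ofReal (i1.div_const _), integral_div, e1, div_self hG.ne',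
      ENNReal.ofReal_one]
    filter_upwards [ae_restrict_mem measurableSet_Ioi] with y hy
    exact div_nonneg (hw0 y hy) hG.le
  set X : ℝ → ℝ := fun y => c + y ^ t * (v * (Real.Gamma (1 + s) / Real.Gamma (1 + (s + t)))) with hX
  have hXm : Measurable X := by fun_prop
  -- The `t`-th power of the Gamma variable has mean `Γ (1 + (s + t)) / Γ (1 + s)`, which the
  -- scaling of `v` cancels.
  have hmean : ∫ y, X y ∂γ = c + v := by
    rw [hγ, integral_withDensity_eq_integral_smul hwm]
    have : ∀ y ∈ Set.Ioi (0 : ℝ), w y • X y = c / Real.Gamma (1 + s) * (Real.exp (-y) * y ^ s) +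
        v / Real.Gamma (1 + (s + t)) * (Real.exp (-y) * y ^ (s + t)) := by
      intro y hy
      rw [NNReal.smul_def, hwe y hy, smul_eq_mul, Real.rpow_add hy]
      simp only [hX]
      field_simp
    rw [setIntegral_congr_fun measurableSet_Ioi this, integral_add (i1.const_mul _) (i2.const_mul _),
      integral_const_mul, integral_const_mul, e1, e2]
    field_simp
  have hJ := enorm_integral_rpow_le (μ := γ) hXm.aestronglyMeasurable hp
  rw [hmean, hγ, lintegral_withDensity_eq_lintegral_mul _ (by fun_prop) (by fun_prop)] at hJ
  refine (mul_le_mul_right hJ _).trans_eq ?_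
  rw [← lintegral_const_mul _ (by fun_prop)]
  refine lintegral_congr fun y => ?_
  rw [Pi.mul_apply, ← mul_assoc]
  congr 1
  change _ * ENNReal.ofReal _ = _
  rw [← ENNReal.ofReal_mul hG.le]
  congr 1
  field_simp

theorem lintegral_lqLaw (q : ℝ≥0∞) (n : ℕ) (f : (Fin n → ℝ) → ℝ≥0∞) :
    ∫⁻ x, f x ∂(lqLaw q n) = (volume (lqBall q n))⁻¹ * ∫⁻ x in lqBall q n, f x := by
  rw [lqLaw, ProbabilityTheory.cond, lintegral_smul_measure, smul_eq_mul]

/-- Comparison of affine forms on the ball with affine forms of independent coordinates. -/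
theorem lintegral_lqLaw_le_pi_expLaw {q : ℝ≥0∞} (hq : 1 ≤ q) (hqt : q ≠ ∞) {p : ℝ} (hp : 1 ≤ p) (n : ℕ)
    (u : Fin n → ℝ) (c : ℝ) :
    ∫⁻ x, ‖c + ∑ i, u i * x i‖ₑ ^ p ∂(lqLaw q n) ≤
      ∫⁻ x, ‖c + ∑ i, (u i * (Real.Gamma (1 + n * recip q) / Real.Gamma (1 + (n * recip q + recip q))))
        * x i‖ₑ ^ p ∂(Measure.pi fun _ => expLaw q.toReal) := by
  have hr := one_le_toReal hq hqt
  have hr0 : 0 < q.toReal := by linarith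
  have ht := recip_nonneg q
  have htr : recip q = q.toReal⁻¹ := recip_eq q
  have hl : 0 < Real.Gamma (1 + recip q) := Gamma_one_add_pos ht
  have hG : 0 < Real.Gamma (1 + n * recip q) := Gamma_one_add_pos (by positivity)
  set ρ := Real.Gamma (1 + n * recip q) / Real.Gamma (1 + (n * recip q + recip q)) with hρ
  have := isProbabilityMeasure_expLaw hr
  have hfm : Measurable fun x : Fin n → ℝ => ‖c + ∑ i, (u i * ρ) * x i‖ₑ ^ p := by fun_prop
  have hvol : volume (lqBall q n) = ENNReal.ofReal (2 ^ n * Real.Gamma (1 + recip q) ^ n /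
      Real.Gamma (1 + n * recip q)) := by
    rw [← vol_lqBall hq n, vol, ENNReal.ofReal_toReal (volume_lqBall_ne_top hq n)]
  have hd : ∀ x : Fin n → ℝ, ∏ i, ENNReal.ofReal ((2 * Real.Gamma (1 + q.toReal⁻¹))⁻¹ *
      Real.exp (-|x i| ^ q.toReal)) = ENNReal.ofReal (((2 * Real.Gamma (1 + recip q)) ^ n)⁻¹) *
        ENNReal.ofReal (Real.exp (-∑ i, |x i| ^ q.toReal)) := by
    intro x
    rw [← htr, ← ENNReal.ofReal_prod_of_nonneg (fun i _ => by positivity),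
      ← ENNReal.ofReal_mul (by positivity), Finset.prod_mul_distrib, ← Real.exp_sum,
      Finset.sum_neg_distrib]
    simp only [Finset.prod_const, Finset.card_univ, Fintype.card_fin, inv_pow]
  have : SigmaFinite ((volume : Measure ℝ).withDensity fun y =>
    ENNReal.ofReal ((2 * Real.Gamma (1 + q.toReal⁻¹))⁻¹ * Real.exp (-|y| ^ q.toReal))) :=
    inferInstanceAs (SigmaFinite (expLaw q.toReal))
  unfold expLaw
  rw [lintegral_pi_withDensity (by fun_prop) n hfm]
  simp only [hd, mul_left_comm _ (ENNReal.ofReal (((2 * Real.Gamma (1 + recip q)) ^ n)⁻¹))]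
  rw [lintegral_const_mul _ (by fun_prop), ← volume_pi, lintegral_mul_exp_neg_sum_rpow hr0 hfm,
    lintegral_lqLaw, hvol, ← ENNReal.ofReal_inv_of_pos (by positivity), ← lqBall_of_ne_top hqt, ← htr]
  -- For fixed `x` the affine form depends on the radial variable only through `y ^ recip q`, so the
  -- preceding Jensen inequality applies with `x` outside.
  have hswap : ∫⁻ y in Set.Ioi (0 : ℝ), ENNReal.ofReal (Real.exp (-y) * y ^ (n * recip q)) *
      ∫⁻ x in lqBall q n, ‖c + ∑ i, (u i * ρ) * (y ^ recip q • x) i‖ₑ ^ p =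
      ∫⁻ x in lqBall q n, ∫⁻ y in Set.Ioi (0 : ℝ), ENNReal.ofReal (Real.exp (-y) * y ^ (n * recip q)) *
        ‖c + y ^ recip q * ((∑ i, u i * x i) * ρ)‖ₑ ^ p := by
    rw [lintegral_lintegral_swap (by fun_prop)]
    refine lintegral_congr fun y => ?_
    rw [← lintegral_const_mul _ (by fun_prop)]
    refine lintegral_congr fun x => ?_
    congr 3
    rw [Finset.sum_mul, Finset.mul_sum]
    congr 1
    refine Finset.sum_congr rfl fun i _ => ?_
    rw [Pi.smul_apply, smul_eq_mul]; ring
  rw [hswap]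
  have hJ : ∀ x : Fin n → ℝ, _ := fun x => ofReal_Gamma_mul_enorm_rpow_le hp
    (by positivity : 0 ≤ n * recip q) ht c (∑ i, u i * x i)
  refine le_trans ?_ (mul_le_mul_right (lintegral_mono hJ) _)
  rw [lintegral_const_mul _ (by fun_prop), ← mul_assoc, ← ENNReal.ofReal_mul (by positivity)]
  refine le_of_eq ?_
  congr 2
  rw [mul_pow]
  field_simp

/-- The affine comparison between the uniform laws on `B_q^n` and on the cube. -/
theorem lintegral_lqLaw_affine_le {q : ℝ≥0∞} (hq : 1 ≤ q) {p : ℝ} (hp : 1 ≤ p) (hp4 : p ≤ 4) (n : ℕ)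
    (u : Fin n → ℝ) (c : ℝ) :
    ∫⁻ x, ‖c + ∑ i, u i * x i‖ₑ ^ p ∂(lqLaw q n) ≤
      ENNReal.ofReal (1 + 518400 * (200 * Real.exp 25 * recip q ^ 2) * Real.sqrt n) *
        ∫⁻ x, ‖c + ∑ i, u i * ((Real.Gamma (1 + recip q) * (Real.Gamma (1 + n * recip q) /
          Real.Gamma (1 + (n * recip q + recip q)))) * x i)‖ₑ ^ p ∂(lqLaw ∞ n) := by
  by_cases hqt : q = ∞
  · subst hqt; simp
  have hr := one_le_toReal hq hqt
  refine (lintegral_lqLaw_le_pi_expLaw hq hqt hp n u c).trans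
    ((lintegral_pi_expLaw_le hp hp4 hr n _ c).trans_eq ?_)
  rw [← recip_eq, pi_unifLaw, lintegral_map (by fun_prop) (by fun_prop)]
  congr 1
  refine lintegral_congr fun x => ?_
  congr 4
  ext i
  rw [Pi.smul_apply, smul_eq_mul]; ring

/-! ### Replacing the rows of a determinant one by one -/

/-- A function affine in each row separately lets the one-row comparison be used with the other rows
frozen, at the price of one factor `K` per row. -/
theorem lintegral_pi_le_of_affine {n : ℕ} {P Q : Measure (Fin n → ℝ)} [SigmaFinite P] [SigmaFinite Q] {p τ : ℝ} {K : ℝ≥0∞}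
    (h : ∀ (u : Fin n → ℝ) (c : ℝ), ∫⁻ x, ‖c + ∑ i, u i * x i‖ₑ ^ p ∂P ≤
      K * ∫⁻ x, ‖c + ∑ i, u i * (τ * x i)‖ₑ ^ p ∂Q) (N : ℕ) :
    ∀ {F : (Fin N → Fin n → ℝ) → ℝ}, Measurable F →
      (∀ i X, ∃ (c : ℝ) (u : Fin n → ℝ), ∀ x, F (Function.update X i x) = c + ∑ j, u j * x j) →
      ∫⁻ X, ‖F X‖ₑ ^ p ∂(Measure.pi fun _ => P) ≤
        K ^ N * ∫⁻ X, ‖F (τ • X)‖ₑ ^ p ∂(Measure.pi fun _ => Q) := by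
  induction N with
  | zero =>
    intro F _ _
    rw [Measure.pi_of_empty, Measure.pi_of_empty]
    simp only [lintegral_dirac, pow_zero, one_mul]
    exact le_of_eq (congrArg (fun X => ‖F X‖ₑ ^ p) (Subsingleton.elim _ _))
  | succ N ih =>
    intro F hF hA
    have hc := measurable_fin_cons (α := Fin n → ℝ) N
    have hτ : Measurable fun x : Fin n → ℝ => τ • x := by fun_prop
    have hFc : Measurable fun z : (Fin n → ℝ) × (Fin N → Fin n → ℝ) =>
        ‖F (Fin.cons (τ • z.1) z.2)‖ₑ ^ p :=
      (hF.comp (hc.comp ((hτ.comp measurable_fst).prodMk measurable_snd))).enorm.pow_const p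
    have hFs : Measurable fun X : Fin (N + 1) → Fin n → ℝ => ‖F (τ • X)‖ₑ ^ p :=
      (hF.comp (by fun_prop)).enorm.pow_const p
    rw [lintegral_pi_succ' P N (hF.enorm.pow_const p), lintegral_pi_succ Q N hFs]
    calc _ ≤ ∫⁻ R : Fin N → Fin n → ℝ, K * ∫⁻ x, ‖F (Fin.cons (τ • x) R)‖ₑ ^ p ∂Q
            ∂(Measure.pi fun _ => P) := by
          refine lintegral_mono fun R => ?_
          obtain ⟨c, u, hu⟩ := hA 0 (Fin.cons 0 R)
          simp only [Fin.update_cons_zero] at hu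
          simp only [hu]
          exact h u c
      _ = K * ∫⁻ x, ∫⁻ R : Fin N → Fin n → ℝ, ‖F (Fin.cons (τ • x) R)‖ₑ ^ p
            ∂(Measure.pi fun _ => P) ∂Q := by
          rw [lintegral_const_mul _ hFc.lintegral_prod_left',
            ← lintegral_lintegral_swap (f := fun (x : Fin n → ℝ) (R : Fin N → Fin n → ℝ) =>
              ‖F (Fin.cons (τ • x) R)‖ₑ ^ p) hFc.aemeasurable]
      -- With the first row fixed and already rescaled, the function of the remaining rows is still
      -- affine in each of them.
      _ ≤ K * ∫⁻ x, K ^ N * ∫⁻ R : Fin N → Fin n → ℝ, ‖F (Fin.cons (τ • x) (τ • R))‖ₑ ^ p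
            ∂(Measure.pi fun _ => Q) ∂Q := by
          refine mul_le_mul_right (lintegral_mono fun x => ?_) _
          refine ih (F := fun R => F (Fin.cons (τ • x) R)) (hF.comp (hc.comp measurable_prodMk_left))
            fun i R => ?_
          obtain ⟨c, u, hu⟩ := hA i.succ (Fin.cons (τ • x) R)
          exact ⟨c, u, fun y => by rw [← hu y, Fin.cons_update]⟩
      _ = _ := by
          have hm : Measurable fun z : (Fin n → ℝ) × (Fin N → Fin n → ℝ) =>
              ‖F (Fin.cons (τ • z.1) (τ • z.2))‖ₑ ^ p :=
            (hF.comp (hc.comp ((hτ.comp measurable_fst).prodMk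
              (by fun_prop)))).enorm.pow_const p
          rw [lintegral_const_mul _ hm.lintegral_prod_right', ← mul_assoc, pow_succ']
          congr 1
          refine lintegral_congr fun x => lintegral_congr fun R => ?_
          congr 3
          ext i j
          refine Fin.cases ?_ (fun k => ?_) i <;> simp

theorem det_update_affine {n : ℕ} (i : Fin n) (X : Fin n → Fin n → ℝ) :
    ∃ (c : ℝ) (u : Fin n → ℝ), ∀ x, Matrix.det (Matrix.of (Function.update X i x)) =
      c + ∑ j, u j * x j := by
  set L := (Matrix.detRowAlternating (R := ℝ) (n := Fin n)).toMultilinearMap.toLinearMap X i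
  refine ⟨0, fun j => L (fun k => if j = k then 1 else 0), fun x => ?_⟩
  have : Matrix.det (Matrix.of (Function.update X i x)) = L x := rfl
  rw [this, LinearMap.pi_apply_eq_sum_univ L x]
  simp [mul_comm]

theorem simplexDet_update_affine {n : ℕ} (i : Fin (n + 1)) (X : Fin (n + 1) → Fin n → ℝ) :
    ∃ (c : ℝ) (u : Fin n → ℝ), ∀ x, simplexDet (Function.update X i x) = c + ∑ j, u j * x j := by
  obtain ⟨c, u, h⟩ := det_update_affine i (fun k => (Fin.cons 1 (X k) : Fin (n + 1) → ℝ))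
  refine ⟨c + u 0, fun j => u j.succ, fun x => ?_⟩
  have e : (fun k => (Fin.cons 1 (Function.update X i x k) : Fin (n + 1) → ℝ)) =
      Function.update (fun k => (Fin.cons 1 (X k) : Fin (n + 1) → ℝ)) i (Fin.cons 1 x) := by
    ext k
    by_cases hk : k = i
    · subst hk; simp
    · simp [hk]
  rw [simplexDet, e, h, Fin.sum_univ_succ]
  simp [add_assoc]

theorem det_of_smul {n : ℕ} (τ : ℝ) (X : Fin n → Fin n → ℝ) :
    Matrix.det (Matrix.of (τ • X)) = τ ^ n * Matrix.det (Matrix.of X) := by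
  rw [← Matrix.smul_of, Matrix.det_smul, Fintype.card_fin]

theorem simplexDet_smul {n : ℕ} (τ : ℝ) (X : Fin (n + 1) → Fin n → ℝ) :
    simplexDet (τ • X) = τ ^ n * simplexDet X := by
  rw [simplexDet, simplexDet, det_cons_one_eq_sum, det_cons_one_eq_sum, Finset.mul_sum]
  refine Finset.sum_congr rfl fun i _ => ?_
  have := det_of_smul τ (fun j => X (i.succAbove j))
  rw [show (fun j => (τ • X) (i.succAbove j)) = τ • fun j => X (i.succAbove j) from rfl, this]
  ring

/-- The factor by which affine forms are rescaled in passing from `B_q^n` to the cube. -/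
noncomputable def cubeScale (t : ℝ) (n : ℕ) : ℝ :=
  Real.Gamma (1 + t) * (Real.Gamma (1 + n * t) / Real.Gamma (1 + (n * t + t)))

theorem cubeScale_pos {t : ℝ} (ht : 0 ≤ t) (n : ℕ) : 0 < cubeScale t n :=
  mul_pos (Gamma_one_add_pos ht) (div_pos (Gamma_one_add_pos (by positivity))
    (Gamma_one_add_pos (by positivity)))

/-- The multiplicative loss per row when the ball is replaced by the rescaled cube, at the level of
`p`-th moments. -/
noncomputable def cubeLoss (t : ℝ) (n : ℕ) : ℝ :=
  1 + 518400 * (200 * Real.exp 25 * t ^ 2) * Real.sqrt n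

theorem one_le_cubeLoss (t : ℝ) (n : ℕ) : 1 ≤ cubeLoss t n := by
  rw [cubeLoss, le_add_iff_nonneg_right]; positivity

/-- Homogeneity of degree `n` turns the rescaling of all rows into `cubeScale ^ n`, both for the `n`
rows of V and for the `n + 1` points of U. -/
theorem lpNorm_le_of_affine {q : ℝ≥0∞} (hq : 1 ≤ q) {p : ℝ≥0∞} (hp : 1 ≤ p) (hp4 : p ≤ 4) {n N : ℕ}
    {F : (Fin N → Fin n → ℝ) → ℝ} (hF : Continuous F)
    (hA : ∀ i X, ∃ (c : ℝ) (u : Fin n → ℝ), ∀ x, F (Function.update X i x) = c + ∑ j, u j * x j)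
    (hH : ∀ (τ : ℝ) X, F (τ • X) = τ ^ n * F X) :
    lpNorm F p (Measure.pi fun _ => lqLaw q n) ≤
      cubeLoss (recip q) n ^ N * cubeScale (recip q) n ^ n *
        lpNorm F p (Measure.pi fun _ => lqLaw ∞ n) := by
  have := isProbabilityMeasure_lqLaw hq n
  have := isProbabilityMeasure_lqLaw (q := ∞) le_top n
  have hpt : p ≠ ∞ := ne_top_of_le_ne_top (by simp) hp4
  have hp0 : p ≠ 0 := (zero_lt_one.trans_le hp).ne'
  have hp1 : 1 ≤ p.toReal := by
    have := ENNReal.toReal_mono hpt hp; simpa using this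
  have hp1' : p.toReal ≤ 4 := by
    have := ENNReal.toReal_mono (by simp) hp4; simpa using this
  have hpp : 0 < p.toReal := by linarith
  have hτ := cubeScale_pos (recip_nonneg q) n
  have hK := one_le_cubeLoss (recip q) n
  have h := lintegral_pi_le_of_affine (lintegral_lqLaw_affine_le hq hp1 hp1' n) N hF.measurable hA
  have hI : eLpNorm F p (Measure.pi fun _ => lqLaw q n) ≤
      ENNReal.ofReal (cubeLoss (recip q) n ^ N * cubeScale (recip q) n ^ n) *
        eLpNorm F p (Measure.pi fun _ => lqLaw ∞ n) := by
    rw [eLpNorm_eq_lintegral_rpow_enorm_toReal hp0 hpt, eLpNorm_eq_lintegral_rpow_enorm_toReal hp0 hpt]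
    refine (ENNReal.rpow_le_rpow h (by positivity)).trans ?_
    change (ENNReal.ofReal (cubeLoss (recip q) n) ^ N *
      ∫⁻ X, ‖F (cubeScale (recip q) n • X)‖ₑ ^ p.toReal ∂_) ^ (1 / p.toReal) ≤ _
    simp only [hH, enorm_mul, ENNReal.mul_rpow_of_nonneg _ _ hpp.le]
    rw [lintegral_const_mul _ (hF.measurable.enorm.pow_const _),
      ENNReal.mul_rpow_of_nonneg _ _ (by positivity), ENNReal.mul_rpow_of_nonneg _ _ (by positivity),
      ← ENNReal.rpow_mul, mul_one_div_cancel hpp.ne', ENNReal.rpow_one,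
      Real.enorm_of_nonneg (by positivity), ← mul_assoc, ENNReal.ofReal_mul (by positivity),
      ← ENNReal.ofReal_pow (by linarith)]
    gcongr
    -- Taking the `p`-th root could only improve the loss, which is at least `1`; this gain is
    -- discarded.
    calc ENNReal.ofReal (cubeLoss (recip q) n ^ N) ^ (1 / p.toReal)
        ≤ ENNReal.ofReal (cubeLoss (recip q) n ^ N) ^ (1 : ℝ) :=
          ENNReal.rpow_le_rpow_of_exponent_le (by
            rw [← ENNReal.ofReal_one]; exact ENNReal.ofReal_le_ofReal (one_le_pow₀ hK))
            (by rw [div_le_one hpp]; exact hp1)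
      _ = _ := ENNReal.rpow_one _
  rw [← toReal_eLpNorm hF.aestronglyMeasurable, ← toReal_eLpNorm hF.aestronglyMeasurable,
    ← ENNReal.toReal_ofReal (by positivity : 0 ≤ cubeLoss (recip q) n ^ N * cubeScale (recip q) n ^ n),
    ← ENNReal.toReal_mul]
  exact ENNReal.toReal_mono (ENNReal.mul_ne_top ENNReal.ofReal_ne_top
    (memLp_pi_lqLaw le_top n N hF p).2.ne) hI

/-- After cancelling `Γ (1 + t) ^ n`, the claim is that the loss fits into the slack of
superadditivity between `Γ (1 + n * t) ^ (n + 1)` and `Γ (1 + (n + 1) * t) ^ n`. The hypothesis `h`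
says exactly that `2 * n * t ^ 2 * √n` times the loss constant is at most `(n * t) ^ 2 / (4 * (1 + n
* t))`, for `t > 0`. -/
theorem vol_mul_cubeLoss_le {q : ℝ≥0∞} (hq : 1 ≤ q) {n N : ℕ} (hn : 1 ≤ n) (hN : N ≤ n + 1)
    (h : 8 * (103680000 * Real.exp 25) * Real.sqrt n * (1 + n * recip q) ≤ n) :
    vol (lqBall ∞ n) * (cubeLoss (recip q) n ^ N * cubeScale (recip q) n ^ n) ≤ vol (lqBall q n) := by
  have ht := recip_nonneg q
  set t := recip q with htdef
  have hn1 : (1 : ℝ) ≤ n := by exact_mod_cast hn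
  have hl := Gamma_one_add_pos ht
  have hG := Gamma_one_add_pos (s := n * t) (by positivity)
  have hG' := Gamma_one_add_pos (s := n * t + t) (by positivity)
  have hK := one_le_cubeLoss t n
  have hK0 : 0 < cubeLoss t n := by linarith
  rw [vol_lqBall hq, vol_lqBall le_top, recip_top, mul_zero, add_zero, Real.Gamma_one, ← htdef]
  have key : cubeLoss t n ^ N * Real.Gamma (1 + n * t) ^ (n + 1) ≤ Real.Gamma (1 + (n * t + t)) ^ n := by
    rw [← Real.log_le_log_iff (by positivity) (by positivity), Real.log_mul (by positivity) (by positivity),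
      Real.log_pow, Real.log_pow, Real.log_pow]
    -- The ratio `r = 1 + 1 / n` carries `n * t` to `(n + 1) * t`.
    have h1 := mul_log_Gamma_le (c := n * t) (r := 1 + 1 / n) (by positivity) (by simp)
    rw [show (1 + 1 / (n : ℝ)) * (n * t) = n * t + t by field_simp] at h1
    have h2 := mul_le_mul_of_nonneg_left h1 (Nat.cast_nonneg (α := ℝ) n)
    have h3 : (n : ℝ) * ((1 + 1 / (n : ℝ)) * Real.log (Real.Gamma (1 + n * t)) +
        (1 + 1 / (n : ℝ) - 1) * ((n * t) ^ 2 / (4 * (1 + n * t)))) =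
        (n + 1) * Real.log (Real.Gamma (1 + n * t)) + (n * t) ^ 2 / (4 * (1 + n * t)) := by
      field_simp; ring
    rw [h3] at h2
    have h4 : Real.log (cubeLoss t n) ≤ 518400 * (200 * Real.exp 25 * t ^ 2) * Real.sqrt n := by
      have := Real.log_le_sub_one_of_pos hK0
      rw [cubeLoss] at this ⊢
      linarith
    have h5 : (N : ℝ) ≤ 2 * n := by
      have : (N : ℝ) ≤ n + 1 := by exact_mod_cast hN
      linarith
    have h6 : (N : ℝ) * Real.log (cubeLoss t n) ≤
        2 * n * (518400 * (200 * Real.exp 25 * t ^ 2) * Real.sqrt n) :=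
      mul_le_mul h5 h4 (Real.log_nonneg hK) (by positivity)
    have h7 : 2 * n * (518400 * (200 * Real.exp 25 * t ^ 2) * Real.sqrt n) ≤
        (n * t) ^ 2 / (4 * (1 + n * t)) := by
      rw [le_div_iff₀ (by positivity)]
      have := mul_le_mul_of_nonneg_left h (by positivity : 0 ≤ n * t ^ 2)
      linarith
    push_cast
    linarith
  rw [cubeScale, mul_pow, div_pow, le_div_iff₀ hG]
  calc _ = 2 ^ n * Real.Gamma (1 + t) ^ n *
        (cubeLoss t n ^ N * Real.Gamma (1 + n * t) ^ (n + 1) / Real.Gamma (1 + (n * t + t)) ^ n) := by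
        rw [one_pow, pow_succ]; field_simp
    _ ≤ 2 ^ n * Real.Gamma (1 + t) ^ n * 1 := by
        refine mul_le_mul_of_nonneg_left ?_ (by positivity)
        rw [div_le_one (by positivity)]
        exact key
    _ = _ := mul_one _

theorem norms_le_of_mul_le {q : ℝ≥0∞} (hq : 1 ≤ q) {p : ℝ≥0∞} (hp : 1 ≤ p) (hp4 : p ≤ 4) {n : ℕ}
    (hn : 1 ≤ n) (h : 8 * (103680000 * Real.exp 25) * Real.sqrt n * (1 + n * recip q) ≤ n) :
    crosspolytopeNorm (lqBall q n) p ≤ crosspolytopeNorm (lqBall ∞ n) p ∧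
      simplexNorm (lqBall q n) p ≤ simplexNorm (lqBall ∞ n) p := by
  have hv := vol_lqBall_pos hq n
  have hv' := vol_lqBall_pos (q := ∞) le_top n
  have key : ∀ (C A A' : ℝ) (N : ℕ), 0 ≤ C → 0 ≤ A' → N ≤ n + 1 →
      A ≤ cubeLoss (recip q) n ^ N * cubeScale (recip q) n ^ n * A' →
      C / ((n ! : ℝ) * vol (lqBall q n)) * A ≤ C / ((n ! : ℝ) * vol (lqBall ∞ n)) * A' := by
    intro C A A' N hC hA' hN hA
    have h1 := vol_mul_cubeLoss_le hq hn hN h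
    have h2 : cubeLoss (recip q) n ^ N * cubeScale (recip q) n ^ n ≤
        vol (lqBall q n) / vol (lqBall ∞ n) := by
      rw [le_div_iff₀ hv', mul_comm]; exact h1
    calc _ ≤ C / ((n ! : ℝ) * vol (lqBall q n)) * (vol (lqBall q n) / vol (lqBall ∞ n) * A') :=
          mul_le_mul_of_nonneg_left (hA.trans (mul_le_mul_of_nonneg_right h2 hA')) (by positivity)
      _ = _ := by field_simp
  constructor
  · rw [crosspolytopeNorm_eq hq hn, crosspolytopeNorm_eq le_top hn]
    exact key _ _ _ n (by positivity) lpNorm_nonneg (by omega)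
      (lpNorm_le_of_affine hq hp hp4 (continuous_det_of n) det_update_affine det_of_smul)
  · rw [simplexNorm_eq hq, simplexNorm_eq le_top]
    exact key _ _ _ (n + 1) zero_le_one lpNorm_nonneg le_rfl
      (lpNorm_le_of_affine hq hp hp4 (continuous_simplexDet n) simplexDet_update_affine simplexDet_smul)

/-! ### Bounds uniform in `q` -/

/-- Only uniformity in `t` matters: it keeps `phiFun` bounded independently of `q`. -/
theorem momentRatio_le {t : ℝ} (ht : 0 ≤ t) (ht1 : t ≤ 1) : |momentRatio t - 3| ≤ 13824 := by
  have hl := Gamma_one_add_pos ht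
  have hl1 := Gamma_one_add_le_one ht ht1
  have hl2 := half_le_Gamma_one_add ht ht1
  have h5 := Gamma_one_add_five_mul_le ht ht1
  have h50 := Gamma_one_add_pos (s := 5 * t) (by positivity)
  have h3 : 1 / 8 ≤ Real.Gamma (1 + 3 * t) := by
    have := Gamma_pow_le_Gamma_mul ht (k := 3) (by norm_num)
    have h8 := pow_le_pow_left₀ (by norm_num) hl2 3
    norm_num at this h8
    linarith
  have hnum : Real.Gamma (1 + t) * Real.Gamma (1 + 5 * t) ≤ 1 * 120 :=
    mul_le_mul hl1 h5 h50.le zero_le_one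
  have hden : (1 / 8 : ℝ) ^ 2 ≤ Real.Gamma (1 + 3 * t) ^ 2 := pow_le_pow_left₀ (by norm_num) h3 2
  have h1 : momentRatio t ≤ 13824 := by
    rw [momentRatio, div_le_iff₀ (by positivity)]
    nlinarith
  have h0 : 0 ≤ momentRatio t := by rw [momentRatio]; positivity
  rw [abs_le]; constructor <;> linarith

theorem mul_phiFun_le (s : ℝ) (n : ℕ) :
    ((n : ℝ) + 1) * ((n : ℝ) + 2) * phiFun s n ≤ Real.exp |s| * (((n : ℝ) + 1) * ((n : ℝ) + 2)) := by
  rw [phiFun_eq_sum]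
  calc _ ≤ ∑ k ∈ Finset.range (n + 1), |s| ^ k / (k ! : ℝ) * (((n : ℝ) + 1) * ((n : ℝ) + 2)) := by
        refine Finset.sum_le_sum fun k hk => ?_
        have hk' : (k : ℝ) ≤ n := by
          have := Finset.mem_range.1 hk
          exact_mod_cast Nat.lt_succ_iff.1 this
        have hk0 : (0 : ℝ) ≤ k := k.cast_nonneg
        have h1 : s ^ k / (k ! : ℝ) ≤ |s| ^ k / (k ! : ℝ) := by
          rw [← abs_pow]; exact div_le_div_of_nonneg_right (le_abs_self _) (by positivity)
        have h2 : 0 ≤ ((n : ℝ) - k + 1) * ((n : ℝ) - k + 2) :=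
          mul_nonneg (by linarith) (by linarith)
        have h3 : ((n : ℝ) - k + 1) * ((n : ℝ) - k + 2) ≤ ((n : ℝ) + 1) * ((n : ℝ) + 2) :=
          mul_le_mul (by linarith) (by linarith) (by linarith) (by positivity)
        exact mul_le_mul h1 h3 h2 (by positivity)
    _ = (∑ k ∈ Finset.range (n + 1), |s| ^ k / (k ! : ℝ)) * (((n : ℝ) + 1) * ((n : ℝ) + 2)) :=
        (Finset.sum_mul _ _ _).symm
    _ ≤ _ := mul_le_mul_of_nonneg_right (Real.sum_le_exp_of_nonneg (abs_nonneg s) _) (by positivity)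

theorem Gamma_sq_le_Gamma_mul_Gamma {a b : ℝ} (ha : 0 < a) (hb : 0 < b) :
    Real.Gamma ((a + b) / 2) ^ 2 ≤ Real.Gamma a * Real.Gamma b := by
  have hA := Real.Gamma_pos_of_pos ha
  have hB := Real.Gamma_pos_of_pos hb
  have hC := Real.Gamma_pos_of_pos (by positivity : 0 < (a + b) / 2)
  have h := Real.convexOn_log_Gamma.2 (Set.mem_Ioi.2 ha) (Set.mem_Ioi.2 hb)
    (by norm_num : (0 : ℝ) ≤ 1 / 2) (by norm_num : (0 : ℝ) ≤ 1 / 2) (by norm_num)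
  simp only [smul_eq_mul, Function.comp_apply] at h
  rw [show 1 / 2 * a + 1 / 2 * b = (a + b) / 2 by ring] at h
  rw [← Real.log_le_log_iff (by positivity) (by positivity), Real.log_pow,
    Real.log_mul hA.ne' hB.ne']
  push_cast
  linarith

/-- Log-convexity gives `Γ (1 + (n + 2) * t) ^ 2 ≤ Γ (1 + n * t) * Γ (1 + (n + 4) * t)`, so the
terms raised to the power `n` compare favourably and only a polynomial factor in `n` remains,
uniformly in `q`. -/
theorem crosspolytopeMoment_four_le {q : ℝ≥0∞} (hq : 1 ≤ q) {n : ℕ} (hn : 1 ≤ n) :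
    crosspolytopeMoment (lqBall q n) 4 ≤
      Real.exp 13824 * (((n : ℝ) + 1) * ((n : ℝ) + 2)) * crosspolytopeMoment (lqBall q n) 2 ^ 2 := by
  have ht := recip_nonneg q
  have ht1 := recip_le_one hq
  have h1 := Gamma_one_add_pos ht
  have h3 := Gamma_one_add_pos (s := 3 * recip q) (by positivity)
  have g0 := Gamma_one_add_pos (s := n * recip q) (by positivity)
  have g2 := Gamma_one_add_pos (s := ((n : ℝ) + 2) * recip q) (by positivity)
  have g4 := Gamma_one_add_pos (s := ((n : ℝ) + 4) * recip q) (by positivity)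
  have hconv := Gamma_sq_le_Gamma_mul_Gamma (a := 1 + n * recip q) (b := 1 + ((n : ℝ) + 4) * recip q)
    (by positivity) (by positivity)
  rw [show (1 + n * recip q + (1 + ((n : ℝ) + 4) * recip q)) / 2 = 1 + ((n : ℝ) + 2) * recip q by ring]
    at hconv
  have hphi := (mul_phiFun_le (momentRatio (recip q) - 3) n).trans
    (mul_le_mul_of_nonneg_right (Real.exp_le_exp.2 (momentRatio_le ht ht1)) (by positivity))
  rw [crosspolytopeMoment_four hq hn, crosspolytopeMoment_two hq hn]
  set l := Real.Gamma (1 + recip q)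
  set G3 := Real.Gamma (1 + 3 * recip q)
  set G0 := Real.Gamma (1 + n * recip q)
  set G2 := Real.Gamma (1 + ((n : ℝ) + 2) * recip q)
  set G4 := Real.Gamma (1 + ((n : ℝ) + 4) * recip q)
  set P := ((n : ℝ) + 1) * ((n : ℝ) + 2)
  set f := phiFun (momentRatio (recip q) - 3) n
  have hbase : G3 ^ 2 * G0 / (9 * l ^ 6 * G4) ≤ (G3 * G0 / (3 * l ^ 3 * G2)) ^ 2 := by
    rw [div_pow, div_le_div_iff₀ (by positivity) (by positivity)]
    calc G3 ^ 2 * G0 * (3 * l ^ 3 * G2) ^ 2 = 9 * G3 ^ 2 * G0 * l ^ 6 * G2 ^ 2 := by ring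
      _ ≤ 9 * G3 ^ 2 * G0 * l ^ 6 * (G0 * G4) := mul_le_mul_of_nonneg_left hconv (by positivity)
      _ = _ := by ring
  have hpow := pow_le_pow_left₀ (by positivity) hbase n
  calc _ = (P * f) * ((1 / (2 * (n ! : ℝ) ^ 2)) * (G3 ^ 2 * G0 / (9 * l ^ 6 * G4)) ^ n * G0 ^ 4) := by
        ring
    _ ≤ (Real.exp 13824 * P) * ((1 / (2 * (n ! : ℝ) ^ 2)) * (G3 ^ 2 * G0 / (9 * l ^ 6 * G4)) ^ n *
          G0 ^ 4) := mul_le_mul_of_nonneg_right hphi (by positivity)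
    _ ≤ (Real.exp 13824 * P) * ((1 / (1 * (n ! : ℝ) ^ 2)) * ((G3 * G0 / (3 * l ^ 3 * G2)) ^ 2) ^ n *
          G0 ^ 4) := by
        gcongr
        norm_num
    _ = _ := by
        generalize G3 * G0 / (3 * l ^ 3 * G2) = X
        ring

/-- With `c = n * t`, the Gamma estimates make all terms in `c * log c` cancel, leaving `-(2 - log
6) * c` and a logarithmic error. The second moment thus decays exponentially in `n / q` relative to
the cube. -/
theorem log_crosspolytopeMoment_two_sub_le {q : ℝ≥0∞} (hq : 1 ≤ q) {n : ℕ} (hn : 1 ≤ n)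
    (hc : 0 < n * recip q) :
    Real.log (crosspolytopeMoment (lqBall q n) 2) - Real.log (crosspolytopeMoment (lqBall ∞ n) 2) ≤
      -(1 / 10) * (n * recip q) + 2 + 2 * Real.log (1 + n * recip q) := by
  have ht := recip_nonneg q
  rw [log_crosspolytopeMoment_two hq hn, log_crosspolytopeMoment_two le_top hn]
  simp only [recip_top, mul_zero, add_zero, Real.Gamma_one, Real.log_one, sub_zero, zero_sub]
  have h1 := log_Gamma_three_mul_le ht (recip_le_one hq)
  have h2 := mul_log_le_log_Gamma_sub hc (by positivity : 0 ≤ 2 * recip q)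
  rw [show 1 + (n * recip q + 2 * recip q) = 1 + ((n : ℝ) + 2) * recip q by ring] at h2
  have h3 := log_Gamma_le_mul_log_sub hc.le
  have h4 := two_sub_log_six_pos
  have hn0 : (0 : ℝ) ≤ n := n.cast_nonneg
  have h5 := mul_le_mul_of_nonneg_left h1 hn0
  have h6 := mul_le_mul_of_nonneg_left h2 hn0
  have h7 := mul_le_mul_of_nonneg_left h4.le hc.le
  nlinarith

theorem log_crosspolytopeNorm_top_ge {p : ℝ≥0∞} (hp : 1 ≤ p) {n : ℕ} (hn : 1 ≤ n)
    (h4 : 0 < crosspolytopeMoment (lqBall ∞ n) 4) :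
    1 / 2 * Real.log (crosspolytopeMoment (lqBall ∞ n) 2)
      - 1 / 2 * Real.log (Real.exp 13824 * (((n : ℝ) + 1) * ((n : ℝ) + 2))) - 3 / 2 * Real.log 2 ≤
      Real.log (crosspolytopeNorm (lqBall ∞ n) p) := by
  have h2 := crosspolytopeMoment_two_pos (q := ∞) le_top hn
  have h := (log_crosspolytopeNorm_ge le_top hn hp h4).2
  have hle := Real.log_le_log h4 (crosspolytopeMoment_four_le le_top hn)
  rw [Real.log_mul (by positivity) (by positivity), Real.log_pow] at hle
  push_cast at hle
  linarith

theorem crosspolytopeNorm_le_exp {q : ℝ≥0∞} (hq : 1 ≤ q) {p : ℝ≥0∞} (hp4 : p ≤ 4) {n : ℕ} (hn : 1 ≤ n) :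
    crosspolytopeNorm (lqBall q n) p ≤
      Real.exp (1 / 2 * Real.log (crosspolytopeMoment (lqBall q n) 2) +
        1 / 4 * Real.log (Real.exp 13824 * (((n : ℝ) + 1) * ((n : ℝ) + 2)))) := by
  have h2 := crosspolytopeMoment_two_pos hq hn
  refine (crosspolytopeNorm_le_four hq hn hp4).trans ?_
  have h0 : 0 ≤ crosspolytopeMoment (lqBall q n) 4 :=
    integral_nonneg fun x => pow_nonneg (crosspolytopeVol_nonneg _ _) 4
  refine (Real.rpow_le_rpow h0 (crosspolytopeMoment_four_le hq hn) (by norm_num)).trans (le_of_eq ?_)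
  rw [Real.rpow_def_of_pos (by positivity), Real.log_mul (by positivity) (by positivity), Real.log_pow]
  congr 1
  push_cast
  ring

/-! ### The two regimes for `n / q` -/

theorem eventually_log_le_sqrt {a b k : ℝ} (ha : 0 < a) :
    ∀ᶠ n : ℕ in atTop, b + k * Real.log ((n : ℝ) + 1) ≤ a * Real.sqrt n := by
  have h1 : Tendsto (fun x : ℝ => Real.log x / x ^ (1 / 2 : ℝ)) atTop (nhds 0) :=
    (isLittleO_log_rpow_atTop (by norm_num)).tendsto_div_nhds_zero
  have h2 : Tendsto (fun n : ℕ => (n : ℝ) + 1) atTop atTop :=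
    tendsto_atTop_add_const_right _ _ tendsto_natCast_atTop_atTop
  have h3 : Tendsto (fun n : ℕ => b / ((n : ℝ) + 1) ^ (1 / 2 : ℝ)) atTop (nhds 0) :=
    tendsto_const_nhds.div_atTop ((tendsto_rpow_atTop (by norm_num)).comp h2)
  have h4 := h3.add ((h1.comp h2).const_mul k)
  rw [mul_zero, add_zero] at h4
  filter_upwards [h4.eventually (gt_mem_nhds (by positivity : 0 < a / 2)), eventually_ge_atTop 1]
    with n hn hn1
  have hn1' : (1 : ℝ) ≤ n := by exact_mod_cast hn1
  simp only [Function.comp_apply] at hn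
  rw [← mul_div_assoc, ← add_div, ← Real.sqrt_eq_rpow, div_lt_iff₀ (by positivity)] at hn
  have h5 : Real.sqrt ((n : ℝ) + 1) ≤ 2 * Real.sqrt n := by
    rw [Real.sqrt_le_left (by positivity), mul_pow, Real.sq_sqrt (by positivity)]
    linarith
  nlinarith

theorem eventually_norms_le {p : ℝ≥0∞} (hp : 1 ≤ p) (hp4 : p ≤ 4) :
    ∃ n₀ : ℕ, ∀ n : ℕ, n₀ ≤ n → ∀ q : ℝ≥0∞, 1 ≤ q →
      crosspolytopeNorm (lqBall q n) p ≤ crosspolytopeNorm (lqBall ∞ n) p ∧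
      simplexNorm (lqBall q n) p ≤ simplexNorm (lqBall ∞ n) p := by
  set A := 8 * (103680000 * Real.exp 25) with hA
  have hA0 : 0 < A := by positivity
  have hlarge := eventually_log_le_sqrt (a := 1 / A) (b := 2) (k := 0) (by positivity)
  have hlog := eventually_log_le_sqrt (a := 1 / (40 * A))
    (b := 1 / 40 + 1 + Real.log 40 + 3 / 4 * (13824 + Real.log 2) + 3 / 2 * Real.log 2) (k := 5 / 2)
    (by positivity)
  obtain ⟨n₀, h₀⟩ := eventually_atTop.1 ((hlarge.and hlog).and ((eventually_ge_atTop 1).and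
    (eventually_crosspolytopeMoment_four_pos (q := ∞) le_top)))
  refine ⟨n₀, fun n hn q hq => ?_⟩
  obtain ⟨⟨hl, hlg⟩, hn1, hpos⟩ := h₀ n hn
  have hn1' : (1 : ℝ) ≤ n := by exact_mod_cast hn1
  -- For small `n * recip q` the row replacement argument applies directly. Otherwise `1 + n * recip
  -- q` exceeds `√n / A`.
  rcases le_or_gt (A * Real.sqrt n * (1 + n * recip q)) n with h | h
  · exact norms_le_of_mul_le hq hp hp4 hn1 h
  set c := n * recip q with hc
  have hs : 0 < Real.sqrt n := Real.sqrt_pos.2 (by linarith)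
  have hss : Real.sqrt n * Real.sqrt n = n := Real.mul_self_sqrt (by linarith)
  have hc1 : 1 / A * Real.sqrt n < 1 + c := by
    have : A * Real.sqrt n * (1 / A * Real.sqrt n) < A * Real.sqrt n * (1 + c) := by
      refine lt_of_eq_of_lt ?_ h
      rw [show A * Real.sqrt n * (1 / A * Real.sqrt n) = Real.sqrt n * Real.sqrt n by field_simp, hss]
    exact lt_of_mul_lt_mul_left this (by positivity)
  have hcpos : 0 < c := by linarith
  -- The extra factor `n + 1` is proved here so that the same estimate settles U through the
  -- two-sided comparison of U with V.
  have hV : ((n : ℝ) + 1) * crosspolytopeNorm (lqBall q n) p ≤ crosspolytopeNorm (lqBall ∞ n) p := by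
    have hVpos := (log_crosspolytopeNorm_ge (q := ∞) le_top hn1 hp hpos).1
    rw [← Real.exp_log hVpos]
    refine (mul_le_mul_of_nonneg_left (crosspolytopeNorm_le_exp hq hp4 hn1) (by positivity)).trans ?_
    nth_rewrite 1 [← Real.exp_log (by positivity : (0 : ℝ) < n + 1)]
    rw [← Real.exp_add]
    refine Real.exp_le_exp.2 (le_trans ?_ (log_crosspolytopeNorm_top_ge hp hn1 hpos))
    have h1 := log_crosspolytopeMoment_two_sub_le hq hn1 hcpos
    rw [← hc] at h1
    -- The bound on `log (1 + c)` with slope `1 / 40` uses half of the decay `c / 20`. The rest, of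
    -- order `√n`, beats the constants and the powers of `n`.
    have h2 := Real.log_le_sub_one_of_pos (by positivity : 0 < (1 + c) / 40)
    rw [Real.log_div (by positivity) (by positivity)] at h2
    have h3 : Real.log (Real.exp 13824 * (((n : ℝ) + 1) * ((n : ℝ) + 2))) ≤
        13824 + Real.log 2 + 2 * Real.log ((n : ℝ) + 1) := by
      rw [Real.log_mul (by positivity) (by positivity), Real.log_exp,
        Real.log_mul (by positivity) (by positivity)]
      have : Real.log ((n : ℝ) + 2) ≤ Real.log (2 * ((n : ℝ) + 1)) :=
        Real.log_le_log (by positivity) (by linarith)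
      rw [Real.log_mul (by positivity) (by positivity)] at this
      linarith
    have h4 : 1 / (40 * A) * Real.sqrt n < (1 + c) / 40 := by
      have : 1 / (40 * A) * Real.sqrt n = 1 / A * Real.sqrt n / 40 := by field_simp
      rw [this]; linarith
    linarith
  have hV0 : 0 ≤ crosspolytopeNorm (lqBall q n) p := lpNorm_nonneg
  constructor
  · nlinarith
  · have h1 := simplexNorm_le_crosspolytopeNorm hq hn1 hp
    have h2 := crosspolytopeNorm_le_simplexNorm (q := ∞) le_top hn1 hp
    exact le_of_mul_le_mul_left (h1.trans (hV.trans h2)) (by positivity)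


/-! ### The theorem -/

theorem mainTheorem1 :
    -- the second and fourth moments of `V`, together with the meaning of the constant `A_q`
    (∀ q : ℝ≥0∞, 1 ≤ q → ∀ n : ℕ, 1 ≤ n →
      (∀ i j : Fin n, i ≠ j →
        (∫ x in lqBall q n, x i ^ 4) / (∫ x in lqBall q n, x i ^ 2 * x j ^ 2)
          = momentRatio (recip q)) ∧
      crosspolytopeMoment (lqBall q n) 2 =
        1 / (n ! : ℝ) *
          (Real.Gamma (1 + 3 * recip q) * Real.Gamma (1 + n * recip q) /
            (3 * Real.Gamma (1 + recip q) ^ 3 *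
              Real.Gamma (1 + ((n : ℝ) + 2) * recip q))) ^ n *
          Real.Gamma (1 + n * recip q) ^ 2 ∧
      crosspolytopeMoment (lqBall q n) 4 =
        ((n : ℝ) + 1) * ((n : ℝ) + 2) / (2 * (n ! : ℝ) ^ 2) *
          (Real.Gamma (1 + 3 * recip q) ^ 2 * Real.Gamma (1 + n * recip q) /
            (9 * Real.Gamma (1 + recip q) ^ 6 *
              Real.Gamma (1 + ((n : ℝ) + 4) * recip q))) ^ n *
          Real.Gamma (1 + n * recip q) ^ 4 *
          phiFun (momentRatio (recip q) - 3) n) ∧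
    -- asymptotics of the second and fourth moments of `V`
    (∀ q : ℝ≥0∞, 1 ≤ q →
      (fun n : ℕ => crosspolytopeMoment (lqBall q n) 2 ^ (1 / (n : ℝ))) ~[atTop]
        (fun n : ℕ => alphaFun (recip q) * (n : ℝ)⁻¹) ∧
      (fun n : ℕ => crosspolytopeMoment (lqBall q n) 4 ^ (1 / (n : ℝ))) ~[atTop]
        (fun n : ℕ => alphaFun (recip q) ^ 2 * ((n : ℝ) ^ 2)⁻¹)) ∧
    -- asymptotics of the `p`-norms of `V` and `U`
    (∀ p q : ℝ≥0∞, 1 ≤ p → p ≤ 4 → 1 ≤ q →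
      (fun n : ℕ => crosspolytopeNorm (lqBall q n) p ^ (1 / (n : ℝ))) ~[atTop]
        (fun n : ℕ => Real.sqrt (alphaFun (recip q)) * (n : ℝ) ^ (-(1 / 2) : ℝ)) ∧
      (fun n : ℕ => simplexNorm (lqBall q n) p ^ (1 / (n : ℝ))) ~[atTop]
        (fun n : ℕ => 1 / 2 * Real.sqrt (alphaFun (recip q)) * (n : ℝ) ^ (-(1 / 2) : ℝ))) ∧
    -- `α` is maximal at `0`, and for large `n` the norms are maximal at `q = ∞`
    IsMaxOn alphaFun (Set.Icc 0 1) 0 ∧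
    (∀ p : ℝ≥0∞, 1 ≤ p → p ≤ 4 → ∃ n₀ : ℕ, ∀ n : ℕ, n₀ ≤ n → ∀ q : ℝ≥0∞, 1 ≤ q →
      crosspolytopeNorm (lqBall q n) p ≤ crosspolytopeNorm (lqBall ∞ n) p ∧
      simplexNorm (lqBall q n) p ≤ simplexNorm (lqBall ∞ n) p) := by
  exact ⟨fun q hq n hn => ⟨fun i j hij => lqBall_moment_ratio hq hij, crosspolytopeMoment_two hq hn,
      crosspolytopeMoment_four hq hn⟩,
    fun q hq => isEquivalent_crosspolytopeMoment hq,
    fun p q hp hp4 hq => isEquivalent_norms hp hp4 hq,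
    isMaxOn_alphaFun,
    fun p hp hp4 => eventually_norms_le hp hp4⟩
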